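/- **Setting.** $N$ is a finite non-empty set of agents, $X$ a set of outcomes; each agent $i$ has a type space $\Theta_i$, and each type $\theta_i$ has a complete and transitive preference $R(\theta_i)$ over $X$. Put $\Theta=\prod_i\Theta_i$. An SCF $f:\Theta\to X$ is strategy-proof (SP) if $f(\theta_i,\theta_{-i})\,R(\theta_i)\,f(\theta_i',\theta_{-i})$ always. A gradual mechanism (GM) $G$ implementing $f$ is a dynamic game form of bounded length with perfect recall, with simultaneous moves allowed and every agent active (possibly with a single action) at the initial history $\varnothing$, such that: the actions of $i$ are non-empty subsets of $\Theta_i$; at each decision node $h$ of $i$ the available actions partition $\Theta_i(h)$, the last action of $i$ at $h$ ($\Theta_i(h)=\Theta_i$ if $i$ has not acted); and the outcome of a terminal history $z$ is $f(\theta)$ for every $\theta\in\Theta(z)=\prod_i\Theta_i(z)$. A strategy of $i$ (measurable with respect to her information sets) is unconditional for $\theta_i$ if it chooses an action containing $\theta_i$ at each decision node $h$ with $\theta_i\in\Theta_i(h)$. $G$ is incentive compatible (IC) if for all $i$ and $\theta_i$, every unconditional strategy for $\theta_i$ is, for type $\theta_i$, at least as good as every other strategy of $i$ against every profile of strategies of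 the others. In the direct mechanism of $f$, all agents simultaneously report their types at $\varnothing$. For a set $I$ of histories let $\Theta_i(I)=\bigcup_{h\in I}\Theta_i(h)$ and $\Theta_{-i}(I)=\bigcup_{h\in I}\prod_{j\ne i}\Theta_j(h)$. **Transformations** (each turns a GM implementing $f$ into a GM implementing $f$). * *SPL*: for an information set $I$ of $i$, an action $a$ available at $I$ and a partition $\{a^1,a^2\}$ of $a$ into non-empty sets, the (non-empty) set of terminal histories $z$ that follow $I$ with $\Theta_i(z)=a$ becomes a new information set of $i$, at which she chooses between $a^1$ and $a^2$. * *COA*: if an information set $J$ of $i$ is an immediate successor of her information set $I$ following action $a$, and $\Theta_{-i}(I)=\Theta_{-i}(J)$, then the actions available at $J$ are moved to $I$, where they replace $a$, and $J$ disappears. * *ILL*: an information set $I$ of $i$ is partitioned into two non-empty sets $I^1,I^2$, and the later information sets of $i$ are partitioned accordingly; nothing else changes. A type profile $\theta$ is consistent with strategies $s_M$ of the agents in $M$ if $s_M$ has a completion that reaches the terminal history $z$ with $\theta\in\Theta(z)$. The ILL is *incentive-preserving* if, for each of the two labellings of the parts of $I$ as $I^1,I^2$, for every $j\neq i$ and all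 $\theta^1,\theta^2\in\Theta$ with $\theta_i^1,\theta_i^2\in\Theta_i(I)$, $\theta^1_{-i}\in\Theta_{-i}(I^1)$, $\theta^2_{-i}\in\Theta_{-i}(I^2)$ that are consistent with a common profile $s_{-i,j}$ of strategies of the agents other than $i,j$, one has $f(\theta^1)\,R(\theta^1_j)\,f(\theta^2)$. **Theorem.** Let $f$ be strategy-proof and let $G$ be a GM implementing $f$. 1. If all $\Theta_i$ are finite and, after $\varnothing$, no agent $i$ is active at a history $h$ at which $\Theta_i(h)$ is a singleton, then some finite chain of SPLs, COAs and inverse ILLs transforms $G$ into the direct mechanism of $f$. 2. For every finite chain of SPLs, COAs and inverse ILLs that transforms $G$ into the direct mechanism of $f$: $G$ is IC if and only if all the ILLs whose inverses occur in the chain are incentive-preserving. -/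

import Mathlib

universe u v w

/-! ### Histories -/

/-- An action profile: `p i = some a` if player `i` is active and takes `a`, `p i = none` if player
`i` is not active. -/
abbrev ActionProfile {N : Type u} (Act : N → Type v) := (i : N) → Option (Act i)

/-- A history is a finite sequence of action profiles, ordered by the prefix relation `<+:`. -/
abbrev History {N : Type u} (Act : N → Type v) := List (ActionProfile Act)

section Trees

variable {N : Type u} {Act : N → Type v}

/-- Strict precedence of histories. -/
def Precedes (h k : History Act) : Prop := h <+: k ∧ h ≠ k

/-- `h` is a decision node of player `i` in the tree `H`. -/
def ActiveAt (H : Set (History Act)) (i : N) (h : History Act) : Prop :=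
  ∃ p : ActionProfile Act, h ++ [p] ∈ H ∧ (p i).isSome

/-- The actions available to player `i` at `h`. -/
def availableAt (H : Set (History Act)) (i : N) (h : History Act) : Set (Act i) :=
  {a | ∃ p : ActionProfile Act, h ++ [p] ∈ H ∧ p i = some a}

/-- The sequence of decisions made by player `i` along `h`. -/
def decisions (i : N) (h : History Act) : List (Act i) := h.filterMap fun p => p i

/-- The information set `I` weakly precedes the history `k`. -/
def SetPrecEq (I : Set (History Act)) (k : History Act) : Prop := ∃ h ∈ I, h <+: k

/-- The information set `I` strictly precedes the history `k`. -/
def SetPrec (I : Set (History Act)) (k : History Act) : Prop := ∃ h ∈ I, Precedes h k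

/-- Weak precedence of information sets. -/
def InfoPrecEq (I J : Set (History Act)) : Prop := ∃ k ∈ J, SetPrecEq I k

/-- Strict precedence of information sets. -/
def InfoPrec (I J : Set (History Act)) : Prop := ∃ k ∈ J, SetPrec I k

end Trees

/-! ### Dynamic game forms with perfect recall -/

/-- A dynamic game form with perfect recall, with players `N`, actions `Act i` and outcomes `X`.
Every player is active (possibly with a single action) at the initial history. The outcome function
is only meaningful at terminal histories. -/
structure GameForm {N : Type u} (Act : N → Type v) (X : Type w) where
  /-- all histories, terminal or not -/
  hist : Set (History Act)
  /-- the information sets of each player -/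
  info : N → Set (Set (History Act))
  /-- the outcome function -/
  outcome : History Act → X
  nil_mem : [] ∈ hist
  prefix_mem : ∀ h p, h ++ [p] ∈ hist → h ∈ hist
  bounded : ∃ T : ℕ, ∀ h ∈ hist, h.length ≤ T
  /-- every action profile that is played is non-empty -/
  profile_nonempty : ∀ h p, h ++ [p] ∈ hist → ∃ i, (p i).isSome
  /-- the set of active players depends only on the history -/
  active_uniform : ∀ h p i, h ++ [p] ∈ hist → ActiveAt hist i h → (p i).isSome
  /-- all combinations of available actions of the active players are possible -/
  product : ∀ h : History Act, (∃ q, h ++ [q] ∈ hist) → ∀ p : ActionProfile Act,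
    (∀ i, ActiveAt hist i h → ∃ a ∈ availableAt hist i h, p i = some a) →
    (∀ i, ¬ ActiveAt hist i h → p i = none) → h ++ [p] ∈ hist
  root_active : ∀ i, ActiveAt hist i []
  /-- the information sets of a player partition her decision nodes -/
  info_nonempty : ∀ i, ∀ I ∈ info i, I.Nonempty
  info_active : ∀ i, ∀ I ∈ info i, ∀ h ∈ I, ActiveAt hist i h
  info_cover : ∀ i h, ActiveAt hist i h → ∃! I, I ∈ info i ∧ h ∈ I
  info_available : ∀ i, ∀ I ∈ info i, ∀ h ∈ I, ∀ k ∈ I,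
    availableAt hist i h = availableAt hist i k
  /-- perfect recall: own decisions -/
  recall_decisions : ∀ i, ∀ I ∈ info i, ∀ h ∈ I, ∀ k ∈ I, decisions i h = decisions i k
  /-- perfect recall: own information sets -/
  recall_info : ∀ i, ∀ I ∈ info i, ∀ h ∈ I, ∀ k ∈ I, ∀ g, g <+: h → ActiveAt hist i g →
    ∃ g₂, g₂ <+: k ∧ ∃ J ∈ info i, g ∈ J ∧ g₂ ∈ J

namespace GameForm

variable {N : Type u} {Act : N → Type v} {X : Type w}

/-- Player `i` is active at `h`. -/
abbrev Active (G : GameForm Act X) (i : N) (h : History Act) : Prop := ActiveAt G.hist i h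

/-- The actions available to player `i` at `h`. -/
abbrev available (G : GameForm Act X) (i : N) (h : History Act) : Set (Act i) :=
  availableAt G.hist i h

/-- `a` is available to player `i` at the information set `I`. -/
def AvailableAtInfo (G : GameForm Act X) (i : N) (I : Set (History Act)) (a : Act i) : Prop :=
  ∃ h ∈ I, a ∈ G.available i h

/-- Terminal histories. -/
def Terminal (G : GameForm Act X) (h : History Act) : Prop :=
  h ∈ G.hist ∧ ∀ p, h ++ [p] ∉ G.hist

/-- `J` is an immediate successor of `I` among the information sets of player `i`, consistent with
her choosing `a` at `I`. -/
def ImmediateSucc (G : GameForm Act X) (i : N) (I : Set (History Act)) (a : Act i)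
    (J : Set (History Act)) : Prop :=
  I ∈ G.info i ∧ J ∈ G.info i ∧ InfoPrec I J ∧
  (¬ ∃ K ∈ G.info i, InfoPrec I K ∧ InfoPrec K J) ∧
  ∃ h ∈ I, ∃ k ∈ J, ∃ p : ActionProfile Act, p i = some a ∧ h ++ [p] <+: k

/-- A pure (interim) strategy of player `i`: an available action at each of her decision nodes,
the same one throughout an information set. Values off her decision nodes play no role. -/
structure Strategy (G : GameForm Act X) (i : N) where
  act : History Act → Act i
  act_mem : ∀ h, G.Active i h → act h ∈ G.available i h
  act_info : ∀ I ∈ G.info i, ∀ h ∈ I, ∀ k ∈ I, act h = act k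

/-- `h` is on the path determined by the strategy profile `s`. -/
def OnPath (G : GameForm Act X) (s : (i : N) → G.Strategy i) (h : History Act) : Prop :=
  h ∈ G.hist ∧ ∀ g p, g ++ [p] <+: h → ∀ i, G.Active i g → p i = some ((s i).act g)

theorem OnPath.prefix_of_length_le {G : GameForm Act X} {s : (i : N) → G.Strategy i}
    {k : History Act} (hk : G.OnPath s k) (h : History Act) :
    G.OnPath s h → h.length ≤ k.length → h <+: k := by
  induction h using List.reverseRecOn with
  | nil => intro _ _; exact List.nil_prefix
  | append_singleton h p ih =>
    intro hh hl
    have hh0 : G.OnPath s h := ⟨G.prefix_mem _ _ hh.1, fun g q hq i hi =>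
      hh.2 g q (hq.trans (List.prefix_append h [p])) i hi⟩
    rw [List.length_append, List.length_singleton] at hl
    obtain ⟨t, rfl⟩ := ih hh0 (by omega)
    cases t with
    | nil => simp at hl
    | cons q r =>
      have hpre : h ++ [q] <+: h ++ q :: r := ⟨r, by simp⟩
      have hmem : ∀ r' : History Act, h ++ q :: r' ∈ G.hist → h ++ [q] ∈ G.hist := by
        intro r'
        induction r' using List.reverseRecOn with
        | nil => exact id
        | append_singleton r' x ih' =>
          intro hx
          refine ih' (G.prefix_mem _ x ?_)
          simpa using hx
      have hq := hmem r hk.1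
      have : p = q := by
        funext i
        by_cases hi : G.Active i h
        · rw [hh.2 h p (List.prefix_refl _) i hi, hk.2 h q hpre i hi]
        · have h1 : p i = none := by
            by_contra hne
            exact hi ⟨p, hh.1, Option.isSome_iff_ne_none.2 hne⟩
          have h2 : q i = none := by
            by_contra hne
            exact hi ⟨q, hq, Option.isSome_iff_ne_none.2 hne⟩
          rw [h1, h2]
      subst this
      exact hpre

/-- A strategy profile determines exactly one terminal history. -/
theorem existsUnique_terminal (G : GameForm Act X) (s : (i : N) → G.Strategy i) :
    ∃! z, G.Terminal z ∧ G.OnPath s z := by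
  classical
  obtain ⟨T, hT⟩ := G.bounded
  have hroot : G.OnPath s [] := ⟨G.nil_mem, fun g p h => by simp at h⟩
  have hex : ∃ n, n ≤ T ∧ ∃ h, G.OnPath s h ∧ T - h.length = n :=
    ⟨T, le_refl _, [], hroot, by simp⟩
  obtain ⟨-, z, hz, hzn⟩ := Nat.find_spec hex
  have hmax : ∀ h, G.OnPath s h → h.length ≤ z.length := by
    intro h hh
    have h1 := Nat.find_min' hex ⟨Nat.sub_le _ _, h, hh, rfl⟩
    have h2 := hT h hh.1
    have h3 := hT z hz.1
    omega
  have hterm : G.Terminal z := by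
    refine ⟨hz.1, fun q hq => ?_⟩
    let p : ActionProfile Act := fun i => if G.Active i z then some ((s i).act z) else none
    have hp : z ++ [p] ∈ G.hist := by
      refine G.product z ⟨q, hq⟩ p (fun i hi => ⟨_, (s i).act_mem z hi, ?_⟩) (fun i hi => ?_)
      · exact if_pos hi
      · exact if_neg hi
    have hon : G.OnPath s (z ++ [p]) := by
      refine ⟨hp, fun g r hr i hi => ?_⟩
      rcases List.prefix_concat_iff.1 (by simpa using hr) with h | h
      · obtain ⟨rfl, h2⟩ := List.append_inj' h rfl
        have h3 : r = p := by simpa using h2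
        subst h3
        exact if_pos hi
      · exact hz.2 g r h i hi
    have := hmax _ hon
    simp at this
  refine ⟨z, ⟨hterm, hz⟩, ?_⟩
  rintro y ⟨hy, hyp⟩
  obtain ⟨t, ht⟩ := hz.prefix_of_length_le y hyp (hmax y hyp)
  cases t with
  | nil => simpa using ht
  | cons q r =>
    exfalso
    have hzy := OnPath.prefix_of_length_le hyp z hz
    have hmem : ∀ r' : History Act, y ++ q :: r' ∈ G.hist → y ++ [q] ∈ G.hist := by
      intro r'
      induction r' using List.reverseRecOn with
      | nil => exact id
      | append_singleton r' x ih' =>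
        intro hx
        refine ih' (G.prefix_mem _ x ?_)
        simpa using hx
    exact hy.2 q (hmem r (ht ▸ hz.1))

/-- The terminal history `z(s)` determined by the strategy profile `s`. -/
noncomputable def play (G : GameForm Act X) (s : (i : N) → G.Strategy i) : History Act :=
  (G.existsUnique_terminal s).choose

/-- The outcome of a strategy profile. -/
noncomputable def outcomeOf (G : GameForm Act X) (s : (i : N) → G.Strategy i) : X :=
  G.outcome (G.play s)

/-- The history `h` is consistent with the incomplete strategy profile `σ` of the players in `M`. -/
def HistConsistent (G : GameForm Act X) (M : Set N) (σ : (k : M) → G.Strategy k)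
    (h : History Act) : Prop :=
  ∃ s : (i : N) → G.Strategy i, (∀ k : M, s k = σ k) ∧ h <+: G.play s

end GameForm

/-! ### Social choice functions -/

/-- Strategy-proofness; `R i t x y` says that type `t` of agent `i` weakly prefers `x` to `y`. -/
def StrategyProof {N : Type u} {Θ : N → Type v} {X : Type w}
    (R : (i : N) → Θ i → X → X → Prop) (f : ((i : N) → Θ i) → X) : Prop :=
  ∀ (i : N) (θ θ₂ : (i : N) → Θ i), (∀ j, j ≠ i → θ j = θ₂ j) → R i (θ i) (f θ) (f θ₂)

/-! ### Gradual mechanisms -/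

/-- The actions of a gradual mechanism: non-empty sets of own types. -/
abbrev Report {N : Type u} (Θ : N → Type v) (i : N) : Type v := {a : Set (Θ i) // a.Nonempty}

section Reports

variable {N : Type u} {Θ : N → Type v}

/-- `Θ_i(h)`: the last action of agent `i` at `h`, or all her types if she has not acted. -/
def reported (i : N) (h : History (Report Θ)) : Set (Θ i) :=
  match (decisions i h).getLast? with
  | some a => a.1
  | none => Set.univ

/-- `Θ(h)`. -/
def reportedAll (h : History (Report Θ)) : Set ((i : N) → Θ i) :=
  {θ | ∀ i, θ i ∈ reported i h}

/-- `Θ_i(I)` for a set `I` of histories. -/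
def infoOwn (i : N) (I : Set (History (Report Θ))) : Set (Θ i) :=
  {t | ∃ h ∈ I, t ∈ reported i h}

/-- `Θ_{-i}(I)` for a set `I` of histories. -/
def infoOthers (i : N) (I : Set (History (Report Θ))) : Set ((j : {j : N // j ≠ i}) → Θ j) :=
  {θ | ∃ h ∈ I, ∀ j : {j : N // j ≠ i}, θ j ∈ reported (j : N) h}

end Reports

/-- A gradual mechanism implementing the social choice function `f`. -/
structure GradualMechanism {N : Type u} {Θ : N → Type v} {X : Type w}
    (f : ((i : N) → Θ i) → X) extends GameForm (Report Θ) X where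
  actions_disjoint : ∀ i h, ActiveAt hist i h → ∀ a ∈ availableAt hist i h,
    ∀ b ∈ availableAt hist i h, a ≠ b → Disjoint a.1 b.1
  actions_cover : ∀ i h, ActiveAt hist i h →
    ⋃ a ∈ availableAt hist i h, a.1 = reported i h
  implements : ∀ z, toGameForm.Terminal z → ∀ θ ∈ reportedAll z, outcome z = f θ

namespace GradualMechanism

variable {N : Type u} {Θ : N → Type v} {X : Type w} {f : ((i : N) → Θ i) → X}

/-- The strategy `s` of agent `i` is unconditional for type `t`. -/
def Unconditional (G : GradualMechanism f) {i : N} (s : G.Strategy i) (t : Θ i) : Prop :=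
  ∀ h, G.Active i h → t ∈ reported i h → t ∈ (s.act h).1

open Classical in
/-- Incentive compatibility: truth-telling is weakly dominant. -/
def IncentiveCompatible (G : GradualMechanism f) (R : (i : N) → Θ i → X → X → Prop) : Prop :=
  ∀ (i : N) (t : Θ i) (st : G.Strategy i), G.Unconditional st t →
    ∀ (si : G.Strategy i) (s : (j : N) → G.Strategy j),
      R i t (G.outcomeOf (Function.update s i st)) (G.outcomeOf (Function.update s i si))

/-- The type profile `θ` is consistent with the incomplete strategy profile `σ`. -/
def TypeConsistent (G : GradualMechanism f) (M : Set N) (σ : (k : M) → G.Strategy k)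
    (θ : (i : N) → Θ i) : Prop :=
  ∃ z, G.Terminal z ∧ θ ∈ reportedAll z ∧ G.HistConsistent M σ z

/-- `G` is the direct mechanism: all agents simultaneously report their types at the initial
history, and nothing else happens. -/
def IsDirect (G : GradualMechanism f) : Prop :=
  G.hist = insert [] (Set.range fun θ : (i : N) → Θ i =>
    [fun i => some (⟨{θ i}, Set.singleton_nonempty _⟩ : Report Θ i)]) ∧
  ∀ i, G.info i = {{[]}}

/-- After the initial history, only agents with at least two types left to distinguish move. -/
def NoIdleMoves (G : GradualMechanism f) : Prop :=
  ∀ i h, h ≠ [] → G.Active i h → (reported i h).Nontrivial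

/-! ### Splitting -/

/-- The terminal histories after `I` at which the last action of agent `i` is `a`. -/
def splitNodes (G : GradualMechanism f) (i : N) (I : Set (History (Report Θ)))
    (a : Report Θ i) : Set (History (Report Θ)) :=
  {z | G.Terminal z ∧ reported i z = a.1 ∧ SetPrec I z}

open Classical in
/-- The action profile in which only `i` is active. -/
noncomputable def soloProfile (i : N) (a : Report Θ i) : ActionProfile (Report Θ) :=
  Function.update (fun _ => none) i (some a)

/-- `Gs` results from `G` by splitting the action `a` of agent `i` at `I` into `a₁` and `a₂`. -/
structure IsSPL (G Gs : GradualMechanism f) (i : N) (I : Set (History (Report Θ)))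
    (a a₁ a₂ : Report Θ i) : Prop where
  info_mem : I ∈ G.info i
  available : G.AvailableAtInfo i I a
  nodes_nonempty : (G.splitNodes i I a).Nonempty
  disjoint : Disjoint a₁.1 a₂.1
  union : a₁.1 ∪ a₂.1 = a.1
  hist_eq : Gs.hist = G.hist ∪
    {h | ∃ z ∈ G.splitNodes i I a, ∃ b, (b = a₁ ∨ b = a₂) ∧ h = z ++ [soloProfile i b]}
  info_other : ∀ j, j ≠ i → Gs.info j = G.info j
  info_self : Gs.info i = G.info i ∪ {G.splitNodes i I a}
  outcome_eq : ∃ m : History (Report Θ) → History (Report Θ),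
    Set.MapsTo m {z | Gs.Terminal z} {z | G.Terminal z} ∧
    Set.SurjOn m {z | Gs.Terminal z} {z | G.Terminal z} ∧
    ∀ z, Gs.Terminal z → reportedAll z ⊆ reportedAll (m z) ∧ Gs.outcome z = G.outcome (m z)

/-! ### Coalescing -/

open Classical in
/-- The profile `q` without the action of agent `i`, as a history of length one, or of length zero
if nobody else acts. -/
noncomputable def dropAgent (i : N) (q : ActionProfile (Report Θ)) : History (Report Θ) :=
  if ∃ j, j ≠ i ∧ (q j).isSome then [Function.update q i none] else []

/-- The histories that do not follow the choice of `a` at `I` are kept. -/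
def CoaKeep (G : GradualMechanism f) (i : N) (I : Set (History (Report Θ))) (a : Report Θ i)
    (hs h : History (Report Θ)) : Prop :=
  hs = h ∧ h ∈ G.hist ∧
    ¬ ∃ g ∈ I, ∃ p : ActionProfile (Report Θ), p i = some a ∧ g ++ [p] <+: h

open Classical in
/-- In the histories that follow the choice of `a` at `I` but do not go beyond `J`, the action `a`
is replaced by any action available at `J`. -/
def CoaBefore (G : GradualMechanism f) (i : N) (I J : Set (History (Report Θ))) (a : Report Θ i)
    (hs h : History (Report Θ)) : Prop :=
  ∃ g ∈ I, ∃ (p : ActionProfile (Report Θ)) (k : History (Report Θ)) (b : Report Θ i),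
    p i = some a ∧ h = g ++ [p] ++ k ∧ h ∈ G.hist ∧ ¬ SetPrec J h ∧ G.AvailableAtInfo i J b ∧
    hs = g ++ [Function.update p i (some b)] ++ k

open Classical in
/-- In the histories that go beyond `J`, the action chosen at `J` is moved to `I`, where it replaces
the action `a`. -/
def CoaAfter (G : GradualMechanism f) (i : N) (I J : Set (History (Report Θ))) (a : Report Θ i)
    (hs h : History (Report Θ)) : Prop :=
  ∃ g ∈ I, ∃ (p q : ActionProfile (Report Θ)) (k l : History (Report Θ)) (b : Report Θ i),
    p i = some a ∧ q i = some b ∧ g ++ [p] ++ k ∈ J ∧ h = g ++ [p] ++ k ++ [q] ++ l ∧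
    h ∈ G.hist ∧ hs = g ++ [Function.update p i (some b)] ++ k ++ dropAgent i q ++ l

/-- The graph of the mapping `T` from new histories to old ones; if a new history arises from two
old ones, then `T` selects the one that goes beyond `J`. -/
def CoaMap (G : GradualMechanism f) (i : N) (I J : Set (History (Report Θ))) (a : Report Θ i)
    (hs h : History (Report Θ)) : Prop :=
  G.CoaAfter i I J a hs h ∨
  ((G.CoaKeep i I a hs h ∨ G.CoaBefore i I J a hs h) ∧ ¬ ∃ k, G.CoaAfter i I J a hs k)

/-- `Gs` results from `G` by coalescing the information set `J` of agent `i`, which follows her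
choice of `a` at `I` without new information, into `I`. -/
structure IsCOA (G Gs : GradualMechanism f) (i : N) (I J : Set (History (Report Θ)))
    (a : Report Θ i) : Prop where
  available : G.AvailableAtInfo i I a
  succ : G.ImmediateSucc i I a J
  no_news : infoOthers i I = infoOthers i J
  hist_eq : Gs.hist = {hs | ∃ h, G.CoaKeep i I a hs h ∨ G.CoaBefore i I J a hs h ∨
    G.CoaAfter i I J a hs h}
  info_eq : ∀ j, Gs.info j = {K | K.Nonempty ∧ ∃ L ∈ G.info j,
    K = {hs | Gs.Active j hs ∧ ∃ h ∈ L, G.CoaMap i I J a hs h}}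
  outcome_eq : ∀ zs z, Gs.Terminal zs → G.CoaMap i I J a zs z → Gs.outcome zs = G.outcome z

/-! ### Illuminating -/

/-- `Gs` results from `G` by illuminating: the information set `I` of agent `i` is partitioned into
`I₁` and `I₂`, and so are, accordingly, her later information sets. -/
structure IsILL (G Gs : GradualMechanism f) (i : N) (I I₁ I₂ : Set (History (Report Θ))) :
    Prop where
  info_mem : I ∈ G.info i
  nonempty₁ : I₁.Nonempty
  nonempty₂ : I₂.Nonempty
  disjoint : Disjoint I₁ I₂
  union : I₁ ∪ I₂ = I
  hist_eq : Gs.hist = G.hist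
  info_other : ∀ j, j ≠ i → Gs.info j = G.info j
  info_self : Gs.info i = {K | K ∈ G.info i ∧ ¬ InfoPrecEq I K} ∪
    {L | L.Nonempty ∧ ∃ K ∈ G.info i, InfoPrecEq I K ∧
      (L = {h | h ∈ K ∧ SetPrecEq I₁ h} ∨ L = {h | h ∈ K ∧ SetPrecEq I₂ h})}
  outcome_eq : ∀ z, G.Terminal z → Gs.outcome z = G.outcome z

/-- No other agent `j` whose report decides between `I₁` and `I₂` gains by making `I₂` obtain when
her true type makes `I₁` obtain. -/
def IPFrom (G : GradualMechanism f) (R : (i : N) → Θ i → X → X → Prop) (i : N)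
    (I I₁ I₂ : Set (History (Report Θ))) : Prop :=
  ∀ j, j ≠ i → ∀ θ₁ θ₂ : (k : N) → Θ k,
    θ₁ i ∈ infoOwn i I → θ₂ i ∈ infoOwn i I →
    (fun k : {k : N // k ≠ i} => θ₁ k) ∈ infoOthers i I₁ →
    (fun k : {k : N // k ≠ i} => θ₂ k) ∈ infoOthers i I₂ →
    (∃ σ : (k : ({k | k ≠ i ∧ k ≠ j} : Set N)) → G.Strategy k,
      G.TypeConsistent {k | k ≠ i ∧ k ≠ j} σ θ₁ ∧ G.TypeConsistent {k | k ≠ i ∧ k ≠ j} σ θ₂) →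
    R j (θ₁ j) (f θ₁) (f θ₂)

/-- An illuminating of `G` with respect to `I`, `I₁`, `I₂` is incentive-preserving. The two parts of
`I` carry no order, so the condition is imposed for both labellings. -/
def IncentivePreserving (G : GradualMechanism f) (R : (i : N) → Θ i → X → X → Prop) (i : N)
    (I I₁ I₂ : Set (History (Report Θ))) : Prop :=
  G.IPFrom R i I I₁ I₂ ∧ G.IPFrom R i I I₂ I₁

/-! ### Chains of transformations -/

/-- Chains of splittings, coalescings and inverse illuminatings that transform one gradual mechanism
implementing `f` into another. -/
inductive Chain : GradualMechanism f → GradualMechanism f → Type (max u v w)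
  | nil (G : GradualMechanism f) : Chain G G
  | spl {G G₁ D : GradualMechanism f} (i : N) (I : Set (History (Report Θ)))
      (a a₁ a₂ : Report Θ i) (step : IsSPL G G₁ i I a a₁ a₂) (rest : Chain G₁ D) : Chain G D
  | coa {G G₁ D : GradualMechanism f} (i : N) (I J : Set (History (Report Θ)))
      (a : Report Θ i) (step : IsCOA G G₁ i I J a) (rest : Chain G₁ D) : Chain G D
  | invILL {G G₁ D : GradualMechanism f} (i : N) (I I₁ I₂ : Set (History (Report Θ)))
      (step : IsILL G₁ G i I I₁ I₂) (rest : Chain G₁ D) : Chain G D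

/-- All illuminatings whose inverses occur in the chain are incentive-preserving. -/
def Chain.AllIP (R : (i : N) → Θ i → X → X → Prop) :
    {G D : GradualMechanism f} → Chain G D → Prop
  | _, _, .nil _ => True
  | _, _, .spl _ _ _ _ _ _ rest => rest.AllIP R
  | _, _, .coa _ _ _ _ _ rest => rest.AllIP R
  | _, _, .invILL (G₁ := G₁) i I I₁ I₂ _ rest =>
      G₁.IncentivePreserving R i I I₁ I₂ ∧ rest.AllIP R

end GradualMechanism

/-! ### Trees and decisions -/

section Trees

variable {N : Type u} {Act : N → Type v}

/-! Everything rests on one reformulation of incentive compatibility. Two type profiles are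
compatible for agent `k` if their truthful paths prescribe the same action at every information set
of `k` that both of them cross (`Compatible`). This is exactly the condition under which one
strategy of `k` can take part in both paths. Quantification over strategies therefore turns into
quantification over pairs of profiles: `G` is IC iff each `i` with type `θ i` weakly prefers `f θ`
to `f θ'` whenever `θ` and `θ'` are compatible for all the other agents (`incentiveCompatible_iff`).

For the second part, each transformation is judged by its effect on compatibility. A COA does not
change compatibility for anyone: without news between `I` and `J`, one finer choice at `I` separates
the same profiles as the two successive choices (`IsCOA.compatible_iff`). An SPL makes compatibility
stricter for `i` only, and only at formerly terminal histories, where the additional report has no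
influence on the outcome; a component of one profile can be exchanged there at no cost
(`IsSPL.incentiveCompatible_iff`). An ILL makes all pairs that pass through different parts of `I`
compatible for `i`; being incentive-preserving is the IC inequality for these pairs, and no other
pair becomes compatible (`IsILL.incentiveCompatible_iff`). In the direct mechanism compatibility for
`j` means having the same type of `j`, so that IC is strategy-proofness. Induction along the chain
finishes the argument.

For the first part, take a non-singleton action `a` of some agent `i` that is preceded by as many of
her decisions as possible. After `a` she moves at most once more, and then she reveals her type
(`FinalStage`). If a terminal history has `a` as her last report, `a` is split. Otherwise every path
after `a` meets a further move of hers. If these moves lie in several information sets, two of them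
are merged by an inverse ILL; if they lie in a single one, it brings no news and is coalesced. The
process stops because the number of pairs of profiles in a common terminal cell, followed by the
number of information sets, decreases lexicographically (`NoIdleMoves.exists_step`).

Most of the work is to show that coalescing yields a gradual mechanism. It is done through the map
`CoaMap` from new histories to old ones. -/

theorem exists_snoc_prefix {α : Type*} {h k : List α} (hk : h <+: k) (hne : h ≠ k) :
    ∃ p, h ++ [p] <+: k := by
  obtain ⟨t, rfl⟩ := hk
  cases t with
  | nil => simp at hne
  | cons p t => exact ⟨p, t, by simp⟩

theorem snoc_prefix_unique {α : Type*} {h k : List α} {p q : α} (hp : h ++ [p] <+: k)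
    (hq : h ++ [q] <+: k) : p = q := by
  have := List.prefix_of_prefix_length_le hp hq (by simp)
  simpa using this.eq_of_length (by simp)

theorem not_snoc_prefix_self {α : Type*} {h : List α} {p : α} : ¬ h ++ [p] <+: h := fun hp => by
  have := hp.length_le
  simp at this

theorem prefix_cases {α : Type*} {g h k : List α} (hg : g <+: k) (hh : h <+: k) :
    g <+: h ∨ ∃ p, h ++ [p] <+: g := by
  rcases List.prefix_or_prefix_of_prefix hg hh with h1 | h1
  · exact Or.inl h1
  · by_cases h2 : h = g
    · exact Or.inl (h2 ▸ List.prefix_refl _)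
    · exact Or.inr (exists_snoc_prefix h1 h2)

theorem decisions_append (i : N) (h k : History Act) :
    decisions i (h ++ k) = decisions i h ++ decisions i k := by
  simp [decisions]

theorem decisions_singleton_some {i : N} {p : ActionProfile Act} {a : Act i} (hp : p i = some a) :
    decisions i [p] = [a] := by
  simp [decisions, hp]

theorem decisions_singleton_none {i : N} {p : ActionProfile Act} (hp : p i = none) :
    decisions i [p] = [] := by
  simp [decisions, hp]

theorem decisions_prefix {i : N} {h k : History Act} (hk : h <+: k) :
    decisions i h <+: decisions i k := by
  obtain ⟨t, rfl⟩ := hk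
  exact ⟨decisions i t, (decisions_append _ _ _).symm⟩

theorem decisions_prefix_snoc {i : N} {h k : History Act} {p : ActionProfile Act} {a : Act i}
    (hk : h ++ [p] <+: k) (hp : p i = some a) : decisions i h ++ [a] <+: decisions i k := by
  have := decisions_prefix (i := i) hk
  rwa [decisions_append, decisions_singleton_some hp] at this

theorem activeAt_of_mem {H : Set (History Act)} {i : N} {h : History Act} {p : ActionProfile Act}
    {a : Act i} (hp : h ++ [p] ∈ H) (hi : p i = some a) : ActiveAt H i h :=
  ⟨p, hp, by simp [hi]⟩

theorem ActiveAt.exists_available {H : Set (History Act)} {i : N} {h : History Act}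
    (hi : ActiveAt H i h) : ∃ a, a ∈ availableAt H i h := by
  obtain ⟨p, hp, h1⟩ := hi
  obtain ⟨a, ha⟩ := Option.isSome_iff_exists.1 h1
  exact ⟨a, p, hp, ha⟩

theorem activeAt_of_available {H : Set (History Act)} {i : N} {h : History Act} {a : Act i}
    (ha : a ∈ availableAt H i h) : ActiveAt H i h := by
  obtain ⟨p, hp, h1⟩ := ha
  exact activeAt_of_mem hp h1

end Trees

/-! ### Paths, perfect recall and strategies in game forms. -/

namespace GameForm

variable {N : Type u} {Act : N → Type v} {X : Type w} (G : GameForm Act X)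

theorem mem_of_prefix {h k : History Act} (hk : k ∈ G.hist) (hp : h <+: k) : h ∈ G.hist := by
  obtain ⟨t, rfl⟩ := hp
  induction t using List.reverseRecOn with
  | nil => simpa using hk
  | append_singleton t x ih => exact ih (G.prefix_mem _ x (by simpa using hk))

end GameForm

namespace ActiveAt

variable {N : Type u} {Act : N → Type v} {X : Type w} {G : GameForm Act X}

theorem mem {i : N} {h : History Act} (hi : G.Active i h) : h ∈ G.hist := by
  obtain ⟨p, hp, -⟩ := hi
  exact G.prefix_mem _ _ hp

theorem exists_eq_some {i : N} {h k : History Act} {p : ActionProfile Act}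
    (hi : G.Active i h) (hk : k ∈ G.hist) (hp : h ++ [p] <+: k) :
    ∃ a, p i = some a ∧ a ∈ G.available i h := by
  have h1 := G.mem_of_prefix hk hp
  obtain ⟨a, ha⟩ := Option.isSome_iff_exists.1 (G.active_uniform h p i h1 hi)
  exact ⟨a, ha, p, h1, ha⟩

end ActiveAt

namespace GameForm

variable {N : Type u} {Act : N → Type v} {X : Type w} {G : GameForm Act X}

theorem eq_none_of_not_active {i : N} {h : History Act} {p : ActionProfile Act}
    (hi : ¬ G.Active i h) (hp : h ++ [p] ∈ G.hist) : p i = none := by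
  by_contra hne
  exact hi ⟨p, hp, Option.isSome_iff_ne_none.2 hne⟩

theorem mem_hist_of_mem_info {i : N} {I : Set (History Act)} (hI : I ∈ G.info i) {h : History Act}
    (hh : h ∈ I) : h ∈ G.hist :=
  ActiveAt.mem (G.info_active i I hI h hh)

theorem info_eq_of_mem {i : N} {I J : Set (History Act)} (hI : I ∈ G.info i) (hJ : J ∈ G.info i)
    {h : History Act} (h1 : h ∈ I) (h2 : h ∈ J) : I = J := by
  obtain ⟨K, -, hK⟩ := G.info_cover i h (G.info_active i I hI h h1)
  rw [hK I ⟨hI, h1⟩, hK J ⟨hJ, h2⟩]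

theorem exists_info {i : N} {h : History Act} (hi : G.Active i h) : ∃ I ∈ G.info i, h ∈ I := by
  obtain ⟨K, hK, -⟩ := G.info_cover i h hi
  exact ⟨K, hK.1, hK.2⟩

theorem active_decisions_lt {i : N} {h k : History Act} (hi : G.Active i h) (hk : k ∈ G.hist)
    (hp : h <+: k) (hne : h ≠ k) : (decisions i h).length < (decisions i k).length := by
  obtain ⟨p, hp⟩ := exists_snoc_prefix hp hne
  obtain ⟨a, ha, -⟩ := hi.exists_eq_some hk hp
  have := (decisions_prefix_snoc hp ha).length_le
  simp at this
  omega

/-- On one path, a player has at most one decision node with a given number of past decisions. -/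
theorem eq_of_decisions_length {i : N} {g h k : History Act} (hg : G.Active i g)
    (hh : G.Active i h) (hk : k ∈ G.hist) (h1 : g <+: k) (h2 : h <+: k)
    (hd : (decisions i g).length = (decisions i h).length) : g = h := by
  by_contra hne
  rcases List.prefix_or_prefix_of_prefix h1 h2 with h3 | h3
  · have := active_decisions_lt hg (G.mem_of_prefix hk h2) h3 hne
    omega
  · have := active_decisions_lt hh (G.mem_of_prefix hk h1) h3 (Ne.symm hne)
    omega

/-- Perfect recall gives both nodes the same number of past decisions, whereas the move at the
earlier of two distinct nodes on a path would add one. -/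
theorem info_antichain {i : N} {I : Set (History Act)} (hI : I ∈ G.info i) {g h k : History Act}
    (hg : g ∈ I) (hh : h ∈ I) (hk : k ∈ G.hist) (h1 : g <+: k) (h2 : h <+: k) : g = h :=
  eq_of_decisions_length (G.info_active i I hI g hg) (G.info_active i I hI h hh) hk h1 h2
    (by rw [G.recall_decisions i I hI g hg h hh])

/-- Perfect recall for a past information set and the action taken there. -/
theorem recall_snoc {i : N} {I J : Set (History Act)} (hI : I ∈ G.info i) (hJ : J ∈ G.info i)
    {g h k : History Act} {p : ActionProfile Act} (hg : g ∈ J) (hh : h ∈ I) (hk : k ∈ I)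
    (hp : g ++ [p] <+: h) : ∃ g₂ ∈ J, ∃ p₂, g₂ ++ [p₂] <+: k ∧ p₂ i = p i := by
  have hgact := G.info_active i J hJ g hg
  obtain ⟨g₂, hg₂, J', hJ', h1, h2⟩ := G.recall_info i I hI h hh k hk g
    ((List.prefix_append _ _).trans hp) hgact
  obtain rfl := info_eq_of_mem hJ hJ' hg h1
  have hd := G.recall_decisions i I hI h hh k hk
  have hd₂ := G.recall_decisions i J hJ g hg g₂ h2
  obtain ⟨a, ha, -⟩ := hgact.exists_eq_some (mem_hist_of_mem_info hI hh) hp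
  have h3 := decisions_prefix_snoc hp ha
  have hne : g₂ ≠ k := by
    rintro rfl
    have := h3.length_le
    rw [hd, hd₂] at this
    simp at this
  obtain ⟨p₂, hp₂⟩ := exists_snoc_prefix hg₂ hne
  obtain ⟨b, hb, -⟩ := (G.info_active i J hJ g₂ h2).exists_eq_some (mem_hist_of_mem_info hI hk) hp₂
  have h4 := decisions_prefix_snoc hp₂ hb
  refine ⟨g₂, h2, p₂, hp₂, ?_⟩
  rw [hd, hd₂] at h3
  have := snoc_prefix_unique h3 h4
  rw [ha, hb, this]

theorem not_active_of_terminal {i : N} {z : History Act} (hz : G.Terminal z) : ¬ G.Active i z :=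
  fun ⟨p, hp, _⟩ => hz.2 p hp

theorem Terminal.eq_of_prefix {z k : History Act} (hz : G.Terminal z) (hk : k ∈ G.hist)
    (h : z <+: k) : z = k := by
  by_contra hne
  obtain ⟨p, hp⟩ := exists_snoc_prefix h hne
  exact hz.2 p (G.mem_of_prefix hk hp)

theorem terminal_of_mem {z : History Act} (hz : z ∈ G.hist) (h : ∀ i, ¬ G.Active i z) :
    G.Terminal z := by
  refine ⟨hz, fun p hp => ?_⟩
  obtain ⟨i, hi⟩ := G.profile_nonempty z p hp
  exact h i ⟨p, hp, hi⟩

theorem available_of_info {i : N} {I : Set (History Act)} (hI : I ∈ G.info i) {h k : History Act}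
    (hh : h ∈ I) (hk : k ∈ I) {a : Act i} (ha : a ∈ G.available i h) : a ∈ G.available i k := by
  have := G.info_available i I hI h hh k hk
  exact (Set.ext_iff.1 this a).1 ha

/-- Information sets of a player are disjoint, so choices made separately at each of them fit
together into a measurable strategy. -/
theorem exists_strategy {i : N} (P : Set (History Act) → Act i → Prop)
    (h : ∀ I ∈ G.info i, ∃ a, G.AvailableAtInfo i I a ∧ P I a) :
    ∃ s : G.Strategy i, ∀ I ∈ G.info i, ∀ h ∈ I, P I (s.act h) := by
  classical
  have hroot := G.root_active i
  -- `a₀` is only the default value off the decision nodes.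
  obtain ⟨a₀, -⟩ := hroot.exists_available
  choose F hF using h
  let act : History Act → Act i := fun h =>
    if hi : ∃ I, I ∈ G.info i ∧ h ∈ I then F hi.choose hi.choose_spec.1 else a₀
  have hact : ∀ I (hI : I ∈ G.info i), ∀ h ∈ I, act h = F I hI := by
    intro I hI h hh
    have hi : ∃ I, I ∈ G.info i ∧ h ∈ I := ⟨I, hI, hh⟩
    have h1 : hi.choose = I := info_eq_of_mem hi.choose_spec.1 hI hi.choose_spec.2 hh
    simp only [act, dif_pos hi]
    congr 1
  refine ⟨⟨act, ?_, ?_⟩, ?_⟩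
  · intro h hi
    obtain ⟨I, hI, hh⟩ := exists_info hi
    obtain ⟨⟨k, hk, hka⟩, -⟩ := hF I hI
    rw [hact I hI h hh]
    exact available_of_info hI hk hh hka
  · intro I hI h hh k hk
    rw [hact I hI h hh, hact I hI k hk]
  · intro I hI h hh
    show P I (act h)
    rw [hact I hI h hh]
    exact (hF I hI).2

theorem play_terminal (s : (i : N) → G.Strategy i) : G.Terminal (G.play s) :=
  (G.existsUnique_terminal s).choose_spec.1.1

theorem play_onPath (s : (i : N) → G.Strategy i) : G.OnPath s (G.play s) :=
  (G.existsUnique_terminal s).choose_spec.1.2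

end GameForm

/-! ### Reports along histories -/

section Reports

variable {N : Type u} {Θ : N → Type v}

theorem reported_eq_of_decisions {i : N} {h k : History (Report Θ)}
    (hd : decisions i h = decisions i k) : reported i h = reported i k := by
  unfold reported
  rw [hd]

theorem reported_of_decisions {i : N} {h : History (Report Θ)} {l : List (Report Θ i)}
    {a : Report Θ i} (hd : decisions i h = l ++ [a]) : reported i h = a.1 := by
  unfold reported
  rw [hd]
  simp

theorem reported_snoc_some {i : N} {h : History (Report Θ)} {p : ActionProfile (Report Θ)}
    {a : Report Θ i} (hp : p i = some a) : reported i (h ++ [p]) = a.1 :=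
  reported_of_decisions (by rw [decisions_append, decisions_singleton_some hp])

theorem reported_snoc_none {i : N} {h : History (Report Θ)} {p : ActionProfile (Report Θ)}
    (hp : p i = none) : reported i (h ++ [p]) = reported i h :=
  reported_eq_of_decisions (by rw [decisions_append, decisions_singleton_none hp, List.append_nil])

end Reports

/-! ### Truthful paths in gradual mechanisms. -/

namespace GradualMechanism

open GameForm

variable {N : Type u} {Θ : N → Type v} {X : Type w} {f : ((i : N) → Θ i) → X}
  {G : GradualMechanism f}

theorem available_subset {i : N} {h : History (Report Θ)} {a : Report Θ i}
    (ha : a ∈ G.available i h) : a.1 ⊆ reported i h := by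
  rw [← G.actions_cover i h (activeAt_of_available ha)]
  exact Set.subset_biUnion_of_mem (u := fun a : Report Θ i => a.1) ha

theorem exists_available {i : N} {h : History (Report Θ)} (hi : G.Active i h) {t : Θ i}
    (ht : t ∈ reported i h) : ∃ a ∈ G.available i h, t ∈ a.1 := by
  rw [← G.actions_cover i h hi] at ht
  simpa using ht

theorem available_unique {i : N} {h : History (Report Θ)} {a b : Report Θ i}
    (ha : a ∈ G.available i h) (hb : b ∈ G.available i h) {t : Θ i} (hta : t ∈ a.1)
    (htb : t ∈ b.1) : a = b := by
  by_contra hne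
  exact Set.disjoint_left.1
    (G.actions_disjoint i h (activeAt_of_available ha) a ha b hb hne) hta htb

theorem reported_anti {i : N} {h k : History (Report Θ)} (hk : k ∈ G.hist) (hp : h <+: k) :
    reported i k ⊆ reported i h := by
  obtain ⟨t, rfl⟩ := hp
  induction t using List.reverseRecOn with
  | nil => simp
  | append_singleton t p ih =>
    rw [← List.append_assoc] at hk ⊢
    have h1 := G.prefix_mem _ _ hk
    refine Set.Subset.trans ?_ (ih h1)
    cases hpi : p i with
    | none => rw [reported_snoc_none hpi]
    | some a =>
      rw [reported_snoc_some hpi]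
      exact available_subset ⟨p, hk, hpi⟩

theorem reportedAll_anti {h k : History (Report Θ)} (hk : k ∈ G.hist) (hp : h <+: k)
    {θ : (i : N) → Θ i} (hθ : θ ∈ reportedAll k) : θ ∈ reportedAll h :=
  fun i => reported_anti hk hp (hθ i)

theorem reported_nonempty (G : GradualMechanism f) (i : N) (h : History (Report Θ)) :
    (reported i h).Nonempty := by
  -- An action at the root witnesses that `Θ i` is non-empty, which matters if `i` has not acted
  -- along `h`.
  obtain ⟨a, -⟩ := (G.root_active i).exists_available
  unfold reported
  split
  · rename_i b _
    exact b.2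
  · exact ⟨a.2.some, trivial⟩

theorem reportedAll_nonempty (G : GradualMechanism f) (h : History (Report Θ)) :
    ∃ θ : (i : N) → Θ i, θ ∈ reportedAll h :=
  ⟨fun i => (reported_nonempty G i h).some, fun i => (reported_nonempty G i h).some_mem⟩

/-- The truthful continuation of a non-terminal history. -/
theorem exists_snoc {h q} (hq : h ++ [q] ∈ G.hist) {θ : (i : N) → Θ i} (hθ : θ ∈ reportedAll h) :
    ∃ p, h ++ [p] ∈ G.hist ∧ θ ∈ reportedAll (h ++ [p]) := by
  classical
  have hex : ∀ i, G.Active i h → ∃ a ∈ G.available i h, θ i ∈ a.1 := fun i hi =>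
    exists_available hi (hθ i)
  choose F hF using hex
  let p : ActionProfile (Report Θ) := fun i => if hi : G.Active i h then some (F i hi) else none
  refine ⟨p, G.product h ⟨q, hq⟩ p (fun i hi => ⟨F i hi, (hF i hi).1, dif_pos hi⟩)
    (fun i hi => dif_neg hi), fun i => ?_⟩
  by_cases hi : G.Active i h
  · rw [reported_snoc_some (dif_pos hi)]
    exact (hF i hi).2
  · rw [reported_snoc_none (dif_neg hi)]
    exact hθ i

theorem mem_of_snoc_prefix {i : N} {h k p} (hk : k ∈ G.hist) (hp : h ++ [p] <+: k)
    {a : Report Θ i} (ha : p i = some a) {θ : (i : N) → Θ i} (hθ : θ ∈ reportedAll k) :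
    θ i ∈ a.1 := by
  have := reportedAll_anti hk hp hθ i
  rwa [reported_snoc_some ha] at this

theorem snoc_unique {h p q} (hp : h ++ [p] ∈ G.hist) (hq : h ++ [q] ∈ G.hist)
    {θ : (i : N) → Θ i} (hθp : θ ∈ reportedAll (h ++ [p])) (hθq : θ ∈ reportedAll (h ++ [q])) :
    p = q := by
  funext i
  by_cases hi : G.Active i h
  · obtain ⟨a, ha, ha'⟩ := hi.exists_eq_some hp (List.prefix_refl _)
    obtain ⟨b, hb, hb'⟩ := hi.exists_eq_some hq (List.prefix_refl _)
    rw [ha, hb, available_unique ha' hb'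
      (mem_of_snoc_prefix hp (List.prefix_refl _) ha hθp)
      (mem_of_snoc_prefix hq (List.prefix_refl _) hb hθq)]
  · rw [eq_none_of_not_active hi hp, eq_none_of_not_active hi hq]

/-- Histories that a type profile reports truthfully are on one path. -/
theorem comparable {h k} (hh : h ∈ G.hist) (hk : k ∈ G.hist) {θ : (i : N) → Θ i}
    (hθh : θ ∈ reportedAll h) (hθk : θ ∈ reportedAll k) : h <+: k ∨ k <+: h := by
  induction h using List.reverseRecOn with
  | nil => exact Or.inl List.nil_prefix
  | append_singleton h p ih =>
    rcases ih (G.prefix_mem _ _ hh) (reportedAll_anti hh (List.prefix_append _ _) hθh) with h1 | h1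
    · by_cases hne : h = k
      · subst hne
        exact Or.inr (List.prefix_append _ _)
      · obtain ⟨q, hq⟩ := exists_snoc_prefix h1 hne
        rw [snoc_unique hh (G.mem_of_prefix hk hq) hθh (reportedAll_anti hk hq hθk)]
        exact Or.inl hq
    · exact Or.inr (h1.trans (List.prefix_append _ _))

theorem prefix_terminal {h z} (hh : h ∈ G.hist) (hz : G.Terminal z) {θ : (i : N) → Θ i}
    (hθh : θ ∈ reportedAll h) (hθz : θ ∈ reportedAll z) : h <+: z := by
  rcases comparable hh hz.1 hθh hθz with h1 | h1
  · exact h1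
  · rw [hz.eq_of_prefix hh h1]

theorem exists_terminal {h} (hh : h ∈ G.hist) {θ : (i : N) → Θ i} (hθ : θ ∈ reportedAll h) :
    ∃ z, G.Terminal z ∧ h <+: z ∧ θ ∈ reportedAll z := by
  obtain ⟨T, hT⟩ := G.bounded
  induction hn : T - h.length using Nat.strong_induction_on generalizing h with
  | _ n ih =>
    by_cases hz : G.Terminal h
    · exact ⟨h, hz, List.prefix_refl _, hθ⟩
    · obtain ⟨q, hq⟩ : ∃ q, h ++ [q] ∈ G.hist := by
        by_contra hne
        exact hz ⟨hh, fun p hp => hne ⟨p, hp⟩⟩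
      obtain ⟨p, hp, hθp⟩ := exists_snoc hq hθ
      have h1 := hT _ hp
      have h2 : (h ++ [p]).length = h.length + 1 := by simp
      obtain ⟨z, hz, hpz, hθz⟩ := ih _ (by omega) hp hθp rfl
      exact ⟨z, hz, (List.prefix_append _ _).trans hpz, hθz⟩

theorem reported_eq_of_info {i : N} {I} (hI : I ∈ G.info i) {h k} (hh : h ∈ I) (hk : k ∈ I) :
    reported i h = reported i k :=
  reported_eq_of_decisions (G.recall_decisions i I hI h hh k hk)

theorem update_mem_reportedAll [DecidableEq N] {i : N} {h : History (Report Θ)}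
    {θ : (j : N) → Θ j} {t : Θ i}
    (ht : t ∈ reported i h) (hθ : ∀ j, j ≠ i → θ j ∈ reported j h) :
    Function.update θ i t ∈ reportedAll h := by
  intro j
  by_cases hj : j = i
  · subst hj
    simpa using ht
  · simpa [hj] using hθ j hj

end GradualMechanism

/-! ### Compatible type profiles and incentive compatibility -/

namespace GradualMechanism

open GameForm

variable {N : Type u} {Θ : N → Type v} {X : Type w} {f : ((i : N) → Θ i) → X}
  {G : GradualMechanism f}

/-- Wherever the paths of truthful play of `θ` and `θ'` cross the same information set of agent
`k`, she takes the same action. -/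
def Compatible (G : GradualMechanism f) (k : N) (θ θ' : (i : N) → Θ i) : Prop :=
  ∀ K ∈ G.info k, ∀ h ∈ K, ∀ h' ∈ K, θ ∈ reportedAll h → θ' ∈ reportedAll h' →
    ∀ a ∈ G.available k h, θ k ∈ a.1 → θ' k ∈ a.1

theorem reportedAll_play {s : (i : N) → G.Strategy i} {θ : (i : N) → Θ i}
    (h : ∀ i h, G.Active i h → θ ∈ reportedAll h → θ i ∈ ((s i).act h).1) :
    θ ∈ reportedAll (G.play s) := by
  have key : ∀ k : History (Report Θ), k <+: G.play s → θ ∈ reportedAll k := by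
    intro k
    induction k using List.reverseRecOn with
    | nil => exact fun _ i => trivial
    | append_singleton k p ih =>
      intro hk i
      have h0 := ih ((List.prefix_append _ _).trans hk)
      by_cases hi : G.Active i k
      · have h1 := (play_onPath s).2 k p hk i hi
        rw [reported_snoc_some h1]
        exact h i k hi h0
      · rw [reported_snoc_none (eq_none_of_not_active hi
          (G.mem_of_prefix (play_terminal s).1 hk))]
        exact h0 i
  exact key _ (List.prefix_refl _)

/-- By uniqueness of the truthful path of `θ`, a decision node whose reports contain `θ` lies on the
path of play, so the action prescribed there is actually taken. -/
theorem mem_act_of_reportedAll_play {s : (i : N) → G.Strategy i} {θ : (i : N) → Θ i}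
    (hθ : θ ∈ reportedAll (G.play s)) {i h} (hi : G.Active i h) (hh : θ ∈ reportedAll h) :
    θ i ∈ ((s i).act h).1 := by
  have hz := play_terminal s
  have h1 := prefix_terminal hi.mem hz hh hθ
  have hne : h ≠ G.play s := by
    rintro rfl
    exact not_active_of_terminal hz hi
  obtain ⟨p, hp⟩ := exists_snoc_prefix h1 hne
  exact mem_of_snoc_prefix hz.1 hp ((play_onPath s).2 h p hp i hi) hθ

theorem compatible_of_plays {s s' : (i : N) → G.Strategy i} {θ θ' : (i : N) → Θ i}
    (hθ : θ ∈ reportedAll (G.play s)) (hθ' : θ' ∈ reportedAll (G.play s')) {k : N}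
    (hk : s k = s' k) : G.Compatible k θ θ' := by
  intro K hK h hh h' hh' h1 h2 a ha hka
  have hact := G.info_active k K hK h hh
  have h3 := mem_act_of_reportedAll_play hθ hact h1
  have h4 := mem_act_of_reportedAll_play hθ' (G.info_active k K hK h' hh') h2
  rw [← hk, ← (s k).act_info K hK h hh h' hh',
    ← available_unique ha ((s k).act_mem h hact) hka h3] at h4
  exact h4

/-- At an information set crossed by the path of `θ`, take the action containing `θ k`;
compatibility makes it suit `θ'` too. Information sets crossed by at most one of the paths impose at
most one demand. -/
theorem Compatible.exists_strategy {k : N} {θ θ' : (i : N) → Θ i} (hc : G.Compatible k θ θ') :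
    ∃ s : G.Strategy k, ∀ h, G.Active k h →
      (θ ∈ reportedAll h → θ k ∈ (s.act h).1) ∧ (θ' ∈ reportedAll h → θ' k ∈ (s.act h).1) := by
  obtain ⟨s, hs⟩ := GameForm.exists_strategy (G := G.toGameForm) (i := k)
    (fun K a => ∀ h ∈ K, (θ ∈ reportedAll h → θ k ∈ a.1) ∧ (θ' ∈ reportedAll h → θ' k ∈ a.1)) (by
      intro K hK
      by_cases h1 : ∃ h ∈ K, θ ∈ reportedAll h
      · obtain ⟨h, hh, hθ⟩ := h1
        obtain ⟨a, ha, hka⟩ := exists_available (G.info_active k K hK h hh) (hθ k)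
        refine ⟨a, ⟨h, hh, ha⟩, fun h' hh' => ⟨fun _ => hka, fun hθ' => ?_⟩⟩
        · exact hc K hK h hh h' hh' hθ hθ' a ha hka
      · by_cases h2 : ∃ h ∈ K, θ' ∈ reportedAll h
        · obtain ⟨h, hh, hθ⟩ := h2
          obtain ⟨a, ha, hka⟩ := exists_available (G.info_active k K hK h hh) (hθ k)
          refine ⟨a, ⟨h, hh, ha⟩, fun h' hh' => ⟨fun hθ' => ?_, fun _ => hka⟩⟩
          · exact absurd ⟨h', hh', hθ'⟩ h1
        · obtain ⟨h, hh⟩ := G.info_nonempty k K hK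
          obtain ⟨a, ha⟩ := (G.info_active k K hK h hh).exists_available
          refine ⟨a, ⟨h, hh, ha⟩, fun h' hh' => ⟨fun hθ' => ?_, fun hθ' => ?_⟩⟩
          · exact absurd ⟨h', hh', hθ'⟩ h1
          · exact absurd ⟨h', hh', hθ'⟩ h2)
  refine ⟨s, fun h hi => ?_⟩
  obtain ⟨K, hK, hh⟩ := exists_info hi
  exact hs K hK h hh h hh

/-- Perfect recall makes `reported i` constant on an information set, so that being truthful is a
measurable requirement. -/
theorem exists_unconditional (G : GradualMechanism f) (i : N) (t : Θ i) :
    ∃ s : G.Strategy i, G.Unconditional s t := by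
  obtain ⟨s, hs⟩ := GameForm.exists_strategy (G := G.toGameForm) (i := i)
    (fun K a => ∀ h ∈ K, t ∈ reported i h → t ∈ a.1) (by
      intro K hK
      obtain ⟨h, hh⟩ := G.info_nonempty i K hK
      have hact := G.info_active i K hK h hh
      by_cases ht : t ∈ reported i h
      · obtain ⟨a, ha, hta⟩ := exists_available hact ht
        exact ⟨a, ⟨h, hh, ha⟩, fun _ _ _ => hta⟩
      · obtain ⟨a, ha⟩ := hact.exists_available
        refine ⟨a, ⟨h, hh, ha⟩, fun h' hh' ht' => ?_⟩
        · rw [reported_eq_of_info hK hh' hh] at ht'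
          exact absurd ht' ht)
  refine ⟨s, fun h hi ht => ?_⟩
  obtain ⟨K, hK, hh⟩ := exists_info hi
  exact hs K hK h hh h hh ht

/-- Two type profiles are consistent with a common incomplete strategy profile if and only if they
are compatible for each of the players concerned. -/
theorem exists_typeConsistent_iff (M : Set N) (θ θ' : (i : N) → Θ i) :
    (∃ σ : (k : M) → G.Strategy k, G.TypeConsistent M σ θ ∧ G.TypeConsistent M σ θ') ↔
      ∀ k ∈ M, G.Compatible k θ θ' := by
  classical
  constructor
  · rintro ⟨σ, ⟨z, hz, hθz, s, hs, hsz⟩, z', hz', hθz', s', hs', hsz'⟩ k hk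
    obtain rfl := hz.eq_of_prefix (play_terminal s).1 hsz
    obtain rfl := hz'.eq_of_prefix (play_terminal s').1 hsz'
    exact compatible_of_plays hθz hθz' ((hs ⟨k, hk⟩).trans (hs' ⟨k, hk⟩).symm)
  · intro hc
    choose σ hσ using fun k : M => (hc k k.2).exists_strategy
    choose τ hτ using fun (t : (i : N) → Θ i) (i : N) => exists_unconditional G i (t i)
    have key : ∀ t : (i : N) → Θ i,
        (∀ k : M, ∀ h, G.Active k h → t ∈ reportedAll h → t k ∈ ((σ k).act h).1) →
        G.TypeConsistent M σ t := by
      intro t ht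
      let s : (i : N) → G.Strategy i := fun i => if hi : i ∈ M then σ ⟨i, hi⟩ else τ t i
      refine ⟨G.play s, play_terminal s, reportedAll_play ?_, s, fun k => dif_pos k.2,
        List.prefix_refl _⟩
      intro i h hi hth
      by_cases hM : i ∈ M
      · simp only [s, dif_pos hM]
        exact ht ⟨i, hM⟩ h hi hth
      · simp only [s, dif_neg hM]
        exact hτ t i h hi (hth i)
    exact ⟨σ, key θ fun k h hi => (hσ k h hi).1, key θ' fun k h hi => (hσ k h hi).2⟩

theorem outcomeOf_eq {s : (i : N) → G.Strategy i} {θ : (i : N) → Θ i}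
    (hθ : θ ∈ reportedAll (G.play s)) : G.outcomeOf s = f θ :=
  G.implements _ (play_terminal s) θ hθ

/-- A deviation of `i` against fixed strategies of the others yields two terminal histories, and
profiles in their cells are compatible for the others. Conversely, compatibility lets the others
have strategies that generate both paths, with `i` being truthful for `θ i` on the one and for `θ'
i` on the other. -/
theorem incentiveCompatible_iff (R : (i : N) → Θ i → X → X → Prop) :
    G.IncentiveCompatible R ↔ ∀ (i : N) (θ θ' : (i : N) → Θ i),
      (∀ k, k ≠ i → G.Compatible k θ θ') → R i (θ i) (f θ) (f θ') := by
  classical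
  constructor
  · intro hG i θ θ' hc
    choose σ hσ using fun k : {k // k ≠ i} => (hc k k.2).exists_strategy
    obtain ⟨st, hst⟩ := exists_unconditional G i (θ i)
    obtain ⟨si, hsi⟩ := exists_unconditional G i (θ' i)
    -- The component of `i` is a dummy, since both profiles used below overwrite it.
    let s : (k : N) → G.Strategy k := fun k => if hk : k ≠ i then σ ⟨k, hk⟩ else by
      exact (not_not.1 hk) ▸ st
    have h1 : θ ∈ reportedAll (G.play (Function.update s i st)) := by
      refine reportedAll_play fun k h hk hh => ?_
      by_cases hki : k = i
      · subst hki
        rw [Function.update_self]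
        exact hst h hk (hh k)
      · rw [Function.update_of_ne hki]
        simp only [s, dif_pos (show k ≠ i from hki)]
        exact (hσ ⟨k, hki⟩ h hk).1 hh
    have h2 : θ' ∈ reportedAll (G.play (Function.update s i si)) := by
      refine reportedAll_play fun k h hk hh => ?_
      by_cases hki : k = i
      · subst hki
        rw [Function.update_self]
        exact hsi h hk (hh k)
      · rw [Function.update_of_ne hki]
        simp only [s, dif_pos (show k ≠ i from hki)]
        exact (hσ ⟨k, hki⟩ h hk).2 hh
    have h3 := hG i (θ i) st hst si s
    rwa [outcomeOf_eq h1, outcomeOf_eq h2] at h3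
  · intro hG i t st hst si s
    -- An unconditional strategy never excludes `t`, so the terminal cell contains a profile whose
    -- `i`-component is `t`.
    have ht : t ∈ reported i (G.play (Function.update s i st)) := by
      have key : ∀ k, k <+: G.play (Function.update s i st) → t ∈ reported i k := by
        intro k
        induction k using List.reverseRecOn with
        | nil => exact fun _ => trivial
        | append_singleton k p ih =>
          intro hk
          have h0 := ih ((List.prefix_append _ _).trans hk)
          by_cases hi : G.Active i k
          · have h1 := (play_onPath _).2 k p hk i hi
            rw [Function.update_self] at h1
            rw [reported_snoc_some h1]
            exact hst k hi h0
          · rw [reported_snoc_none (eq_none_of_not_active hi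
              (G.mem_of_prefix (play_terminal _).1 hk))]
            exact h0
      exact key _ (List.prefix_refl _)
    obtain ⟨θ₀, hθ₀⟩ := reportedAll_nonempty G (G.play (Function.update s i st))
    obtain ⟨θ', hθ'⟩ := reportedAll_nonempty G (G.play (Function.update s i si))
    have hθ := update_mem_reportedAll ht fun j _ => hθ₀ j
    have h3 := hG i (Function.update θ₀ i t) θ' fun k hk =>
      compatible_of_plays hθ hθ' (by rw [Function.update_of_ne hk, Function.update_of_ne hk])
    rw [Function.update_self] at h3
    rwa [outcomeOf_eq hθ, outcomeOf_eq hθ']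

/-- At the root, compatibility for `j` compares the singletons `{θ j}` and `{θ' j}`; hence profiles
compatible for all agents but `i` differ at most in the type of `i`. -/
theorem IsDirect.incentiveCompatible {R : (i : N) → Θ i → X → X → Prop} (hf : StrategyProof R f)
    (hG : G.IsDirect) : G.IncentiveCompatible R := by
  rw [incentiveCompatible_iff]
  intro i θ θ' hc
  refine hf i θ θ' fun j hj => ?_
  have h := hc j hj {[]} (by rw [hG.2]; rfl) [] rfl [] rfl (fun _ => trivial) (fun _ => trivial)
    ⟨{θ j}, Set.singleton_nonempty _⟩ ⟨fun i => some ⟨{θ i}, Set.singleton_nonempty _⟩, ?_, rfl⟩ rfl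
  · exact h.symm
  · rw [hG.1]
    exact Or.inr ⟨θ, rfl⟩

end GradualMechanism

namespace GradualMechanism

open GameForm

variable {N : Type u} {Θ : N → Type v} {X : Type w} {f : ((i : N) → Θ i) → X}
  {G : GradualMechanism f}

/-! ### Splitting and incentives -/

/-- All new moves take place at terminal histories of `G`, which are not decision nodes of `G`. -/
theorem IsSPL.available_eq {Gs : GradualMechanism f} {i I a a₁ a₂} (H : IsSPL G Gs i I a a₁ a₂)
    {k K h} (hK : K ∈ G.info k) (hh : h ∈ K) : Gs.available k h = G.available k h := by
  have hact := G.info_active k K hK h hh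
  ext b
  refine ⟨?_, fun ⟨p, hp, hb⟩ => ⟨p, by rw [H.hist_eq]; exact Or.inl hp, hb⟩⟩
  rintro ⟨p, hp, hb⟩
  rw [H.hist_eq] at hp
  rcases hp with hp | ⟨z, hz, c, -, hc⟩
  · exact ⟨p, hp, hb⟩
  · obtain ⟨rfl, -⟩ := List.append_inj' hc rfl
    exact absurd hact (not_active_of_terminal hz.1)

theorem IsSPL.info_subset {Gs : GradualMechanism f} {i I a a₁ a₂} (H : IsSPL G Gs i I a a₁ a₂)
    {k K} (hK : K ∈ G.info k) : K ∈ Gs.info k := by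
  by_cases hk : k = i
  · subst hk
    rw [H.info_self]
    exact Or.inl hK
  · rwa [H.info_other k hk]

theorem IsSPL.compatible {Gs : GradualMechanism f} {i I a a₁ a₂} (H : IsSPL G Gs i I a a₁ a₂)
    {k θ θ'} (hc : Gs.Compatible k θ θ') : G.Compatible k θ θ' := by
  intro K hK h hh h' hh' h1 h2 b hb
  rw [← H.available_eq hK hh] at hb
  exact hc K (H.info_subset hK) h hh h' hh' h1 h2 b hb

theorem IsSPL.compatible_of {Gs : GradualMechanism f} {i I a a₁ a₂} (H : IsSPL G Gs i I a a₁ a₂)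
    {k θ θ'} (hc : G.Compatible k θ θ') (hs : k = i → ∀ h ∈ G.splitNodes i I a,
      ∀ h' ∈ G.splitNodes i I a, θ ∈ reportedAll h → θ' ∈ reportedAll h' → θ i = θ' i) :
    Gs.Compatible k θ θ' := by
  intro K hK h hh h' hh' h1 h2 b hb hkb
  by_cases hK' : K ∈ G.info k
  · rw [H.available_eq hK' hh] at hb
    exact hc K hK' h hh h' hh' h1 h2 b hb hkb
  · have hk : k = i := by
      by_contra hk
      rw [H.info_other k hk] at hK
      exact hK' hK
    subst hk
    rw [H.info_self] at hK
    obtain rfl := hK.resolve_left hK'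
    rwa [← hs rfl h hh h' hh' h1 h2]

/-- Splitting matters only for an agent `j ≠ i` and for profiles that both end in `splitNodes`.
Replacing `θ' i` by `θ i` there keeps `θ'` in its terminal cell, hence keeps the outcome, and makes
the pair compatible at the new information set. -/
theorem IsSPL.incentiveCompatible_iff {Gs : GradualMechanism f} {i I a a₁ a₂}
    (H : IsSPL G Gs i I a a₁ a₂) (R : (i : N) → Θ i → X → X → Prop) :
    G.IncentiveCompatible R ↔ Gs.IncentiveCompatible R := by
  classical
  rw [GradualMechanism.incentiveCompatible_iff, GradualMechanism.incentiveCompatible_iff]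
  refine ⟨fun hG j θ θ' hc => hG j θ θ' fun k hk => H.compatible (hc k hk),
    fun hG j θ θ' hc => ?_⟩
  by_cases hS : ∃ h ∈ G.splitNodes i I a, ∃ h' ∈ G.splitNodes i I a,
      θ ∈ reportedAll h ∧ θ' ∈ reportedAll h'
  · obtain ⟨z, hz, z', hz', h1, h2⟩ := hS
    by_cases hj : j = i
    · subst hj
      exact hG j θ θ' fun k hk => H.compatible_of (hc k hk) fun h => absurd h hk
    · have h3 : Function.update θ' i (θ i) ∈ reportedAll z' := by
        refine update_mem_reportedAll ?_ fun j _ => h2 j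
        rw [hz'.2.1, ← hz.2.1]
        exact h1 i
      have h4 : f θ' = f (Function.update θ' i (θ i)) := by
        rw [← G.implements z' hz'.1 _ h2, ← G.implements z' hz'.1 _ h3]
      rw [h4]
      refine hG j θ _ fun k hk => H.compatible_of ?_ fun _ _ _ _ _ _ _ => by simp
      intro K hK h hh h' hh' h5 h6 b hb hkb
      -- The altered profile also ends in `z'`, so the nodes on its path are nodes on the path of
      -- `θ'`.
      have h7 : θ' ∈ reportedAll h' :=
        reportedAll_anti hz'.1.1 (prefix_terminal (mem_hist_of_mem_info hK hh') hz'.1 h6 h3) h2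
      by_cases hki : k = i
      · subst hki
        simpa using hkb
      · rw [Function.update_of_ne hki]
        exact hc k hk K hK h hh h' hh' h5 h7 b hb hkb
  · exact hG j θ θ' fun k hk => H.compatible_of (hc k hk) fun _ h hh h' hh' h1 h2 =>
      absurd ⟨h, hh, h', hh', h1, h2⟩ hS

/-! ### Illuminating and incentives -/

/-- Since `Θ_i(h)` does not vary over `h ∈ I`, the separate conditions on the types of `i` and of
the others amount to passing through one node of the part; consistency with common strategies is
compatibility. -/
theorem ipFrom_iff (R : (i : N) → Θ i → X → X → Prop) {i : N} {I I₁ I₂ : Set (History (Report Θ))}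
    (hI : I ∈ G.info i) (h₁ : I₁ ⊆ I) (h₂ : I₂ ⊆ I) :
    G.IPFrom R i I I₁ I₂ ↔ ∀ j, j ≠ i → ∀ θ₁ θ₂ : (k : N) → Θ k,
      (∃ h ∈ I₁, θ₁ ∈ reportedAll h) → (∃ h ∈ I₂, θ₂ ∈ reportedAll h) →
      (∀ k, k ≠ i → k ≠ j → G.Compatible k θ₁ θ₂) → R j (θ₁ j) (f θ₁) (f θ₂) := by
  have key : ∀ {I' : Set (History (Report Θ))} (_ : I' ⊆ I) (θ : (k : N) → Θ k),
      (∃ h ∈ I', θ ∈ reportedAll h) ↔ (θ i ∈ infoOwn i I ∧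
        (fun k : {k : N // k ≠ i} => θ k) ∈ infoOthers i I') := by
    intro I' hI' θ
    constructor
    · rintro ⟨h, hh, hθ⟩
      exact ⟨⟨h, hI' hh, hθ i⟩, h, hh, fun k => hθ k⟩
    · rintro ⟨⟨h, hh, hθ⟩, h', hh', hθ'⟩
      refine ⟨h', hh', fun k => ?_⟩
      by_cases hk : k = i
      · subst hk
        rwa [reported_eq_of_info hI (hI' hh') hh]
      · exact hθ' ⟨k, hk⟩
  unfold IPFrom
  refine forall₄_congr fun j hj θ₁ θ₂ => ?_
  rw [exists_typeConsistent_iff, key h₁, key h₂]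
  simp only [Set.mem_ofPred_eq]
  exact ⟨fun H a b c => H a.1 b.1 a.2 b.2 fun k hk => c k hk.1 hk.2,
    fun H a b c d e => H ⟨a, c⟩ ⟨b, d⟩ fun k h1 h2 => e k ⟨h1, h2⟩⟩

theorem IsILL.symm {Gs : GradualMechanism f} {i I I₁ I₂} (H : IsILL G Gs i I I₁ I₂) :
    IsILL G Gs i I I₂ I₁ where
  info_mem := H.info_mem
  nonempty₁ := H.nonempty₂
  nonempty₂ := H.nonempty₁
  disjoint := H.disjoint.symm
  union := by rw [Set.union_comm, H.union]
  hist_eq := H.hist_eq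
  info_other := H.info_other
  info_self := by
    rw [H.info_self]
    simp only [or_comm]
  outcome_eq := H.outcome_eq

theorem IsILL.compatible_other {Gs : GradualMechanism f} {i I I₁ I₂} (H : IsILL G Gs i I I₁ I₂)
    {k} (hk : k ≠ i) {θ θ' : (k : N) → Θ k} : Gs.Compatible k θ θ' ↔ G.Compatible k θ θ' := by
  unfold Compatible GameForm.available
  rw [H.hist_eq, H.info_other k hk]

theorem IsILL.info_subset {Gs : GradualMechanism f} {i I I₁ I₂} (H : IsILL G Gs i I I₁ I₂)
    {k L} (hL : L ∈ Gs.info k) : ∃ K ∈ G.info k, L ⊆ K := by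
  by_cases hk : k = i
  · subst hk
    rw [H.info_self] at hL
    rcases hL with ⟨hL, -⟩ | ⟨-, K, hK, -, rfl | rfl⟩
    · exact ⟨L, hL, subset_rfl⟩
    · exact ⟨K, hK, fun h hh => hh.1⟩
    · exact ⟨K, hK, fun h hh => hh.1⟩
  · rw [H.info_other k hk] at hL
    exact ⟨L, hL, subset_rfl⟩

/-- New information sets are contained in old ones, so two paths have fewer common crossings. -/
theorem IsILL.compatible {Gs : GradualMechanism f} {i I I₁ I₂} (H : IsILL G Gs i I I₁ I₂)
    {k} {θ θ' : (k : N) → Θ k} (hc : G.Compatible k θ θ') : Gs.Compatible k θ θ' := by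
  intro L hL h hh h' hh' h1 h2 a ha
  obtain ⟨K, hK, hLK⟩ := H.info_subset hL
  unfold GameForm.available at ha
  rw [H.hist_eq] at ha
  exact hc K hK h (hLK hh) h' (hLK hh') h1 h2 a ha

/-- Information sets that `I` does not precede cannot separate two profiles passing through `I`. -/
theorem mem_of_passes {i : N} {I K} (hI : I ∈ G.info i) (hK : K ∈ G.info i)
    (hIK : ¬ InfoPrecEq I K) {θ θ' : (k : N) → Θ k} {g g' h h'} (hg : g ∈ I) (hg' : g' ∈ I)
    (hh : h ∈ K) (hh' : h' ∈ K) (hθg : θ ∈ reportedAll g) (hθg' : θ' ∈ reportedAll g')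
    (hθh : θ ∈ reportedAll h) (hθh' : θ' ∈ reportedAll h') {a} (ha : a ∈ G.available i h)
    (hia : θ i ∈ a.1) : θ' i ∈ a.1 := by
  have hgm := mem_hist_of_mem_info hI hg
  have hgm' := mem_hist_of_mem_info hI hg'
  have hhg : h <+: g := (comparable hgm (mem_hist_of_mem_info hK hh) hθg hθh).resolve_left
    fun h1 => hIK ⟨h, hh, g, hg, h1⟩
  have hhg' : h' <+: g' := (comparable hgm' (mem_hist_of_mem_info hK hh') hθg' hθh').resolve_left
    fun h1 => hIK ⟨h', hh', g', hg', h1⟩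
  have hne : h ≠ g := by
    rintro rfl
    exact hIK ⟨h, hh, h, hg, List.prefix_refl _⟩
  obtain ⟨p, hp⟩ := exists_snoc_prefix hhg hne
  obtain ⟨b, hb, hba⟩ := (G.info_active i K hK h hh).exists_eq_some hgm hp
  obtain ⟨g₂, hg₂, p₂, hp₂, hpe⟩ := recall_snoc hI hK hh hg hg' hp
  have h1 := mem_of_snoc_prefix hgm hp hb hθg
  rw [available_unique ha hba hia h1]
  exact mem_of_snoc_prefix hgm' hp₂ (hpe.trans hb) hθg'

/-- At information sets that `I` does not weakly precede, perfect recall at `I` forces equal choices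
on the two paths. The later ones have been divided according to the part passed, so the two paths no
longer share any. -/
theorem IsILL.compatible_of_passes {Gs : GradualMechanism f} {i I I₁ I₂}
    (H : IsILL G Gs i I I₁ I₂) {θ θ' : (k : N) → Θ k} (h₁ : ∃ g ∈ I₁, θ ∈ reportedAll g)
    (h₂ : ∃ g ∈ I₂, θ' ∈ reportedAll g) : Gs.Compatible i θ θ' := by
  obtain ⟨g₁, hg₁, hθ₁⟩ := h₁
  obtain ⟨g₂, hg₂, hθ₂⟩ := h₂
  have hs₁ : I₁ ⊆ I := H.union ▸ Set.subset_union_left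
  have hs₂ : I₂ ⊆ I := H.union ▸ Set.subset_union_right
  intro L hL h hh h' hh' h1 h2 a ha hia
  unfold GameForm.available at ha
  rw [H.hist_eq] at ha
  rw [H.info_self] at hL
  -- A path crosses `I` at most once: a predecessor of `k` in `I` must be the node of `I` that `t`
  -- passes.
  have key : ∀ {K : Set (History (Report Θ))} {k g g'} {t : (k : N) → Θ k} (_ : K ∈ G.info i)
      (_ : k ∈ K) (_ : t ∈ reportedAll k) (_ : t ∈ reportedAll g) (_ : g ∈ I) (_ : g' ∈ I)
      (_ : g' <+: k), g = g' := by
    intro K k g g' t hK hk ht htg hg hg' hgk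
    have hkm := mem_hist_of_mem_info hK hk
    have hgm := mem_hist_of_mem_info H.info_mem hg
    obtain ⟨z, hz, hkz, hθz⟩ := exists_terminal hkm ht
    exact info_antichain H.info_mem hg hg' hz.1 (prefix_terminal hgm hz htg hθz) (hgk.trans hkz)
  rcases hL with ⟨hL, hne⟩ | ⟨-, K, hK, -, rfl | rfl⟩
  · exact mem_of_passes H.info_mem hL hne (hs₁ hg₁) (hs₂ hg₂) hh hh' hθ₁ hθ₂ h1 h2 ha hia
  · obtain ⟨g, hg, hgh⟩ := hh'.2
    have := key hK hh'.1 h2 hθ₂ (hs₂ hg₂) (hs₁ hg) hgh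
    subst this
    exact absurd hg₂ (Set.disjoint_left.1 H.disjoint hg)
  · obtain ⟨g, hg, hgh⟩ := hh.2
    have := key hK hh.1 h1 hθ₁ (hs₁ hg₁) (hs₂ hg) hgh
    subst this
    exact absurd hg (Set.disjoint_left.1 H.disjoint hg₁)

theorem IsILL.ipFrom {Gs : GradualMechanism f} {i I I₁ I₂} (H : IsILL G Gs i I I₁ I₂)
    {R : (i : N) → Θ i → X → X → Prop} (hG : Gs.IncentiveCompatible R) :
    G.IPFrom R i I I₁ I₂ := by
  have hs₁ : I₁ ⊆ I := H.union ▸ Set.subset_union_left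
  have hs₂ : I₂ ⊆ I := H.union ▸ Set.subset_union_right
  rw [ipFrom_iff R H.info_mem hs₁ hs₂]
  rw [incentiveCompatible_iff] at hG
  intro j hj θ₁ θ₂ h₁ h₂ hc
  refine hG j θ₁ θ₂ fun k hk => ?_
  by_cases hki : k = i
  · subst hki
    exact H.compatible_of_passes h₁ h₂
  · exact (H.compatible_other hki).2 (hc k hki hk)

theorem exists_pred_of_infoPrecEq {i : N} {I K} (hI : I ∈ G.info i) (hK : K ∈ G.info i)
    (hIK : InfoPrecEq I K) {h} (hh : h ∈ K) : ∃ g ∈ I, g <+: h := by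
  obtain ⟨k, hk, g, hg, hgk⟩ := hIK
  obtain ⟨g₂, hg₂, J, hJ, h1, h2⟩ := G.recall_info i K hK k hk h hh g hgk (G.info_active i I hI g hg)
  rw [info_eq_of_mem hI hJ hg h1]
  exact ⟨g₂, h2, hg₂⟩

/-- The two labellings in `IncentivePreserving` cover the pairs in which `θ` passes the one part and
`θ'` the other. For the remaining pairs and agents other than `i`, the two mechanisms impose the
same inequalities. -/
theorem IsILL.incentiveCompatible_iff {Gs : GradualMechanism f} {i I I₁ I₂}
    (H : IsILL G Gs i I I₁ I₂) (R : (i : N) → Θ i → X → X → Prop) :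
    Gs.IncentiveCompatible R ↔
      G.IncentivePreserving R i I I₁ I₂ ∧ G.IncentiveCompatible R := by
  have hs₁ : I₁ ⊆ I := H.union ▸ Set.subset_union_left
  have hs₂ : I₂ ⊆ I := H.union ▸ Set.subset_union_right
  constructor
  · intro hG
    refine ⟨⟨H.ipFrom hG, H.symm.ipFrom hG⟩, ?_⟩
    rw [GradualMechanism.incentiveCompatible_iff] at hG ⊢
    exact fun j θ θ' hc => hG j θ θ' fun k hk => H.compatible (hc k hk)
  · rintro ⟨⟨h₁, h₂⟩, hG⟩
    rw [ipFrom_iff R H.info_mem hs₁ hs₂] at h₁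
    rw [ipFrom_iff R H.info_mem hs₂ hs₁] at h₂
    rw [GradualMechanism.incentiveCompatible_iff] at hG ⊢
    intro j θ θ' hc
    have hc' : ∀ k, k ≠ i → k ≠ j → G.Compatible k θ θ' := fun k hki hkj =>
      (H.compatible_other hki).1 (hc k hkj)
    by_cases hj : j = i
    · exact hG j θ θ' fun k hk => hc' k (hj ▸ hk) hk
    by_cases hp₁ : (∃ h ∈ I₁, θ ∈ reportedAll h) ∧ ∃ h ∈ I₂, θ' ∈ reportedAll h
    · exact h₁ j hj θ θ' hp₁.1 hp₁.2 hc'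
    by_cases hp₂ : (∃ h ∈ I₂, θ ∈ reportedAll h) ∧ ∃ h ∈ I₁, θ' ∈ reportedAll h
    · exact h₂ j hj θ θ' hp₂.1 hp₂.2 hc'
    -- Now the two profiles do not pass through different parts, so an old information set at or
    -- after `I` that both cross yields a new one that both cross.
    refine hG j θ θ' fun k hk => ?_
    by_cases hki : k = i
    swap
    · exact hc' k hki hk
    subst hki
    have hci := hc k hk
    intro K hK h hh h' hh' hθ hθ' a ha hka
    have ha' : a ∈ Gs.available k h := by
      unfold GameForm.available
      rwa [H.hist_eq]
    by_cases hIK : InfoPrecEq I K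
    · obtain ⟨g, hg, hgh⟩ := exists_pred_of_infoPrecEq H.info_mem hK hIK hh
      obtain ⟨g', hg', hgh'⟩ := exists_pred_of_infoPrecEq H.info_mem hK hIK hh'
      have hθg := reportedAll_anti (mem_hist_of_mem_info hK hh) hgh hθ
      have hθg' := reportedAll_anti (mem_hist_of_mem_info hK hh') hgh' hθ'
      rw [← H.union] at hg hg'
      rcases hg with hg | hg <;> rcases hg' with hg' | hg'
      · refine hci {h | h ∈ K ∧ SetPrecEq I₁ h} ?_ h ⟨hh, g, hg, hgh⟩ h' ⟨hh', g', hg', hgh'⟩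
          hθ hθ' a ha' hka
        rw [H.info_self]
        exact Or.inr ⟨⟨h, hh, g, hg, hgh⟩, K, hK, hIK, Or.inl rfl⟩
      · exact absurd ⟨⟨g, hg, hθg⟩, g', hg', hθg'⟩ hp₁
      · exact absurd ⟨⟨g, hg, hθg⟩, g', hg', hθg'⟩ hp₂
      · refine hci {h | h ∈ K ∧ SetPrecEq I₂ h} ?_ h ⟨hh, g, hg, hgh⟩ h' ⟨hh', g', hg', hgh'⟩
          hθ hθ' a ha' hka
        rw [H.info_self]
        exact Or.inr ⟨⟨h, hh, g, hg, hgh⟩, K, hK, hIK, Or.inr rfl⟩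
    · refine hci K ?_ h hh h' hh' hθ hθ' a ha' hka
      rw [H.info_self]
      exact Or.inl ⟨hK, hIK⟩

end GradualMechanism

/-! ### Coalescing: the tree -/

namespace GradualMechanism

open GameForm

section Coalescing

open Classical

variable {N : Type u} {Θ : N → Type v} {X : Type w} {f : ((i : N) → Θ i) → X}
  {G : GradualMechanism f}

/-- The information set `J` of agent `i` can be coalesced into `I`. -/
structure Coalescible (G : GradualMechanism f) (i : N) (I J : Set (History (Report Θ)))
    (a : Report Θ i) : Prop where
  available : G.AvailableAtInfo i I a
  succ : G.ImmediateSucc i I a J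
  no_news : infoOthers i I = infoOthers i J

/-- The histories of the coalesced mechanism. -/
def coaHist (G : GradualMechanism f) (i : N) (I J : Set (History (Report Θ))) (a : Report Θ i) :
    Set (History (Report Θ)) :=
  {hs | ∃ h, G.CoaKeep i I a hs h ∨ G.CoaBefore i I J a hs h ∨ G.CoaAfter i I J a hs h}

theorem update_mem_hist {h : History (Report Θ)} {q : ActionProfile (Report Θ)} {i : N}
    {b : Report Θ i} (hq : h ++ [q] ∈ G.hist) (hb : b ∈ G.available i h) :
    h ++ [Function.update q i (some b)] ∈ G.hist := by
  refine G.product h ⟨q, hq⟩ _ (fun j hj => ?_) (fun j hj => ?_)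
  · by_cases hji : j = i
    · subst hji
      exact ⟨b, hb, by simp⟩
    · obtain ⟨c, hc, hc'⟩ := hj.exists_eq_some hq (List.prefix_refl _)
      exact ⟨c, hc', by simpa [hji] using hc⟩
  · have hji : j ≠ i := by
      rintro rfl
      exact hj (activeAt_of_available hb)
    rw [Function.update_of_ne hji]
    exact eq_none_of_not_active hj hq

theorem decisions_eq_of_not_active {i : N} {g k : History (Report Θ)} (hk : k ∈ G.hist)
    (hgk : g <+: k) (hna : ∀ h, g <+: h → h <+: k → h ≠ k → ¬ G.Active i h) :
    decisions i k = decisions i g := by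
  obtain ⟨t, rfl⟩ := hgk
  induction t using List.reverseRecOn with
  | nil => simp
  | append_singleton t p ih =>
    rw [← List.append_assoc] at hk hna ⊢
    have h1 : ¬ G.Active i (g ++ t) :=
      hna _ (List.prefix_append _ _) (List.prefix_append _ _) (by simp)
    rw [decisions_append, decisions_singleton_none (eq_none_of_not_active h1 hk), List.append_nil]
    refine ih (G.prefix_mem _ _ hk) fun h h2 h3 h4 => hna h h2 (h3.trans (List.prefix_append _ _)) ?_
    rintro rfl
    exact not_snoc_prefix_self h3

theorem decisions_dropAgent_self {i : N} {q : ActionProfile (Report Θ)} :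
    decisions i (dropAgent i q) = [] := by
  unfold dropAgent
  split
  · exact decisions_singleton_none (by simp)
  · rfl

theorem decisions_update_of_ne {i k : N} (hk : k ≠ i) {q : ActionProfile (Report Θ)}
    {o : Option (Report Θ i)} : decisions k [Function.update q i o] = decisions k [q] := by
  simp [decisions, List.filterMap_cons, hk]

theorem decisions_dropAgent_of_ne {i k : N} (hk : k ≠ i) {q : ActionProfile (Report Θ)} :
    decisions k (dropAgent i q) = decisions k [q] := by
  unfold dropAgent
  split
  · exact decisions_update_of_ne hk
  · rename_i h
    push Not at h
    have := h k hk
    simp only [Option.isSome_iff_ne_none, ne_eq, not_not] at this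
    rw [decisions_singleton_none this]
    rfl

namespace Coalescible

variable {i : N} {I J : Set (History (Report Θ))} {a : Report Θ i}

theorem mem_available (C : Coalescible G i I J a) {g} (hg : g ∈ I) : a ∈ G.available i g := by
  obtain ⟨k, hk, ha⟩ := C.available
  exact available_of_info C.succ.1 hk hg ha

/-- `ImmediateSucc` provides a single path of this kind; perfect recall extends it to all nodes of
`J`. -/
theorem exists_pred (C : Coalescible G i I J a) {k} (hk : k ∈ J) :
    ∃ g ∈ I, ∃ p : ActionProfile (Report Θ), p i = some a ∧ g ++ [p] <+: k := by
  obtain ⟨hI, hJ, -, -, g, hg, k', hk', p, hp, hpk⟩ := C.succ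
  obtain ⟨g₂, hg₂, p₂, h1, h2⟩ := recall_snoc hJ hI hg hk' hk hpk
  exact ⟨g₂, hg₂, p₂, h2.trans hp, h1⟩

/-- An information set of `i` met on the way would contradict the immediacy of the succession. -/
theorem not_active_between (C : Coalescible G i I J a) {g h k} (hg : g ∈ I)
    {p : ActionProfile (Report Θ)} (hgh : g ++ [p] <+: h) (hk : k ∈ J) (hhk : h <+: k)
    (hne : h ≠ k) : ¬ G.Active i h := by
  intro hact
  obtain ⟨K, hK, hh⟩ := exists_info hact
  refine C.succ.2.2.2.1 ⟨K, hK, ⟨h, hh, g, hg, (List.prefix_append _ _).trans hgh, ?_⟩,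
    ⟨k, hk, h, hh, hhk, hne⟩⟩
  rintro rfl
  exact not_snoc_prefix_self hgh

theorem decisions_eq (C : Coalescible G i I J a) {g h k} (hg : g ∈ I)
    {p : ActionProfile (Report Θ)} (hp : p i = some a) (hgh : g ++ [p] <+: h) (hk : k ∈ J)
    (hhk : h <+: k) : decisions i h = decisions i g ++ [a] := by
  have hkm := mem_hist_of_mem_info C.succ.2.1 hk
  rw [decisions_eq_of_not_active (G.mem_of_prefix hkm hhk) hgh fun h' h1 h2 h3 =>
    C.not_active_between hg h1 hk (h2.trans hhk) fun h4 => h3 (h2.eq_of_length_le (by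
      subst h4
      exact hhk.length_le)), decisions_append, decisions_singleton_some hp]

theorem reported_eq (C : Coalescible G i I J a) {k} (hk : k ∈ J) : reported i k = a.1 := by
  obtain ⟨g, hg, p, hp, hgk⟩ := C.exists_pred hk
  exact reported_of_decisions (C.decisions_eq hg hp hgk hk (List.prefix_refl _))

theorem subset_of_available (C : Coalescible G i I J a) {b} (hb : G.AvailableAtInfo i J b) :
    b.1 ⊆ a.1 := by
  obtain ⟨k, hk, hb⟩ := hb
  rw [← C.reported_eq hk]
  exact available_subset hb

theorem exists_mem_available (C : Coalescible G i I J a) {t} (ht : t ∈ a.1) :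
    ∃ b, G.AvailableAtInfo i J b ∧ t ∈ b.1 := by
  obtain ⟨k, hk⟩ := G.info_nonempty i J C.succ.2.1
  rw [← C.reported_eq hk] at ht
  obtain ⟨b, hb, htb⟩ := exists_available (G.info_active i J C.succ.2.1 k hk) ht
  exact ⟨b, ⟨k, hk, hb⟩, htb⟩

theorem not_mem_both (C : Coalescible G i I J a) {k} (hI : k ∈ I) : k ∉ J := by
  intro hJ
  obtain ⟨g, hg, p, hp, hgk⟩ := C.exists_pred hJ
  have := info_antichain C.succ.1 hg hI (mem_hist_of_mem_info C.succ.1 hI)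
    ((List.prefix_append _ _).trans hgk) (List.prefix_refl _)
  subst this
  exact not_snoc_prefix_self hgk

/-- Every path that follows the choice of `a` at `I` passes through `J`. -/
theorem exists_mem (C : Coalescible G i I J a) {g h} (hg : g ∈ I) {p : ActionProfile (Report Θ)}
    (hp : p i = some a) (hgh : g ++ [p] <+: h) (hh : h ∈ G.hist) {θ : (i : N) → Θ i}
    (hθ : θ ∈ reportedAll h) :
    ∃ k ∈ J, g ++ [p] <+: k ∧ θ ∈ reportedAll k ∧ (h <+: k ∨ k <+: h) := by
  have hgm := mem_hist_of_mem_info C.succ.1 hg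
  have hθg := reportedAll_anti hh ((List.prefix_append _ _).trans hgh) hθ
  -- This is where the absence of news enters: what the others have reported at `g` is also possible
  -- at some node of `J`. The type of `i` fits because her report throughout `J` is `a`.
  have h1 : (fun j : {j : N // j ≠ i} => θ j) ∈ infoOthers i J := by
    rw [← C.no_news]
    exact ⟨g, hg, fun j => hθg j⟩
  obtain ⟨k, hk, hθk⟩ := h1
  have hkm := mem_hist_of_mem_info C.succ.2.1 hk
  have hθk' : θ ∈ reportedAll k := by
    intro j
    by_cases hj : j = i
    · subst hj
      rw [C.reported_eq hk]
      exact mem_of_snoc_prefix hh hgh hp hθ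
    · exact hθk ⟨j, hj⟩
  refine ⟨k, hk, ?_, hθk', comparable hh hkm hθ hθk'⟩
  have h2 := reportedAll_anti hh hgh hθ
  rcases comparable (G.mem_of_prefix hh hgh) hkm h2 hθk' with h3 | h3
  · exact h3
  -- If `k` does not lie beyond `g ++ [p]`, its predecessor in `I` is `g` itself and is followed by
  -- the same profile `p`.
  · obtain ⟨g', hg', p', hp', hgk'⟩ := C.exists_pred hk
    have h4 : g' = g := info_antichain C.succ.1 hg' hg (G.mem_of_prefix hh hgh)
      (((List.prefix_append _ _).trans hgk').trans h3) (List.prefix_append _ _)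
    subst h4
    have h5 := snoc_prefix_unique (hgk'.trans h3) (List.prefix_refl _)
    rwa [← h5]

theorem before_prefix (C : Coalescible G i I J a) {g h} (hg : g ∈ I)
    {p : ActionProfile (Report Θ)} (hp : p i = some a) (hgh : g ++ [p] <+: h) (hh : h ∈ G.hist)
    (hJ : ¬ SetPrec J h) : ∃ k ∈ J, h <+: k := by
  obtain ⟨θ, hθ⟩ := reportedAll_nonempty G h
  obtain ⟨k, hk, -, -, h1 | h1⟩ := C.exists_mem hg hp hgh hh hθ
  · exact ⟨k, hk, h1⟩
  · by_cases hne : k = h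
    · exact ⟨k, hk, hne ▸ List.prefix_refl _⟩
    · exact absurd ⟨k, hk, h1, hne⟩ hJ

theorem not_setPrec (C : Coalescible G i I J a) {h k} (hk : k ∈ J) (hhk : h <+: k) :
    ¬ SetPrec J h := by
  rintro ⟨k', hk', h1, hne⟩
  have := info_antichain C.succ.2.1 hk' hk (mem_hist_of_mem_info C.succ.2.1 hk) (h1.trans hhk)
    (List.prefix_refl _)
  subst this
  exact hne (h1.eq_of_length_le hhk.length_le)

/-- A history that is kept does not follow a choice moved from `J` to `I`. -/
theorem keep_not_follows (C : Coalescible G i I J a) {hs h} (hK : G.CoaKeep i I a hs h)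
    {g} (hg : g ∈ I) {p : ActionProfile (Report Θ)} {b : Report Θ i} (hp : p i = some a)
    (hb : G.AvailableAtInfo i J b) (hgs : g ++ [Function.update p i (some b)] <+: hs) : False := by
  obtain ⟨rfl, hh, hn⟩ := hK
  obtain ⟨c, hc, hc'⟩ := (G.info_active i I C.succ.1 g hg).exists_eq_some hh hgs
  have hcb : b = c := by simpa using hc
  subst hcb
  obtain ⟨t, ht⟩ := b.2
  obtain rfl := available_unique hc' (C.mem_available hg) ht (C.subset_of_available hb ht)
  exact hn ⟨g, hg, _, hc, hgs⟩

/-- A path crosses `I` only once, so the place of the replacement can be read off the new history;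
the overwritten component of `p` is known to be `a`. -/
theorem follows_unique (C : Coalescible G i I J a) {g g' : History (Report Θ)} (hg : g ∈ I)
    (hg' : g' ∈ I) {p p' : ActionProfile (Report Θ)} {b b' : Report Θ i} (hp : p i = some a)
    (hp' : p' i = some a) {hs k k' : History (Report Θ)}
    (h1 : hs = g ++ [Function.update p i (some b)] ++ k)
    (h2 : hs = g' ++ [Function.update p' i (some b')] ++ k') :
    g = g' ∧ p = p' ∧ b = b' ∧ k = k' := by
  have hgm := mem_hist_of_mem_info C.succ.1 hg
  have hgm' := mem_hist_of_mem_info C.succ.1 hg'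
  have hgs : g <+: hs := ⟨[Function.update p i (some b)] ++ k, by simp [h1]⟩
  have hgs' : g' <+: hs := ⟨[Function.update p' i (some b')] ++ k', by simp [h2]⟩
  have hgg : g = g' := by
    rcases List.prefix_or_prefix_of_prefix hgs hgs' with h | h
    · exact info_antichain C.succ.1 hg hg' hgm' h (List.prefix_refl _)
    · exact (info_antichain C.succ.1 hg' hg hgm h (List.prefix_refl _)).symm
  subst hgg
  rw [h1] at h2
  simp only [List.append_assoc, List.append_cancel_left_eq, List.cons_append, List.nil_append,
    List.cons.injEq] at h2
  obtain ⟨h3, h4⟩ := h2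
  refine ⟨rfl, ?_, ?_, h4⟩
  · funext j
    by_cases hj : j = i
    · subst hj
      rw [hp, hp']
    · simpa [hj] using congrFun h3 j
  · simpa using congrFun h3 i

theorem before_unique (C : Coalescible G i I J a) {hs h h'} (h1 : G.CoaBefore i I J a hs h)
    (h2 : G.CoaBefore i I J a hs h') : h = h' := by
  obtain ⟨g, hg, p, k, b, hp, rfl, -, -, -, hs1⟩ := h1
  obtain ⟨g', hg', p', k', b', hp', rfl, -, -, -, hs2⟩ := h2
  obtain ⟨rfl, rfl, rfl, rfl⟩ := C.follows_unique hg hg' hp hp' hs1 hs2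
  rfl

/-- Two old histories can give the same new one only if `i` moves alone at `J`: only then does
deleting her move delete the whole profile. -/
theorem before_after (C : Coalescible G i I J a) {hs h h'} (h1 : G.CoaBefore i I J a hs h)
    (h2 : G.CoaAfter i I J a hs h') : h ∈ J ∧ ∀ j, j ≠ i → ¬ G.Active j h := by
  obtain ⟨g, hg, p, k, b, hp, rfl, hh, hJ, -, hs1⟩ := h1
  obtain ⟨g', hg', p', q, k', l, b', hp', hq, hk', rfl, hh', hs2⟩ := h2
  rw [List.append_assoc (_ ++ k'), List.append_assoc _ k'] at hs2
  obtain ⟨rfl, rfl, rfl, rfl⟩ := C.follows_unique hg hg' hp hp' hs1 hs2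
  have h3 : g ++ [p] ++ k' = g ++ [p] ++ (k' ++ (dropAgent i q ++ l)) := by
    by_contra hne
    exact hJ ⟨_, hk', ⟨dropAgent i q ++ l, by simp⟩, hne⟩
  have h4 : dropAgent i q = [] := (by simpa using h3 : _ ∧ _).1
  rw [← h3]
  refine ⟨hk', fun j hj hact => ?_⟩
  have hqm : g ++ [p] ++ k' ++ [q] ∈ G.hist := G.mem_of_prefix hh' ⟨l, rfl⟩
  have := G.active_uniform _ _ j hqm hact
  unfold dropAgent at h4
  rw [if_pos ⟨j, hj, this⟩] at h4
  simp at h4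

/-- A path crosses `J` only once, which fixes where `q` was. What `dropAgent` deletes from `q` is
the action `b`, and that has been recorded at `I`; whether a whole profile was deleted depends only
on who is active at the node of `J`. -/
theorem after_unique (C : Coalescible G i I J a) {hs h h'} (h1 : G.CoaAfter i I J a hs h)
    (h2 : G.CoaAfter i I J a hs h') : h = h' := by
  obtain ⟨g, hg, p, q, k, l, b, hp, hq, hk, rfl, hh, hs1⟩ := h1
  obtain ⟨g', hg', p', q', k', l', b', hp', hq', hk', rfl, hh', hs2⟩ := h2
  rw [List.append_assoc (_ ++ k), List.append_assoc _ k] at hs1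
  rw [List.append_assoc (_ ++ k'), List.append_assoc _ k'] at hs2
  obtain ⟨rfl, rfl, rfl, h3⟩ := C.follows_unique hg hg' hp hp' hs1 hs2
  have hkk : k = k' := by
    have h4 : k <+: k' ++ (dropAgent i q' ++ l') := ⟨_, h3⟩
    rcases List.prefix_or_prefix_of_prefix h4 (List.prefix_append _ _) with h5 | h5
    · have := info_antichain C.succ.2.1 hk hk' (mem_hist_of_mem_info C.succ.2.1 hk')
        ((List.prefix_append_right_inj _).2 h5) (List.prefix_refl _)
      simpa using this
    · have := info_antichain C.succ.2.1 hk' hk (mem_hist_of_mem_info C.succ.2.1 hk)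
        ((List.prefix_append_right_inj _).2 h5) (List.prefix_refl _)
      simpa using this.symm
  subst hkk
  have h4 : dropAgent i q ++ l = dropAgent i q' ++ l' := by simpa using h3
  have hqm : g ++ [p] ++ k ++ [q] ∈ G.hist := G.mem_of_prefix hh ⟨l, rfl⟩
  have hqm' : g ++ [p] ++ k ++ [q'] ∈ G.hist := G.mem_of_prefix hh' ⟨l', rfl⟩
  have h5 : ∀ j, (q j).isSome ↔ (q' j).isSome := fun j =>
    ⟨fun h => G.active_uniform _ _ j hqm' ⟨q, hqm, h⟩,
      fun h => G.active_uniform _ _ j hqm ⟨q', hqm', h⟩⟩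
  have hqq : q = q' ∧ l = l' := by
    unfold dropAgent at h4
    by_cases hs : ∃ j, j ≠ i ∧ (q j).isSome
    · have hs' : ∃ j, j ≠ i ∧ (q' j).isSome := by
        simpa only [h5] using hs
      rw [if_pos hs, if_pos hs'] at h4
      simp only [List.cons_append, List.nil_append, List.cons.injEq] at h4
      refine ⟨?_, h4.2⟩
      funext j
      by_cases hj : j = i
      · subst hj
        rw [hq, hq']
      · simpa [hj] using congrFun h4.1 j
    · have hs' : ¬ ∃ j, j ≠ i ∧ (q' j).isSome := by
        simpa only [h5] using hs
      rw [if_neg hs, if_neg hs'] at h4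
      refine ⟨?_, h4⟩
      funext j
      by_cases hj : j = i
      · subst hj
        rw [hq, hq']
      · have h6 : q j = none := by
          by_contra hne
          exact hs ⟨j, hj, Option.isSome_iff_ne_none.2 hne⟩
        have h7 : q' j = none := by
          by_contra hne
          exact hs' ⟨j, hj, Option.isSome_iff_ne_none.2 hne⟩
        rw [h6, h7]
  rw [hqq.1, hqq.2]

theorem keep_before (C : Coalescible G i I J a) {hs h h'} (h1 : G.CoaKeep i I a hs h)
    (h2 : G.CoaBefore i I J a hs h') : False := by
  obtain ⟨g, hg, p, k, b, hp, -, -, -, hb, hs2⟩ := h2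
  exact C.keep_not_follows h1 hg hp hb ⟨k, hs2.symm⟩

theorem keep_after (C : Coalescible G i I J a) {hs h h'} (h1 : G.CoaKeep i I a hs h)
    (h2 : G.CoaAfter i I J a hs h') : False := by
  obtain ⟨g, hg, p, q, k, l, b, hp, hq, hk, rfl, hh, hs2⟩ := h2
  have hqm : g ++ [p] ++ k ++ [q] ∈ G.hist := G.mem_of_prefix hh ⟨l, rfl⟩
  exact C.keep_not_follows h1 hg hp (b := b) ⟨_, hk, q, hqm, hq⟩
    ⟨k ++ dropAgent i q ++ l, by simp [hs2]⟩

/-- The priority rule in `CoaMap` becomes a local condition: the history up to `J` is discarded only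
at nodes of `J` where nobody but `i` moves. -/
theorem coaMap_iff (C : Coalescible G i I J a) {hs h} : G.CoaMap i I J a hs h ↔
    G.CoaAfter i I J a hs h ∨ G.CoaKeep i I a hs h ∨
      (G.CoaBefore i I J a hs h ∧ (h ∈ J → ∃ j, j ≠ i ∧ G.Active j h)) := by
  unfold CoaMap
  constructor
  · rintro (h1 | ⟨h1 | h1, h2⟩)
    · exact Or.inl h1
    · exact Or.inr (Or.inl h1)
    · refine Or.inr (Or.inr ⟨h1, fun hJ => ?_⟩)
      by_contra hne
      push Not at hne
      obtain ⟨g, hg, p, k, b, hp, rfl, hh, -, hb, rfl⟩ := h1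
      obtain ⟨k', hk', hb⟩ := hb
      obtain ⟨q, hq, hqb⟩ := available_of_info C.succ.2.1 hk' hJ hb
      refine h2 ⟨_, g, hg, p, q, k, [], b, hp, hqb, hJ, rfl, by simpa using hq, ?_⟩
      unfold dropAgent
      rw [if_neg]
      · simp
      · rintro ⟨j, hj, hjs⟩
        exact hne j hj ⟨q, hq, hjs⟩
  · rintro (h1 | h1 | ⟨h1, h2⟩)
    · exact Or.inl h1
    · exact Or.inr ⟨Or.inl h1, fun ⟨k, hk⟩ => C.keep_after h1 hk⟩
    · refine Or.inr ⟨Or.inr h1, fun ⟨k, hk⟩ => ?_⟩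
      obtain ⟨h3, h4⟩ := C.before_after h1 hk
      obtain ⟨j, hj, hact⟩ := h2 h3
      exact h4 j hj hact

theorem coaMap_unique (C : Coalescible G i I J a) {hs h h'} (h1 : G.CoaMap i I J a hs h)
    (h2 : G.CoaMap i I J a hs h') : h = h' := by
  rcases h1 with h1 | ⟨h1 | h1, h3⟩ <;> rcases h2 with h2 | ⟨h2 | h2, h4⟩
  · exact C.after_unique h1 h2
  · exact absurd ⟨_, h1⟩ h4
  · exact absurd ⟨_, h1⟩ h4
  · exact absurd ⟨_, h2⟩ h3
  · exact h1.1.symm.trans h2.1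
  · exact (C.keep_before h1 h2).elim
  · exact absurd ⟨_, h2⟩ h3
  · exact (C.keep_before h2 h1).elim
  · exact C.before_unique h1 h2

theorem mem_coaHist_of_coaMap {hs h} (h1 : G.CoaMap i I J a hs h) : hs ∈ G.coaHist i I J a := by
  rcases h1 with h1 | ⟨h1 | h1, -⟩
  · exact ⟨h, Or.inr (Or.inr h1)⟩
  · exact ⟨h, Or.inl h1⟩
  · exact ⟨h, Or.inr (Or.inl h1)⟩

theorem exists_coaMap {hs} (h : hs ∈ G.coaHist i I J a) : ∃ h, G.CoaMap i I J a hs h := by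
  by_cases h1 : ∃ k, G.CoaAfter i I J a hs k
  · obtain ⟨k, hk⟩ := h1
    exact ⟨k, Or.inl hk⟩
  · obtain ⟨k, hk | hk | hk⟩ := h
    · exact ⟨k, Or.inr ⟨Or.inl hk, h1⟩⟩
    · exact ⟨k, Or.inr ⟨Or.inr hk, h1⟩⟩
    · exact ⟨k, Or.inl hk⟩

theorem coaMap_mem {hs h} (h1 : G.CoaMap i I J a hs h) : h ∈ G.hist := by
  rcases h1 with h1 | ⟨h1 | h1, -⟩
  · obtain ⟨g, hg, p, q, k, l, b, hp, hq, hk, rfl, hh, hs2⟩ := h1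
    exact hh
  · exact h1.2.1
  · obtain ⟨g, hg, p, k, b, hp, rfl, hh, -⟩ := h1
    exact hh

end Coalescible

end Coalescing

end GradualMechanism

/-! ### Coalescing: successors, decisions and reports under the map to old histories. -/

namespace GradualMechanism

open GameForm

section Coalescing

open Classical

variable {N : Type u} {Θ : N → Type v} {X : Type w} {f : ((i : N) → Θ i) → X}
  {G : GradualMechanism f}

namespace Coalescible

variable {i : N} {I J : Set (History (Report Θ))} {a : Report Θ i}

theorem not_mem_of_follows (C : Coalescible G i I J a) {g h} (hg : g ∈ I)
    {p : ActionProfile (Report Θ)} (hgh : g ++ [p] <+: h) : h ∉ I := by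
  intro hh
  have := info_antichain C.succ.1 hg hh (mem_hist_of_mem_info C.succ.1 hh)
    ((List.prefix_append _ _).trans hgh) (List.prefix_refl _)
  subst this
  exact not_snoc_prefix_self hgh

theorem keep_of_mem (C : Coalescible G i I J a) {g} (hg : g ∈ I) : G.CoaKeep i I a g g :=
  ⟨rfl, mem_hist_of_mem_info C.succ.1 hg, fun ⟨_, hg', _, _, h⟩ =>
    C.not_mem_of_follows hg' h hg⟩

theorem coaMap_of_mem (C : Coalescible G i I J a) {g} (hg : g ∈ I) : G.CoaMap i I J a g g :=
  C.coaMap_iff.2 (Or.inr (Or.inl (C.keep_of_mem hg)))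

theorem eq_of_coaMap_mem (C : Coalescible G i I J a) {hs h} (hT : G.CoaMap i I J a hs h)
    (hh : h ∈ I) : hs = h := by
  rcases hT with hT | ⟨hT | hT, -⟩
  · obtain ⟨g, hg, p, q, k, l, b, hp, hq, hk, rfl, -⟩ := hT
    exact absurd hh (C.not_mem_of_follows hg (p := p) ⟨k ++ [q] ++ l, by simp⟩)
  · exact hT.1
  · obtain ⟨g, hg, p, k, b, hp, rfl, -⟩ := hT
    exact absurd hh (C.not_mem_of_follows hg (p := p) ⟨k, by simp⟩)

theorem reported_before (C : Coalescible G i I J a) {g k k₀} (hg : g ∈ I)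
    {p : ActionProfile (Report Θ)} {b : Report Θ i} (hp : p i = some a) (hk₀ : k₀ ∈ J)
    (hk : g ++ [p] ++ k <+: k₀) :
    decisions i (g ++ [Function.update p i (some b)] ++ k) = decisions i g ++ [b] := by
  have h1 := C.decisions_eq hg hp ⟨k, rfl⟩ hk₀ hk
  rw [decisions_append, decisions_append, decisions_singleton_some hp] at h1
  have h2 : decisions i k = [] := by simpa using h1
  rw [decisions_append, decisions_append, h2, List.append_nil,
    decisions_singleton_some (a := b) (by simp)]

/-- A node of `J` has a counterpart only if someone else moves there too. The report of `i` at the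
counterpart is then the action she would have chosen at `J`. -/
theorem coaMap_mem_succ (C : Coalescible G i I J a) {hs h} (hT : G.CoaMap i I J a hs h)
    (hh : h ∈ J) : ∃ g ∈ I, ∃ (p : ActionProfile (Report Θ)) (k : History (Report Θ))
      (b : Report Θ i), p i = some a ∧ h = g ++ [p] ++ k ∧ G.AvailableAtInfo i J b ∧
      hs = g ++ [Function.update p i (some b)] ++ k ∧ reported i hs = b.1 ∧
      ∃ j, j ≠ i ∧ G.Active j h := by
  rcases C.coaMap_iff.1 hT with hT | hT | ⟨hT, hj⟩
  · obtain ⟨g, hg, p, q, k, l, b, hp, hq, hk, rfl, -⟩ := hT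
    refine absurd ⟨_, hk, ⟨[q] ++ l, by simp⟩, ?_⟩ (C.not_setPrec hh (List.prefix_refl _))
    simp
  · obtain ⟨g, hg, p, hp, hgk⟩ := C.exists_pred hh
    exact absurd ⟨g, hg, p, hp, hgk⟩ hT.2.2
  · obtain ⟨g, hg, p, k, b, hp, rfl, -, -, hb, rfl⟩ := hT
    exact ⟨g, hg, p, k, b, hp, rfl, hb, rfl, reported_of_decisions
      (C.reported_before hg hp hh (List.prefix_refl _)), hj hh⟩

/-- This case of `coaMap_snoc` is needed twice: when the old history does not go beyond `J`, and
when it goes just beyond `J` by a solo move of `i`, which leaves no trace in the new history. -/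
theorem before_snoc (C : Coalescible G i I J a) {hs h} {r : ActionProfile (Report Θ)}
    (hT : G.CoaBefore i I J a (hs ++ [r]) h) : ∃ h₁, G.CoaMap i I J a hs h₁ ∧
      ((h₁ ∉ J ∧ h₁ ++ [r] <+: h ∧ (h₁ ∈ I → r i ≠ some a)) ∨
      (h₁ ∈ I ∧ ∃ p b, p i = some a ∧ h₁ ++ [p] <+: h ∧ G.AvailableAtInfo i J b ∧
        r = Function.update p i (some b))) := by
  obtain ⟨g, hg, p, k, b, hp, rfl, hh, hJ, hb, hs1⟩ := hT
  rcases List.eq_nil_or_concat k with rfl | ⟨k, r', rfl⟩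
  · obtain ⟨rfl, h2⟩ : hs = g ∧ r = Function.update p i (some b) := by simpa using hs1
    exact ⟨hs, C.coaMap_of_mem hg, Or.inr ⟨hg, p, b, hp, by simp, hb, h2⟩⟩
  · rw [List.concat_eq_append, ← List.append_assoc] at hs1
    obtain ⟨rfl, h2⟩ := List.append_inj' hs1 rfl
    obtain rfl : r = r' := by simpa using h2
    have h3 : g ++ [p] ++ k ∉ J := fun h3 => hJ ⟨_, h3, ⟨[r], by simp⟩, by simp⟩
    have h4 : g ++ [p] ++ k ∉ I := C.not_mem_of_follows hg (List.prefix_append _ _)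
    refine ⟨g ++ [p] ++ k, C.coaMap_iff.2 (Or.inr (Or.inr ⟨⟨g, hg, p, k, b, hp, rfl,
      G.mem_of_prefix hh ⟨[r], by simp⟩, ?_, hb, rfl⟩, fun h => absurd h h3⟩)),
      Or.inl ⟨h3, by simp, fun h => absurd h h4⟩⟩
    rintro ⟨k', hk', h5, h6⟩
    refine hJ ⟨k', hk', h5.trans ⟨[r], by simp⟩, ?_⟩
    rintro rfl
    have := h5.length_le
    simp at this

/-- How the map to old histories extends along a path. -/
theorem coaMap_snoc (C : Coalescible G i I J a) {hs h} {r : ActionProfile (Report Θ)}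
    (hT : G.CoaMap i I J a (hs ++ [r]) h) : ∃ h₁, G.CoaMap i I J a hs h₁ ∧
      ((h₁ ∉ J ∧ h₁ ++ [r] <+: h ∧ (h₁ ∈ I → r i ≠ some a)) ∨
      (h₁ ∈ I ∧ ∃ p b, p i = some a ∧ h₁ ++ [p] <+: h ∧ G.AvailableAtInfo i J b ∧
        r = Function.update p i (some b)) ∨
      (h₁ ∈ J ∧ ∃ q b, q i = some b ∧ h₁ ++ [q] <+: h ∧ reported i hs = b.1 ∧
        r = Function.update q i none)) := by
  rcases hT with hT | ⟨hT | hT, -⟩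
  · obtain ⟨g, hg, p, q, k, l, b, hp, hq, hk, rfl, hh, hs1⟩ := hT
    have hqm : g ++ [p] ++ k ++ [q] ∈ G.hist := G.mem_of_prefix hh ⟨l, rfl⟩
    have hb : G.AvailableAtInfo i J b := ⟨_, hk, q, hqm, hq⟩
    rcases List.eq_nil_or_concat l with rfl | ⟨l, r', rfl⟩
    · rw [List.append_nil] at hs1
      -- If others move at `J`, then `r` is what remains of `q`. Otherwise `q` has disappeared and
      -- `r` comes from a profile played before `J`.
      by_cases hd : ∃ j, j ≠ i ∧ (q j).isSome
      · unfold dropAgent at hs1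
        rw [if_pos hd] at hs1
        obtain ⟨rfl, h2⟩ := List.append_inj' hs1 rfl
        obtain ⟨j, hj, hjs⟩ := hd
        refine ⟨g ++ [p] ++ k, C.coaMap_iff.2 (Or.inr (Or.inr ⟨⟨g, hg, p, k, b, hp, rfl,
          mem_hist_of_mem_info C.succ.2.1 hk, C.not_setPrec hk (List.prefix_refl _), hb, rfl⟩,
          fun _ => ⟨j, hj, q, hqm, hjs⟩⟩)), Or.inr (Or.inr ⟨hk, q, b, hq, by simp, ?_, ?_⟩)⟩
        · exact reported_of_decisions (C.reported_before hg hp hk (List.prefix_refl _))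
        · simpa using h2
      · unfold dropAgent at hs1
        rw [if_neg hd, List.append_nil] at hs1
        obtain ⟨h₁, h1, h2⟩ := C.before_snoc (hs := hs) (r := r) ⟨g, hg, p, k, b, hp, rfl,
          mem_hist_of_mem_info C.succ.2.1 hk, C.not_setPrec hk (List.prefix_refl _), hb, hs1⟩
        have h3 : g ++ [p] ++ k <+: g ++ [p] ++ k ++ [q] ++ [] := ⟨[q], by simp⟩
        refine ⟨h₁, h1, ?_⟩
        rcases h2 with ⟨h4, h5, h6⟩ | ⟨h4, p', b', h5, h6, h7⟩
        · exact Or.inl ⟨h4, h5.trans h3, h6⟩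
        · exact Or.inr (Or.inl ⟨h4, p', b', h5, h6.trans h3, h7⟩)
    · rw [List.concat_eq_append, ← List.append_assoc] at hs1
      obtain ⟨rfl, h2⟩ := List.append_inj' hs1 rfl
      obtain rfl : r = r' := by simpa using h2
      refine ⟨g ++ [p] ++ k ++ [q] ++ l, Or.inl ⟨g, hg, p, q, k, l, b, hp, hq, hk, rfl,
        G.mem_of_prefix hh ⟨[r], by simp⟩, rfl⟩, Or.inl ⟨?_, by simp, fun h => absurd h ?_⟩⟩
      · intro h3
        refine absurd ⟨_, hk, ⟨[q] ++ l, by simp⟩, ?_⟩ (C.not_setPrec h3 (List.prefix_refl _))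
        simp
      · exact C.not_mem_of_follows hg (p := p) ⟨k ++ [q] ++ l, by simp⟩
  · obtain ⟨rfl, hh, hn⟩ := hT
    refine ⟨hs, C.coaMap_iff.2 (Or.inr (Or.inl ⟨rfl, G.prefix_mem _ _ hh, fun ⟨g, hg, p, hp, h1⟩ =>
      hn ⟨g, hg, p, hp, h1.trans (List.prefix_append _ _)⟩⟩)),
      Or.inl ⟨fun h1 => ?_, List.prefix_refl _, fun h1 h2 => hn ⟨hs, h1, r, h2, List.prefix_refl _⟩⟩⟩
    obtain ⟨g, hg, p, hp, h2⟩ := C.exists_pred h1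
    exact hn ⟨g, hg, p, hp, h2.trans (List.prefix_append _ _)⟩
  · obtain ⟨h₁, h1, h2⟩ := C.before_snoc hT
    refine ⟨h₁, h1, ?_⟩
    rcases h2 with h2 | h2
    · exact Or.inl h2
    · exact Or.inr (Or.inl h2)

theorem coaMap_lt (C : Coalescible G i I J a) {hs h} {r : ActionProfile (Report Θ)}
    (hT : G.CoaMap i I J a (hs ++ [r]) h) : ∃ h₁ q, G.CoaMap i I J a hs h₁ ∧ h₁ ++ [q] <+: h := by
  obtain ⟨h₁, h1, ⟨-, h2, -⟩ | ⟨-, p, b, -, h2, -⟩ | ⟨-, q, b, -, h2, -⟩⟩ := C.coaMap_snoc hT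
  · exact ⟨h₁, r, h1, h2⟩
  · exact ⟨h₁, p, h1, h2⟩
  · exact ⟨h₁, q, h1, h2⟩

theorem coaMap_prefix (C : Coalescible G i I J a) {hs hs' h} (hT : G.CoaMap i I J a hs h)
    (hp : hs' <+: hs) : ∃ h', G.CoaMap i I J a hs' h' ∧ h' <+: h := by
  obtain ⟨t, rfl⟩ := hp
  induction t using List.reverseRecOn generalizing h with
  | nil =>
    rw [List.append_nil] at hT
    exact ⟨h, hT, List.prefix_refl _⟩
  | append_singleton t r ih =>
    rw [← List.append_assoc] at hT
    obtain ⟨h₁, q, h1, h2⟩ := C.coaMap_lt hT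
    obtain ⟨h', h3, h4⟩ := ih h1
    exact ⟨h', h3, h4.trans ((List.prefix_append _ _).trans h2)⟩

theorem before_of_update (C : Coalescible G i I J a) {g} (hg : g ∈ I)
    {p : ActionProfile (Report Θ)} (hp : p i = some a) (hpm : g ++ [p] ∈ G.hist) {b : Report Θ i}
    (hb : G.AvailableAtInfo i J b) :
    G.CoaBefore i I J a (g ++ [Function.update p i (some b)]) (g ++ [p]) := by
  refine ⟨g, hg, p, [], b, hp, by simp, hpm, ?_, hb, by simp⟩
  rintro ⟨k, hk, h1, hne⟩
  have h2 := (List.prefix_concat_iff.1 h1).resolve_left hne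
  obtain ⟨g', hg', p', hp', h3⟩ := C.exists_pred hk
  exact C.not_mem_of_follows hg' (h3.trans h2) hg

theorem follows_snoc_prefix {g h : History (Report Θ)} {p r : ActionProfile (Report Θ)}
    (hg : g ++ [p] <+: h ++ [r]) : (g = h ∧ p = r) ∨ g ++ [p] <+: h := by
  rcases List.prefix_concat_iff.1 hg with h1 | h1
  · obtain ⟨rfl, h2⟩ := List.append_inj' h1 rfl
    exact Or.inl ⟨rfl, by simpa using h2⟩
  · exact Or.inr h1

/-- The successors of a new history in terms of those of the corresponding old one. -/
theorem snoc_mem_coaHist (C : Coalescible G i I J a) {hs h} (hT : G.CoaMap i I J a hs h)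
    {r : ActionProfile (Report Θ)} : hs ++ [r] ∈ G.coaHist i I J a ↔
      ((h ∉ J ∧ h ++ [r] ∈ G.hist ∧ (h ∈ I → r i ≠ some a)) ∨
      (h ∈ I ∧ ∃ p b, p i = some a ∧ h ++ [p] ∈ G.hist ∧ G.AvailableAtInfo i J b ∧
        r = Function.update p i (some b)) ∨
      (h ∈ J ∧ ∃ q b, q i = some b ∧ h ++ [q] ∈ G.hist ∧ reported i hs = b.1 ∧
        r = Function.update q i none)) := by
  constructor
  · intro hr
    obtain ⟨h', hT'⟩ := exists_coaMap hr
    have hm := coaMap_mem hT'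
    obtain ⟨h₁, h1, h2⟩ := C.coaMap_snoc hT'
    obtain rfl := C.coaMap_unique hT h1
    rcases h2 with ⟨h3, h4, h5⟩ | ⟨h3, p, b, h4, h5, h6⟩ | ⟨h3, q, b, h4, h5, h6⟩
    · exact Or.inl ⟨h3, G.mem_of_prefix hm h4, h5⟩
    · exact Or.inr (Or.inl ⟨h3, p, b, h4, G.mem_of_prefix hm h5, h6⟩)
    · exact Or.inr (Or.inr ⟨h3, q, b, h4, G.mem_of_prefix hm h5, h6⟩)
  · rintro (⟨h1, h2, h3⟩ | ⟨h1, p, b, h2, h3, h4, rfl⟩ | ⟨h1, q, b, h2, h3, h4, rfl⟩)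
    · rcases C.coaMap_iff.1 hT with hT | hT | ⟨hT, -⟩
      · obtain ⟨g, hg, p, q, k, l, b, hp, hq, hk, rfl, -, rfl⟩ := hT
        exact ⟨_, Or.inr (Or.inr ⟨g, hg, p, q, k, l ++ [r], b, hp, hq, hk, rfl, by simpa using h2,
          by simp⟩)⟩
      · obtain ⟨rfl, hh, hn⟩ := hT
        refine ⟨_, Or.inl ⟨rfl, h2, ?_⟩⟩
        rintro ⟨g, hg, p, hp, h4⟩
        rcases follows_snoc_prefix h4 with ⟨rfl, rfl⟩ | h5
        · exact h3 hg hp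
        · exact hn ⟨g, hg, p, hp, h5⟩
      · obtain ⟨g, hg, p, k, b, hp, rfl, hh, hJ, hb, rfl⟩ := hT
        refine ⟨_, Or.inr (Or.inl ⟨g, hg, p, k ++ [r], b, hp, rfl, by simpa using h2, ?_, hb,
          by simp⟩)⟩
        rintro ⟨k', hk', h4, hne⟩
        rw [← List.append_assoc] at h4 hne
        have h5 := (List.prefix_concat_iff.1 h4).resolve_left hne
        refine hJ ⟨k', hk', h5, ?_⟩
        rintro rfl
        exact h1 hk'
    · obtain rfl := C.eq_of_coaMap_mem hT h1
      exact ⟨_, Or.inr (Or.inl (C.before_of_update h1 h2 h3 h4))⟩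
    · obtain ⟨g, hg, p, k, b', hp, rfl, hb, rfl, hr, j, hj, hact⟩ := C.coaMap_mem_succ hT h1
      obtain rfl : b' = b := Subtype.ext (hr.symm.trans h4)
      refine ⟨g ++ [p] ++ k ++ [q], Or.inr (Or.inr ⟨g, hg, p, q, k, [], b', hp, h2, h1, by simp, h3,
        ?_⟩)⟩
      unfold dropAgent
      rw [if_pos ⟨j, hj, G.active_uniform _ _ j h3 hact⟩]
      simp

theorem coaMap_decisions (C : Coalescible G i I J a) {hs h} (hT : G.CoaMap i I J a hs h) {k : N}
    (hk : k ≠ i) : decisions k hs = decisions k h := by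
  rcases C.coaMap_iff.1 hT with hT | hT | ⟨hT, -⟩
  · obtain ⟨g, hg, p, q, k', l, b, hp, hq, -, rfl, -, rfl⟩ := hT
    simp only [decisions_append, decisions_dropAgent_of_ne hk, decisions_update_of_ne hk]
  · rw [hT.1]
  · obtain ⟨g, hg, p, k', b, hp, rfl, -, -, hb, rfl⟩ := hT
    simp only [decisions_append, decisions_update_of_ne hk]

/-- The decisions of `i` are untouched off the choice of `a`, have `a, b` contracted to `b` beyond
`J`, and have `a` replaced by the anticipated `b` in between. -/
theorem coaMap_decisions_self (C : Coalescible G i I J a) {hs h} (hT : G.CoaMap i I J a hs h) :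
    (decisions i hs = decisions i h ∧ ¬ ∃ g ∈ I, ∃ p : ActionProfile (Report Θ),
      p i = some a ∧ g ++ [p] <+: h) ∨
    (∃ g ∈ I, ∃ (p : ActionProfile (Report Θ)) (b : Report Θ i) (l : List (Report Θ i)),
      p i = some a ∧ g ++ [p] <+: h ∧ SetPrec J h ∧
      decisions i hs = decisions i g ++ [b] ++ l ∧ decisions i h = decisions i g ++ [a, b] ++ l) ∨
    (∃ g ∈ I, ∃ (p : ActionProfile (Report Θ)) (b : Report Θ i), p i = some a ∧ g ++ [p] <+: h ∧
      G.AvailableAtInfo i J b ∧ (∃ k ∈ J, h <+: k) ∧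
      decisions i hs = decisions i g ++ [b] ∧ decisions i h = decisions i g ++ [a]) := by
  rcases C.coaMap_iff.1 hT with hT | hT | ⟨hT, -⟩
  · right; left
    obtain ⟨g, hg, p, q, k, l, b, hp, hq, hk, rfl, -, rfl⟩ := hT
    refine ⟨g, hg, p, b, decisions i l, hp, ⟨k ++ [q] ++ l, by simp⟩, ⟨_, hk, ⟨[q] ++ l, by simp⟩,
      by simp⟩, ?_, ?_⟩
    · rw [decisions_append, decisions_append, C.reported_before hg hp hk (List.prefix_refl _),
        decisions_dropAgent_self, List.append_nil]
    · rw [decisions_append, decisions_append, decisions_singleton_some hq,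
        C.decisions_eq hg hp ⟨k, rfl⟩ hk (List.prefix_refl _)]
      simp
  · left
    obtain ⟨rfl, -, h⟩ := hT
    exact ⟨rfl, h⟩
  · right; right
    obtain ⟨g, hg, p, k, b, hp, rfl, hh, hJ, hb, rfl⟩ := hT
    obtain ⟨k₀, hk₀, h1⟩ := C.before_prefix hg hp ⟨k, rfl⟩ hh hJ
    exact ⟨g, hg, p, b, hp, ⟨k, rfl⟩, hb, ⟨k₀, hk₀, h1⟩, C.reported_before hg hp hk₀ h1,
      C.decisions_eq hg hp ⟨k, rfl⟩ hk₀ h1⟩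

/-- The inclusion can be strict only for `i` and only after `I` and up to `J`, where the new history
already contains her choice at `J`. -/
theorem coaMap_reported (C : Coalescible G i I J a) {hs h} (hT : G.CoaMap i I J a hs h) (k : N) :
    reported k hs ⊆ reported k h := by
  by_cases hk : k = i
  · subst hk
    rcases C.coaMap_decisions_self hT with ⟨h1, -⟩ |
      ⟨g, hg, p, b, l, hp, -, -, h1, h2⟩ | ⟨g, hg, p, b, hp, -, hb, -, h1, h2⟩
    · rw [reported_eq_of_decisions h1]
    · rcases List.eq_nil_or_concat l with rfl | ⟨l, c, rfl⟩
      · rw [List.append_nil] at h1 h2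
        rw [reported_of_decisions h1, reported_of_decisions (l := decisions k g ++ [a]) (a := b)
          (by simpa using h2)]
      · rw [List.concat_eq_append, ← List.append_assoc] at h1 h2
        rw [reported_of_decisions h1, reported_of_decisions h2]
    · rw [reported_of_decisions h1, reported_of_decisions h2]
      exact C.subset_of_available hb
  · rw [reported_eq_of_decisions (C.coaMap_decisions hT hk)]

theorem coaMap_reportedAll (C : Coalescible G i I J a) {hs h} (hT : G.CoaMap i I J a hs h)
    {θ : (k : N) → Θ k} (hθ : θ ∈ reportedAll hs) : θ ∈ reportedAll h :=
  fun k => C.coaMap_reported hT k (hθ k)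

theorem exists_active_of_mem_succ (C : Coalescible G i I J a) {h k} {q : ActionProfile (Report Θ)}
    (hh : h ∈ J) (hk : k ≠ i) {c : Report Θ k} (hq : h ++ [q] ∈ G.hist) (hc : q k = some c)
    {b : Report Θ i} (hb : G.AvailableAtInfo i J b) :
    ∃ q' : ActionProfile (Report Θ), h ++ [q'] ∈ G.hist ∧ q' k = some c ∧ q' i = some b := by
  obtain ⟨k', hk', hb⟩ := hb
  exact ⟨_, update_mem_hist hq (available_of_info C.succ.2.1 hk' hh hb), by simpa [hk] using hc,
    by simp⟩

/-- Coalescing alters profiles only in the component of `i` and only at `I` and `J`. For another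
agent at these nodes, that component can be adjusted independently of hers. -/
theorem availableAt_coaHist (C : Coalescible G i I J a) {hs h} (hT : G.CoaMap i I J a hs h) {k : N}
    (hk : k = i → h ∉ I ∧ h ∉ J) :
    availableAt (G.coaHist i I J a) k hs = G.available k h := by
  ext c
  constructor
  · rintro ⟨r, hr, hc⟩
    rcases (C.snoc_mem_coaHist hT).1 hr with ⟨-, h2, -⟩ | ⟨h1, p, b, h2, h3, h4, rfl⟩ |
      ⟨h1, q, b, h2, h3, h4, rfl⟩
    · exact ⟨r, h2, hc⟩
    · have hki : k ≠ i := fun h => (hk h).1 h1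
      exact ⟨p, h3, by simpa [hki] using hc⟩
    · have hki : k ≠ i := fun h => (hk h).2 h1
      exact ⟨q, h3, by simpa [hki] using hc⟩
  · rintro ⟨q, hq, hc⟩
    by_cases hJ : h ∈ J
    · have hki : k ≠ i := fun h => (hk h).2 hJ
      obtain ⟨g, hg, p, k', b, hp, rfl, hb, -, hr, -⟩ := C.coaMap_mem_succ hT hJ
      obtain ⟨q', hq', h1, h2⟩ := C.exists_active_of_mem_succ hJ hki hq hc hb
      exact ⟨_, (C.snoc_mem_coaHist hT).2 (Or.inr (Or.inr ⟨hJ, q', b, h2, hq', hr, rfl⟩)),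
        by simpa [hki] using h1⟩
    · by_cases hI : h ∈ I ∧ q i = some a
      · have hki : k ≠ i := fun h => (hk h).1 hI.1
        obtain ⟨t, ht⟩ := a.2
        obtain ⟨b, hb, -⟩ := C.exists_mem_available ht
        exact ⟨_, (C.snoc_mem_coaHist hT).2 (Or.inr (Or.inl ⟨hI.1, q, b, hI.2, hq, hb, rfl⟩)),
          by simpa [hki] using hc⟩
      · exact ⟨q, (C.snoc_mem_coaHist hT).2 (Or.inl ⟨hJ, hq, fun h1 h2 => hI ⟨h1, h2⟩⟩), hc⟩

theorem availableAt_coaHist_of_mem (C : Coalescible G i I J a) {g} (hg : g ∈ I) {c : Report Θ i} :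
    c ∈ availableAt (G.coaHist i I J a) i g ↔
      (c ∈ G.available i g ∧ c ≠ a) ∨ G.AvailableAtInfo i J c := by
  have hT := C.coaMap_of_mem hg
  constructor
  · rintro ⟨r, hr, hc⟩
    rcases (C.snoc_mem_coaHist hT).1 hr with ⟨-, h2, h3⟩ | ⟨h1, p, b, h2, h3, h4, rfl⟩ | ⟨h1, -⟩
    · refine Or.inl ⟨⟨r, h2, hc⟩, ?_⟩
      rintro rfl
      exact h3 hg hc
    · obtain rfl : b = c := by simpa using hc
      exact Or.inr h4
    · exact absurd h1 (C.not_mem_both hg)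
  · rintro (⟨⟨q, hq, hc⟩, hne⟩ | hc)
    · refine ⟨q, (C.snoc_mem_coaHist hT).2 (Or.inl ⟨C.not_mem_both hg, hq, fun _ h => ?_⟩), hc⟩
      rw [hc] at h
      exact hne (by simpa using h)
    · obtain ⟨p, hp, hpa⟩ := C.mem_available hg
      exact ⟨_, (C.snoc_mem_coaHist hT).2 (Or.inr (Or.inl ⟨hg, p, c, hpa, hp, hc, rfl⟩)), by simp⟩

theorem activeAt_coaHist (C : Coalescible G i I J a) {hs h} (hT : G.CoaMap i I J a hs h) {k : N} :
    ActiveAt (G.coaHist i I J a) k hs ↔ G.Active k h ∧ (k = i → h ∉ J) := by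
  constructor
  · rintro ⟨r, hr, hc⟩
    rcases (C.snoc_mem_coaHist hT).1 hr with ⟨h1, h2, -⟩ | ⟨h1, p, b, h2, h3, h4, rfl⟩ |
      ⟨h1, q, b, h2, h3, h4, rfl⟩
    · exact ⟨⟨r, h2, hc⟩, fun _ => h1⟩
    · refine ⟨?_, fun _ => C.not_mem_both h1⟩
      by_cases hki : k = i
      · subst hki
        exact activeAt_of_mem h3 h2
      · exact ⟨p, h3, by simpa [hki] using hc⟩
    · have hki : k ≠ i := by
        rintro rfl
        simp at hc
      exact ⟨⟨q, h3, by simpa [hki] using hc⟩, fun h => absurd h hki⟩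
  · rintro ⟨h1, h2⟩
    by_cases hki : k = i ∧ h ∈ I
    · obtain ⟨rfl, hI⟩ := hki
      obtain rfl := C.eq_of_coaMap_mem hT hI
      obtain ⟨t, ht⟩ := a.2
      obtain ⟨b, hb, -⟩ := C.exists_mem_available ht
      exact activeAt_of_available ((C.availableAt_coaHist_of_mem hI).2 (Or.inr hb))
    · obtain ⟨c, hc⟩ := h1.exists_available
      refine activeAt_of_available (a := c) ?_
      rw [C.availableAt_coaHist hT fun h => ⟨fun h' => hki ⟨h, h'⟩, h2 h⟩]
      exact hc

/-- Every old history, except those at which only agent `i` moves and belong to `J`, comes from a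
new one with the same truthful reports. -/
theorem exists_coaMap_of_mem (C : Coalescible G i I J a) {h} (hh : h ∈ G.hist)
    {θ : (k : N) → Θ k} (hθ : θ ∈ reportedAll h) (hJ : h ∈ J → ∃ j, j ≠ i ∧ G.Active j h) :
    ∃ hs, G.CoaMap i I J a hs h ∧ θ ∈ reportedAll hs := by
  by_cases hf : ∃ g ∈ I, ∃ p : ActionProfile (Report Θ), p i = some a ∧ g ++ [p] <+: h
  · obtain ⟨g, hg, p, hp, k, rfl⟩ := hf
    by_cases hS : SetPrec J (g ++ [p] ++ k)
    · obtain ⟨k', hk', h1, hne⟩ := hS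
      obtain ⟨q, hq⟩ := exists_snoc_prefix h1 hne
      obtain ⟨g', hg', p', hp', m, rfl⟩ := C.exists_pred hk'
      obtain ⟨l, hl⟩ := hq
      have hact := G.info_active i J C.succ.2.1 _ hk'
      obtain ⟨b, hb, -⟩ := hact.exists_eq_some hh ⟨l, hl⟩
      have hT : G.CoaMap i I J a
          (g' ++ [Function.update p' i (some b)] ++ m ++ dropAgent i q ++ l) (g ++ [p] ++ k) :=
        Or.inl ⟨g', hg', p', q, m, l, b, hp', hb, hk', hl.symm, hh, rfl⟩
      refine ⟨_, hT, fun j => ?_⟩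
      by_cases hj : j = i
      · subst hj
        have h2 := C.reported_before (b := b) hg' hp' hk' (List.prefix_refl _)
        have h3 : decisions j (g ++ [p] ++ k) = decisions j g' ++ [a] ++ [b] ++ decisions j l := by
          rw [← hl, decisions_append, decisions_append, decisions_singleton_some hb,
            C.decisions_eq hg' hp' ⟨m, rfl⟩ hk' (List.prefix_refl _)]
        have h4 : decisions j (g' ++ [Function.update p' j (some b)] ++ m ++ dropAgent j q ++ l) =
            decisions j g' ++ [b] ++ decisions j l := by
          rw [decisions_append, decisions_append, h2, decisions_dropAgent_self, List.append_nil]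
        have h5 := hθ j
        rcases List.eq_nil_or_concat (decisions j l) with h6 | ⟨d, c, h6⟩
        · rw [h6, List.append_nil] at h3 h4
          rw [reported_of_decisions h3] at h5
          rwa [reported_of_decisions h4]
        · rw [h6, List.concat_eq_append, ← List.append_assoc] at h3 h4
          rw [reported_of_decisions h3] at h5
          rwa [reported_of_decisions h4]
      · rw [reported_eq_of_decisions (C.coaMap_decisions hT hj)]
        exact hθ j
    -- The replacement of `a` must be the action at `J` that contains `θ i`, so that the new history
    -- stays truthful.
    · obtain ⟨b, hb, hθb⟩ := C.exists_mem_available (mem_of_snoc_prefix hh ⟨k, rfl⟩ hp hθ)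
      have hT : G.CoaMap i I J a (g ++ [Function.update p i (some b)] ++ k) (g ++ [p] ++ k) :=
        C.coaMap_iff.2 (Or.inr (Or.inr ⟨⟨g, hg, p, k, b, hp, rfl, hh, hS, hb, rfl⟩, hJ⟩))
      refine ⟨_, hT, fun j => ?_⟩
      by_cases hj : j = i
      · subst hj
        obtain ⟨k₀, hk₀, h1⟩ := C.before_prefix hg hp ⟨k, rfl⟩ hh hS
        rwa [reported_of_decisions (C.reported_before hg hp hk₀ h1)]
      · rw [reported_eq_of_decisions (C.coaMap_decisions hT hj)]
        exact hθ j
  · exact ⟨h, C.coaMap_iff.2 (Or.inr (Or.inl ⟨rfl, hh, hf⟩)), hθ⟩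

end Coalescible

end Coalescing

end GradualMechanism

/-! ### Coalescing and incentives -/

namespace GradualMechanism

open GameForm

variable {N : Type u} {Θ : N → Type v} {X : Type w} {f : ((i : N) → Θ i) → X}
  {G Gs : GradualMechanism f} {i : N} {I J : Set (History (Report Θ))} {a : Report Θ i}

theorem IsCOA.coalescible (H : IsCOA G Gs i I J a) : Coalescible G i I J a :=
  ⟨H.available, H.succ, H.no_news⟩

theorem IsCOA.mem_info (H : IsCOA G Gs i I J a) {k : N} {L} (hL : L ∈ G.info k) {h hs}
    (hh : h ∈ L) (hT : G.CoaMap i I J a hs h) (hJ : k = i → h ∉ J) :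
    {hs | Gs.Active k hs ∧ ∃ h ∈ L, G.CoaMap i I J a hs h} ∈ Gs.info k ∧ Gs.Active k hs := by
  have hact : Gs.Active k hs := by
    unfold GameForm.Active
    rw [show Gs.hist = G.coaHist i I J a from H.hist_eq, H.coalescible.activeAt_coaHist hT]
    exact ⟨G.info_active k L hL h hh, hJ⟩
  refine ⟨?_, hact⟩
  rw [H.info_eq k]
  exact ⟨⟨hs, hact, h, hh, hT⟩, L, hL, rfl⟩

/-- At `I` the action `a` is replaced by its refinement into the actions of `J`. Agreement on the
refined choice is agreement at `I` and at `J`, because the truthful paths that choose `a` at `I` all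
cross `J`. Elsewhere the choices and the truthful crossings correspond under `CoaMap`. -/
theorem IsCOA.compatible_iff (H : IsCOA G Gs i I J a) {k : N} {θ θ' : (j : N) → Θ j} :
    Gs.Compatible k θ θ' ↔ G.Compatible k θ θ' := by
  have C := H.coalescible
  have hH : Gs.hist = G.coaHist i I J a := H.hist_eq
  constructor
  · intro hc
    have hcI : ∀ g ∈ I, ∀ g' ∈ I, k = i → θ ∈ reportedAll g → θ' ∈ reportedAll g' →
        ∀ c : Report Θ i, ((c ∈ G.available i g ∧ c ≠ a) ∨ G.AvailableAtInfo i J c) → θ i ∈ c.1 →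
        θ' i ∈ c.1 := by
      rintro g hg g' hg' rfl hθ hθ' c hc' hθc
      have h1 := H.mem_info C.succ.1 hg (C.coaMap_of_mem hg) fun _ => C.not_mem_both hg
      have h2 := H.mem_info C.succ.1 hg' (C.coaMap_of_mem hg') fun _ => C.not_mem_both hg'
      refine hc _ h1.1 g ⟨h1.2, g, hg, C.coaMap_of_mem hg⟩ g' ⟨h2.2, g', hg', C.coaMap_of_mem hg'⟩
        hθ hθ' c ?_ hθc
      unfold GameForm.available
      rw [hH, C.availableAt_coaHist_of_mem hg]
      exact hc'
    intro L hL h hh h' hh' hθ hθ' c hcm hθc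
    by_cases hJ : k = i ∧ h ∈ J
    · obtain ⟨rfl, hJ⟩ := hJ
      obtain rfl := info_eq_of_mem hL C.succ.2.1 hh hJ
      obtain ⟨g, hg, p, -, hgh⟩ := C.exists_pred hh
      obtain ⟨g', hg', p', -, hgh'⟩ := C.exists_pred hh'
      exact hcI g hg g' hg' rfl
        (reportedAll_anti (mem_hist_of_mem_info hL hh) ((List.prefix_append _ _).trans hgh) hθ)
        (reportedAll_anti (mem_hist_of_mem_info hL hh') ((List.prefix_append _ _).trans hgh') hθ')
        c (Or.inr ⟨h, hh, hcm⟩) hθc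
    by_cases hI : k = i ∧ h ∈ I
    · obtain ⟨rfl, hI⟩ := hI
      obtain rfl := info_eq_of_mem hL C.succ.1 hh hI
      by_cases hca : c = a
      · subst hca
        -- The old action `a` is no longer available, but agreement on the piece of `a` that
        -- contains `θ i` implies agreement on `a`.
        obtain ⟨b, hb, hθb⟩ := C.exists_mem_available hθc
        exact C.subset_of_available hb (hcI h hh h' hh' rfl hθ hθ' b (Or.inr hb) hθb)
      · exact hcI h hh h' hh' rfl hθ hθ' c (Or.inl ⟨hcm, hca⟩) hθc
    have hJL : k = i → ∀ l ∈ L, l ∉ J := by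
      rintro rfl l hl hlJ
      obtain rfl := info_eq_of_mem hL C.succ.2.1 hl hlJ
      exact hJ ⟨rfl, hh⟩
    have hlift : ∀ l ∈ L, ∀ t : (j : N) → Θ j, t ∈ reportedAll l →
        ∃ hs, G.CoaMap i I J a hs l ∧ t ∈ reportedAll hs := by
      intro l hl t ht
      refine C.exists_coaMap_of_mem (mem_hist_of_mem_info hL hl) ht fun hlJ =>
        ⟨k, fun hk => hJL hk l hl hlJ, G.info_active k L hL l hl⟩
    obtain ⟨hs, hT, hθs⟩ := hlift h hh θ hθ
    obtain ⟨hs', hT', hθs'⟩ := hlift h' hh' θ' hθ'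
    have h1 := H.mem_info hL hh hT fun hk => hJL hk h hh
    have h2 := H.mem_info hL hh' hT' fun hk => hJL hk h' hh'
    refine hc _ h1.1 hs ⟨h1.2, h, hh, hT⟩ hs' ⟨h2.2, h', hh', hT'⟩ hθs hθs' c ?_ hθc
    unfold GameForm.available
    rw [hH, C.availableAt_coaHist hT fun hk => ⟨fun h' => hI ⟨hk, h'⟩, fun h' => hJ ⟨hk, h'⟩⟩]
    exact hcm
  · intro hc K hK hs hh hs' hh' hθ hθ' c hcm hθc
    rw [H.info_eq k] at hK
    obtain ⟨-, L, hL, rfl⟩ := hK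
    obtain ⟨hact, h, hh, hT⟩ := hh
    obtain ⟨-, h', hh', hT'⟩ := hh'
    have hθh := C.coaMap_reportedAll hT hθ
    have hθh' := C.coaMap_reportedAll hT' hθ'
    unfold GameForm.available at hcm
    unfold GameForm.Active at hact
    rw [hH] at hcm hact
    rw [C.activeAt_coaHist hT] at hact
    by_cases hI : k = i ∧ h ∈ I
    · obtain ⟨rfl, hI⟩ := hI
      obtain rfl := info_eq_of_mem hL C.succ.1 hh hI
      obtain rfl := C.eq_of_coaMap_mem hT hI
      rw [C.availableAt_coaHist_of_mem hI] at hcm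
      rcases hcm with ⟨hcm, -⟩ | hcm
      · exact hc L hL hs hh h' hh' hθ hθh' c hcm hθc
      · have hθa := C.subset_of_available hcm hθc
        have hθa' := hc L hL hs hh h' hh' hθ hθh' a (C.mem_available hh) hθa
        -- Both paths choose `a` at `I`, hence reach `J`, where compatibility can be applied to the
        -- refined action.
        have key : ∀ g ∈ L, ∀ t : (j : N) → Θ j, t ∈ reportedAll g → t k ∈ a.1 →
            ∃ l ∈ J, t ∈ reportedAll l := by
          intro g hg t ht hta
          obtain ⟨q, hq, -⟩ := C.mem_available hg
          obtain ⟨p, hp, htp⟩ := exists_snoc hq ht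
          obtain ⟨b, hb, hb'⟩ := (G.info_active k L hL g hg).exists_eq_some hp
            (List.prefix_refl _)
          obtain rfl := available_unique hb' (C.mem_available hg)
            (mem_of_snoc_prefix hp (List.prefix_refl _) hb htp) hta
          obtain ⟨l, hl, -, htl, -⟩ := C.exists_mem hg hb (List.prefix_refl _) hp htp
          exact ⟨l, hl, htl⟩
        obtain ⟨l, hl, hθl⟩ := key hs hh θ hθ hθa
        obtain ⟨l', hl', hθl'⟩ := key h' hh' θ' hθh' hθa'
        obtain ⟨l₀, hl₀, hcl⟩ := hcm
        exact hc J C.succ.2.1 l hl l' hl' hθl hθl' c (available_of_info C.succ.2.1 hl₀ hl hcl) hθc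
    · rw [C.availableAt_coaHist hT fun hk => ⟨fun h' => hI ⟨hk, h'⟩, hact.2 hk⟩] at hcm
      exact hc L hL h hh h' hh' hθh hθh' c hcm hθc

theorem IsCOA.incentiveCompatible_iff (H : IsCOA G Gs i I J a)
    (R : (i : N) → Θ i → X → X → Prop) : G.IncentiveCompatible R ↔ Gs.IncentiveCompatible R := by
  rw [GradualMechanism.incentiveCompatible_iff, GradualMechanism.incentiveCompatible_iff]
  simp only [H.compatible_iff]

/-- Incentive compatibility along a chain that ends in the direct mechanism. -/
theorem Chain.incentiveCompatible_iff {R : (i : N) → Θ i → X → X → Prop} (hf : StrategyProof R f)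
    {G D : GradualMechanism f} (c : Chain G D) (hD : D.IsDirect) :
    G.IncentiveCompatible R ↔ c.AllIP R := by
  induction c with
  | nil G => exact ⟨fun _ => trivial, fun _ => hD.incentiveCompatible hf⟩
  | spl i I a a₁ a₂ step rest ih => exact (step.incentiveCompatible_iff R).trans (ih hD)
  | coa i I J a step rest ih => exact (step.incentiveCompatible_iff R).trans (ih hD)
  | invILL i I I₁ I₂ step rest ih =>
    exact (step.incentiveCompatible_iff R).trans (and_congr_right fun _ => ih hD)

end GradualMechanism

/-! ### Coalescing: construction of the mechanism -/

namespace GradualMechanism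

open GameForm

section Coalescing

open Classical

variable {N : Type u} {Θ : N → Type v} {X : Type w} {f : ((i : N) → Θ i) → X}
  {G : GradualMechanism f}

namespace Coalescible

variable {i : N} {I J : Set (History (Report Θ))} {a : Report Θ i}

theorem coaMap_nil (C : Coalescible G i I J a) : G.CoaMap i I J a [] [] :=
  C.coaMap_iff.2 (Or.inr (Or.inl ⟨rfl, G.nil_mem, by rintro ⟨g, -, p, -, h⟩; simp at h⟩))

theorem nil_not_mem (C : Coalescible G i I J a) : [] ∉ J := by
  intro h
  obtain ⟨g, -, p, -, hp⟩ := C.exists_pred h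
  simp at hp

/-- Each new step corresponds to at least one old step; this bounds the coalesced tree. -/
theorem length_le_of_coaMap (C : Coalescible G i I J a) {hs h} (hT : G.CoaMap i I J a hs h) :
    hs.length ≤ h.length := by
  induction hs using List.reverseRecOn generalizing h with
  | nil => simp
  | append_singleton hs r ih =>
    obtain ⟨h₁, q, h1, h2⟩ := C.coaMap_lt hT
    have h3 := ih h1
    have h4 := h2.length_le
    simp only [List.length_append, List.length_singleton] at h4 ⊢
    omega

theorem prefix_append_cases {α : Type*} {g x y : List α} (h : g <+: x ++ y) :
    g <+: x ∨ ∃ y', y' <+: y ∧ g = x ++ y' := by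
  rcases List.prefix_or_prefix_of_prefix h (List.prefix_append x y) with h1 | ⟨y', rfl⟩
  · exact Or.inl h1
  · exact Or.inr ⟨y', (List.prefix_append_right_inj _).1 h, rfl⟩

theorem coaMap_of_prefix_mem (C : Coalescible G i I J a) {g g'} (hg : g ∈ I) (h : g' <+: g) :
    G.CoaMap i I J a g' g' :=
  C.coaMap_iff.2 (Or.inr (Or.inl ⟨rfl, G.mem_of_prefix (mem_hist_of_mem_info C.succ.1 hg) h,
    fun ⟨_, hg₁, _, _, h1⟩ => C.not_mem_of_follows hg₁ (h1.trans h) hg⟩))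

theorem coaMap_before (C : Coalescible G i I J a) {g k} {p : ActionProfile (Report Θ)}
    {b : Report Θ i} (hg : g ∈ I) (hp : p i = some a) (hb : G.AvailableAtInfo i J b)
    (hh : g ++ [p] ++ k ∈ G.hist) (hJ : ¬ SetPrec J (g ++ [p] ++ k))
    (ha : g ++ [p] ++ k ∈ J → ∃ j, j ≠ i ∧ G.Active j (g ++ [p] ++ k)) :
    G.CoaMap i I J a (g ++ [Function.update p i (some b)] ++ k) (g ++ [p] ++ k) :=
  C.coaMap_iff.2 (Or.inr (Or.inr ⟨⟨g, hg, p, k, b, hp, rfl, hh, hJ, hb, rfl⟩, ha⟩))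

/-- Perfect recall of the new mechanism needs the node supplied by recall in `G` to reappear on the
given new path. Only the nodes of `J` at which `i` moves alone vanish. -/
theorem coaMap_lift (C : Coalescible G i I J a) {hs h g'} (hT : G.CoaMap i I J a hs h)
    (hgh : g' <+: h) (hJ : g' ∈ J → ∃ j, j ≠ i ∧ G.Active j g') :
    ∃ gs, gs <+: hs ∧ G.CoaMap i I J a gs g' := by
  have hm := coaMap_mem hT
  rcases C.coaMap_iff.1 hT with hT | hT | ⟨hT, -⟩
  · obtain ⟨g, hg, p, q, k, l, b, hp, hq, hk, rfl, -, rfl⟩ := hT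
    have hqm : g ++ [p] ++ k ++ [q] ∈ G.hist := G.mem_of_prefix hm ⟨l, rfl⟩
    have hb : G.AvailableAtInfo i J b := ⟨_, hk, q, hqm, hq⟩
    rcases prefix_append_cases hgh with h1 | ⟨l', hl', rfl⟩
    · rcases List.prefix_concat_iff.1 h1 with rfl | h1
      · refine ⟨g ++ [Function.update p i (some b)] ++ k ++ dropAgent i q ++ [], ?_,
          Or.inl ⟨g, hg, p, q, k, [], b, hp, hq, hk, by simp, hqm, rfl⟩⟩
        simp
      · rcases prefix_append_cases h1 with h2 | ⟨k', hk', rfl⟩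
        · rcases List.prefix_concat_iff.1 h2 with rfl | h2
          · refine ⟨g ++ [Function.update p i (some b)] ++ [], by simp, ?_⟩
            have := C.coaMap_before (k := []) hg hp hb
            simp only [List.append_nil] at this ⊢
            exact this (G.mem_of_prefix hm hgh) (C.not_setPrec hk h1) hJ
          · exact ⟨g', h2.trans (by simp), C.coaMap_of_prefix_mem hg h2⟩
        · obtain ⟨t, rfl⟩ := hk'
          refine ⟨g ++ [Function.update p i (some b)] ++ k', by simp, ?_⟩
          exact C.coaMap_before hg hp hb (G.mem_of_prefix hm hgh) (C.not_setPrec hk h1) hJ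
    · obtain ⟨t, rfl⟩ := hl'
      refine ⟨g ++ [Function.update p i (some b)] ++ k ++ dropAgent i q ++ l', by simp,
        Or.inl ⟨g, hg, p, q, k, l', b, hp, hq, hk, rfl, G.mem_of_prefix hm hgh, rfl⟩⟩
  · obtain ⟨rfl, hh, hn⟩ := hT
    exact ⟨g', hgh, C.coaMap_iff.2 (Or.inr (Or.inl ⟨rfl, G.mem_of_prefix hm hgh,
      fun ⟨g, hg, p, hp, h1⟩ => hn ⟨g, hg, p, hp, h1.trans hgh⟩⟩))⟩
  · obtain ⟨g, hg, p, k, b, hp, rfl, -, hS, hb, rfl⟩ := hT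
    have hS' : ¬ SetPrec J g' := by
      rintro ⟨k', hk', h1, hne⟩
      refine hS ⟨k', hk', h1.trans hgh, ?_⟩
      rintro rfl
      exact hne (h1.eq_of_length_le hgh.length_le)
    rcases prefix_append_cases hgh with h2 | ⟨k', hk', rfl⟩
    · rcases List.prefix_concat_iff.1 h2 with rfl | h2
      · refine ⟨g ++ [Function.update p i (some b)] ++ [], by simp, ?_⟩
        have := C.coaMap_before (k := []) hg hp hb
        simp only [List.append_nil] at this ⊢
        exact this (G.mem_of_prefix hm hgh) hS' hJ
      · exact ⟨g', h2.trans (by simp), C.coaMap_of_prefix_mem hg h2⟩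
    · obtain ⟨t, rfl⟩ := hk'
      exact ⟨g ++ [Function.update p i (some b)] ++ k', by simp,
        C.coaMap_before hg hp hb (G.mem_of_prefix hm hgh) hS' hJ⟩

/-- At a new history where `i` is active, her decisions are those at the old history, with the
choice of `a` at `I` left out. -/
theorem coaMap_decisions_active (C : Coalescible G i I J a) {hs h} (hT : G.CoaMap i I J a hs h)
    (hact : ActiveAt (G.coaHist i I J a) i hs) :
    (decisions i hs = decisions i h ∧ ¬ ∃ g ∈ I, ∃ p : ActionProfile (Report Θ),
      p i = some a ∧ g ++ [p] <+: h) ∨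
    (∃ g ∈ I, ∃ (p : ActionProfile (Report Θ)) (b : Report Θ i) (l : List (Report Θ i)),
      p i = some a ∧ g ++ [p] <+: h ∧
      decisions i hs = decisions i g ++ [b] ++ l ∧ decisions i h = decisions i g ++ [a, b] ++ l) := by
  rcases C.coaMap_decisions_self hT with h1 | ⟨g, hg, p, b, l, hp, hgh, -, h1⟩ |
    ⟨g, hg, p, b, hp, hgh, -, ⟨k, hk, hhk⟩, -⟩
  · exact Or.inl h1
  · exact Or.inr ⟨g, hg, p, b, l, hp, hgh, h1⟩
  · rw [C.activeAt_coaHist hT] at hact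
    refine absurd hact.1 (C.not_active_between hg hgh hk hhk ?_)
    rintro rfl
    exact hact.2 rfl hk

/-- The anticipated report of `i` differs from the old one only up to `J`, and there she is inactive
in the coalesced mechanism. -/
theorem coaMap_reported_active (C : Coalescible G i I J a) {hs h} (hT : G.CoaMap i I J a hs h)
    {k : N} (hact : ActiveAt (G.coaHist i I J a) k hs) : reported k hs = reported k h := by
  by_cases hk : k = i
  · subst hk
    rcases C.coaMap_decisions_active hT hact with ⟨h1, -⟩ | ⟨g, hg, p, b, l, hp, -, h1, h2⟩
    · rw [reported_eq_of_decisions h1]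
    · rcases List.eq_nil_or_concat l with rfl | ⟨l, c, rfl⟩
      · rw [List.append_nil] at h1 h2
        rw [reported_of_decisions h1, reported_of_decisions (l := decisions k g ++ [a]) (a := b)
          (by simpa using h2)]
      · rw [List.concat_eq_append, ← List.append_assoc] at h1 h2
        rw [reported_of_decisions h1, reported_of_decisions h2]
  · rw [reported_eq_of_decisions (C.coaMap_decisions hT hk)]

theorem follows_of_info (C : Coalescible G i I J a) {L} (hL : L ∈ G.info i) {h h'} (hh : h ∈ L)
    (hh' : h' ∈ L) (hf : ∃ g ∈ I, ∃ p : ActionProfile (Report Θ), p i = some a ∧ g ++ [p] <+: h) :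
    ∃ g ∈ I, ∃ p : ActionProfile (Report Θ), p i = some a ∧ g ++ [p] <+: h' := by
  obtain ⟨g, hg, p, hp, hgh⟩ := hf
  obtain ⟨g₂, hg₂, p₂, h1, h2⟩ := recall_snoc hL C.succ.1 hg hh hh' hgh
  exact ⟨g₂, hg₂, p₂, h2.trans hp, h1⟩

/-- By perfect recall, either all or none of the nodes of `L` follow the choice of `a` at `I`, so
the same entry is left out on both sides. -/
theorem coaMap_recall_decisions (C : Coalescible G i I J a) {L} {k : N} (hL : L ∈ G.info k)
    {hs hs' h h'} (hh : h ∈ L) (hh' : h' ∈ L) (hT : G.CoaMap i I J a hs h)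
    (hT' : G.CoaMap i I J a hs' h') (hact : ActiveAt (G.coaHist i I J a) k hs)
    (hact' : ActiveAt (G.coaHist i I J a) k hs') : decisions k hs = decisions k hs' := by
  have hd := G.recall_decisions k L hL h hh h' hh'
  by_cases hk : k = i
  · subst hk
    rcases C.coaMap_decisions_active hT hact with ⟨h1, h2⟩ | ⟨g, hg, p, b, l, hp, hgh, h1, h2⟩ <;>
    rcases C.coaMap_decisions_active hT' hact' with ⟨h3, h4⟩ |
      ⟨g', hg', p', b', l', hp', hgh', h3, h4⟩
    · rw [h1, h3, hd]
    · exact absurd (C.follows_of_info hL hh' hh ⟨g', hg', p', hp', hgh'⟩) h2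
    · exact absurd (C.follows_of_info hL hh hh' ⟨g, hg, p, hp, hgh⟩) h4
    · rw [h2, h4, G.recall_decisions k I C.succ.1 g hg g' hg'] at hd
      rw [h1, h3, G.recall_decisions k I C.succ.1 g hg g' hg']
      simpa using hd
  · rw [C.coaMap_decisions hT hk, C.coaMap_decisions hT' hk, hd]

theorem availableAt_coaHist_info (C : Coalescible G i I J a) {L} {k : N} (hL : L ∈ G.info k)
    {hs hs' h h'} (hh : h ∈ L) (hh' : h' ∈ L) (hT : G.CoaMap i I J a hs h)
    (hT' : G.CoaMap i I J a hs' h') (hact : ActiveAt (G.coaHist i I J a) k hs)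
    (hact' : ActiveAt (G.coaHist i I J a) k hs') :
    availableAt (G.coaHist i I J a) k hs = availableAt (G.coaHist i I J a) k hs' := by
  rw [C.activeAt_coaHist hT] at hact
  rw [C.activeAt_coaHist hT'] at hact'
  by_cases hI : k = i ∧ h ∈ I
  · obtain ⟨rfl, hI⟩ := hI
    obtain rfl := info_eq_of_mem hL C.succ.1 hh hI
    obtain rfl := C.eq_of_coaMap_mem hT hI
    obtain rfl := C.eq_of_coaMap_mem hT' hh'
    ext c
    rw [C.availableAt_coaHist_of_mem hh, C.availableAt_coaHist_of_mem hh']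
    exact or_congr (and_congr_left' ⟨available_of_info hL hh hh', available_of_info hL hh' hh⟩)
      Iff.rfl
  · have hI' : ¬ (k = i ∧ h' ∈ I) := by
      rintro ⟨rfl, hI'⟩
      obtain rfl := info_eq_of_mem hL C.succ.1 hh' hI'
      exact hI ⟨rfl, hh⟩
    rw [C.availableAt_coaHist hT fun hk => ⟨fun h1 => hI ⟨hk, h1⟩, hact.2 hk⟩,
      C.availableAt_coaHist hT' fun hk => ⟨fun h1 => hI' ⟨hk, h1⟩, hact'.2 hk⟩]
    exact G.info_available k L hL h hh h' hh'

/-- The product property is inherited from `G` once the component of `i` is restored: at `J` it is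
the action recorded at `I`, and at `I` an action of `J` is turned back into `a`. -/
theorem coaHist_product (C : Coalescible G i I J a) {hs} {q : ActionProfile (Report Θ)}
    (hq : hs ++ [q] ∈ G.coaHist i I J a) {p : ActionProfile (Report Θ)}
    (h1 : ∀ k, ActiveAt (G.coaHist i I J a) k hs →
      ∃ c ∈ availableAt (G.coaHist i I J a) k hs, p k = some c)
    (h2 : ∀ k, ¬ ActiveAt (G.coaHist i I J a) k hs → p k = none) :
    hs ++ [p] ∈ G.coaHist i I J a := by
  obtain ⟨h', hT'⟩ := exists_coaMap hq
  obtain ⟨h, r, hT, hr⟩ := C.coaMap_lt hT'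
  have hrm : h ++ [r] ∈ G.hist := G.mem_of_prefix (coaMap_mem hT') hr
  rw [C.snoc_mem_coaHist hT]
  have hother : ∀ k, k ≠ i → (G.Active k h → ∃ c ∈ G.available k h, p k = some c) ∧
      (¬ G.Active k h → p k = none) := by
    intro k hk
    have h3 := h1 k
    have h4 := h2 k
    rw [C.activeAt_coaHist hT] at h3 h4
    rw [C.availableAt_coaHist hT fun h => absurd h hk] at h3
    exact ⟨fun h5 => h3 ⟨h5, fun h => absurd h hk⟩, fun h5 => h4 fun h6 => h5 h6.1⟩
  have hprod : ∀ o : Option (Report Θ i), (G.Active i h → ∃ c ∈ G.available i h, o = some c) →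
      (¬ G.Active i h → o = none) → h ++ [Function.update p i o] ∈ G.hist := by
    intro o ho ho'
    refine G.product h ⟨r, hrm⟩ _ (fun k hk => ?_) (fun k hk => ?_)
    · by_cases hki : k = i
      · subst hki
        simpa using ho hk
      · simpa [hki] using (hother k hki).1 hk
    · by_cases hki : k = i
      · subst hki
        simpa using ho' hk
      · simpa [hki] using (hother k hki).2 hk
  by_cases hJ : h ∈ J
  · obtain ⟨g, hg, p', k', b, hp', rfl, ⟨l, hl, hb⟩, -, hrep, -⟩ := C.coaMap_mem_succ hT hJ
    have hb' := available_of_info C.succ.2.1 hl hJ hb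
    have hpi : p i = none := h2 i fun h => ((C.activeAt_coaHist hT).1 h).2 rfl hJ
    refine Or.inr (Or.inr ⟨hJ, Function.update p i (some b), b, by simp,
      hprod _ (fun _ => ⟨b, hb', rfl⟩) (fun h => absurd (activeAt_of_available hb') h), hrep, ?_⟩)
    rw [Function.update_idem, ← hpi, Function.update_eq_self]
  by_cases hI : h ∈ I
  · have hact : ActiveAt (G.coaHist i I J a) i hs :=
      (C.activeAt_coaHist hT).2 ⟨G.info_active i I C.succ.1 h hI, fun _ => hJ⟩
    obtain ⟨c, hc, hpc⟩ := h1 i hact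
    obtain rfl := C.eq_of_coaMap_mem hT hI
    rw [C.availableAt_coaHist_of_mem hI] at hc
    rcases hc with ⟨hc, hca⟩ | hc
    · refine Or.inl ⟨hJ, ?_, fun _ h3 => hca ?_⟩
      · have := hprod (p i) (fun _ => ⟨c, hc, hpc⟩) (fun h => absurd (activeAt_of_available hc) h)
        rwa [Function.update_eq_self] at this
      · rw [hpc] at h3
        simpa using h3
    · have ha := C.mem_available hI
      refine Or.inr (Or.inl ⟨hI, Function.update p i (some a), c, by simp,
        hprod _ (fun _ => ⟨a, ha, rfl⟩) (fun h => absurd (activeAt_of_available ha) h), hc, ?_⟩)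
      rw [Function.update_idem, ← hpc, Function.update_eq_self]
  · refine Or.inl ⟨hJ, ?_, fun h => absurd h hI⟩
    have h3 := h1 i
    have h4 := h2 i
    rw [C.activeAt_coaHist hT] at h3 h4
    rw [C.availableAt_coaHist hT fun _ => ⟨hI, hJ⟩] at h3
    have := hprod (p i) (fun h => h3 ⟨h, fun _ => hJ⟩) (fun h => h4 fun h' => h h'.1)
    rwa [Function.update_eq_self] at this

theorem coaHist_active_uniform (C : Coalescible G i I J a) {hs} {r : ActionProfile (Report Θ)}
    (hr : hs ++ [r] ∈ G.coaHist i I J a) {k : N} (hk : ActiveAt (G.coaHist i I J a) k hs) :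
    (r k).isSome := by
  obtain ⟨h', hT'⟩ := exists_coaMap hr
  obtain ⟨h, -, hT, -⟩ := C.coaMap_lt hT'
  rw [C.activeAt_coaHist hT] at hk
  rcases (C.snoc_mem_coaHist hT).1 hr with ⟨h1, h2, -⟩ | ⟨h1, p, b, h2, h3, h4, rfl⟩ |
    ⟨h1, q, b, h2, h3, h4, rfl⟩
  · exact G.active_uniform h r k h2 hk.1
  · by_cases hki : k = i
    · subst hki
      simp
    · simpa [hki] using G.active_uniform h p k h3 hk.1
  · have hki : k ≠ i := fun h => hk.2 h h1
    simpa [hki] using G.active_uniform h q k h3 hk.1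

theorem coaHist_profile_nonempty (C : Coalescible G i I J a) {hs} {r : ActionProfile (Report Θ)}
    (hr : hs ++ [r] ∈ G.coaHist i I J a) : ∃ k, (r k).isSome := by
  obtain ⟨h', hT'⟩ := exists_coaMap hr
  obtain ⟨h, -, hT, -⟩ := C.coaMap_lt hT'
  rcases (C.snoc_mem_coaHist hT).1 hr with ⟨h1, h2, -⟩ | ⟨h1, p, b, h2, h3, h4, rfl⟩ |
    ⟨h1, q, b, h2, h3, h4, rfl⟩
  · exact G.profile_nonempty h r h2
  · exact ⟨i, by simp⟩
  · obtain ⟨-, -, -, -, -, -, -, -, -, -, j, hj, hact⟩ := C.coaMap_mem_succ hT h1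
    exact ⟨j, by simpa [hj] using G.active_uniform h q j h3 hact⟩

/-- At a node of `J` that has a counterpart some other agent moves, so removing the move of `i`
creates no new end. -/
theorem coaMap_terminal (C : Coalescible G i I J a) {zs z} (hT : G.CoaMap i I J a zs z)
    (hz : ∀ p, zs ++ [p] ∉ G.coaHist i I J a) : G.Terminal z := by
  have key : ∀ k, ¬ ActiveAt (G.coaHist i I J a) k zs := fun k ⟨p, hp, _⟩ => hz p hp
  refine terminal_of_mem (coaMap_mem hT) fun k hk => ?_
  by_cases hJ : z ∈ J
  · obtain ⟨-, -, -, -, -, -, -, -, -, -, j, hj, hact⟩ := C.coaMap_mem_succ hT hJ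
    exact key j ((C.activeAt_coaHist hT).2 ⟨hact, fun h => absurd h hj⟩)
  · exact key k ((C.activeAt_coaHist hT).2 ⟨hk, fun _ => hJ⟩)

theorem coaHist_actions_disjoint (C : Coalescible G i I J a) {hs k}
    (hact : ActiveAt (G.coaHist i I J a) k hs) {b c : Report Θ k}
    (hb : b ∈ availableAt (G.coaHist i I J a) k hs)
    (hc : c ∈ availableAt (G.coaHist i I J a) k hs) (hne : b ≠ c) : Disjoint b.1 c.1 := by
  obtain ⟨p, hp, -⟩ := hact
  obtain ⟨h', hT'⟩ := exists_coaMap hp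
  obtain ⟨h, -, hT, -⟩ := C.coaMap_lt hT'
  replace hact : ActiveAt (G.coaHist i I J a) k hs := activeAt_of_available hb
  rw [C.activeAt_coaHist hT] at hact
  by_cases hI : k = i ∧ h ∈ I
  · obtain ⟨rfl, hI⟩ := hI
    obtain rfl := C.eq_of_coaMap_mem hT hI
    rw [C.availableAt_coaHist_of_mem hI] at hb hc
    have ha := C.mem_available hI
    rw [Set.disjoint_left]
    intro t htb htc
    rcases hb with ⟨hb, hba⟩ | hb <;> rcases hc with ⟨hc, hca⟩ | hc
    · exact hne (available_unique hb hc htb htc)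
    · exact hba (available_unique hb ha htb (C.subset_of_available hc htc))
    · exact hca (available_unique hc ha htc (C.subset_of_available hb htb))
    · obtain ⟨l, hl, hb⟩ := hb
      obtain ⟨l', hl', hc⟩ := hc
      exact hne (available_unique hb (available_of_info C.succ.2.1 hl' hl hc) htb htc)
  · rw [C.availableAt_coaHist hT fun hk => ⟨fun h1 => hI ⟨hk, h1⟩, hact.2 hk⟩] at hb hc
    exact G.actions_disjoint k h hact.1 b hb c hc hne

theorem coaHist_actions_cover (C : Coalescible G i I J a) {hs k}
    (hact : ActiveAt (G.coaHist i I J a) k hs) :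
    ⋃ b ∈ availableAt (G.coaHist i I J a) k hs, b.1 = reported k hs := by
  obtain ⟨p, hp, hps⟩ := hact
  obtain ⟨h', hT'⟩ := exists_coaMap hp
  obtain ⟨h, -, hT, -⟩ := C.coaMap_lt hT'
  replace hact : ActiveAt (G.coaHist i I J a) k hs := ⟨p, hp, hps⟩
  rw [C.coaMap_reported_active hT hact]
  rw [C.activeAt_coaHist hT] at hact
  by_cases hI : k = i ∧ h ∈ I
  · obtain ⟨rfl, hI⟩ := hI
    obtain rfl := C.eq_of_coaMap_mem hT hI
    have ha := C.mem_available hI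
    apply Set.Subset.antisymm
    · refine Set.iUnion₂_subset fun b hb => ?_
      rw [C.availableAt_coaHist_of_mem hI] at hb
      rcases hb with ⟨hb, -⟩ | hb
      · exact available_subset hb
      · exact (C.subset_of_available hb).trans (available_subset ha)
    · intro t ht
      obtain ⟨b, hb, htb⟩ := exists_available hact.1 ht
      rw [Set.mem_iUnion₂]
      by_cases hba : b = a
      · subst hba
        obtain ⟨c, hc, htc⟩ := C.exists_mem_available htb
        exact ⟨c, (C.availableAt_coaHist_of_mem hI).2 (Or.inr hc), htc⟩
      · exact ⟨b, (C.availableAt_coaHist_of_mem hI).2 (Or.inl ⟨hb, hba⟩), htb⟩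
  · rw [C.availableAt_coaHist hT fun hk => ⟨fun h1 => hI ⟨hk, h1⟩, hact.2 hk⟩]
    exact G.actions_cover k h hact.1

/-- The outcome of the coalesced mechanism. -/
noncomputable def coaOutcome (G : GradualMechanism f) (i : N) (I J : Set (History (Report Θ)))
    (a : Report Θ i) (hs : History (Report Θ)) : X :=
  if h : ∃ h, G.CoaMap i I J a hs h then G.outcome h.choose else G.outcome []

theorem coaOutcome_eq (C : Coalescible G i I J a) {hs h} (hT : G.CoaMap i I J a hs h) :
    coaOutcome G i I J a hs = G.outcome h := by
  have hex : ∃ h, G.CoaMap i I J a hs h := ⟨h, hT⟩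
  unfold coaOutcome
  rw [dif_pos hex, C.coaMap_unique hex.choose_spec hT]

/-- The coalesced mechanism. -/
noncomputable def coalesce (C : Coalescible G i I J a) : GradualMechanism f where
  hist := G.coaHist i I J a
  info k := {K | K.Nonempty ∧ ∃ L ∈ G.info k,
    K = {hs | ActiveAt (G.coaHist i I J a) k hs ∧ ∃ h ∈ L, G.CoaMap i I J a hs h}}
  outcome := coaOutcome G i I J a
  nil_mem := mem_coaHist_of_coaMap C.coaMap_nil
  prefix_mem hs r hr := by
    obtain ⟨h', hT'⟩ := exists_coaMap hr
    obtain ⟨h, -, hT, -⟩ := C.coaMap_lt hT'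
    exact mem_coaHist_of_coaMap hT
  bounded := by
    obtain ⟨T, hT⟩ := G.bounded
    refine ⟨T, fun hs hhs => ?_⟩
    obtain ⟨h, h1⟩ := exists_coaMap hhs
    exact (C.length_le_of_coaMap h1).trans (hT h (coaMap_mem h1))
  profile_nonempty _ _ hr := C.coaHist_profile_nonempty hr
  active_uniform _ _ _ hr hk := C.coaHist_active_uniform hr hk
  product _ := fun ⟨_, hq⟩ _ h1 h2 => C.coaHist_product hq h1 h2
  root_active k := (C.activeAt_coaHist C.coaMap_nil).2 ⟨G.root_active k, fun _ => C.nil_not_mem⟩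
  info_nonempty _ _ hK := hK.1
  info_active k K hK h hh := by
    obtain ⟨-, L, hL, rfl⟩ := hK
    exact hh.1
  info_cover k hs hact := by
    obtain ⟨p, hp, hps⟩ := hact
    obtain ⟨h', hT'⟩ := exists_coaMap hp
    obtain ⟨h, -, hT, -⟩ := C.coaMap_lt hT'
    replace hact : ActiveAt (G.coaHist i I J a) k hs := ⟨p, hp, hps⟩
    obtain ⟨L, hL, hh⟩ := exists_info ((C.activeAt_coaHist hT).1 hact).1
    refine ⟨{hs | ActiveAt (G.coaHist i I J a) k hs ∧ ∃ h ∈ L, G.CoaMap i I J a hs h},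
      ⟨⟨⟨hs, hact, h, hh, hT⟩, L, hL, rfl⟩, hact, h, hh, hT⟩, ?_⟩
    rintro K ⟨⟨-, L', hL', rfl⟩, -, h₂, hh₂, hT₂⟩
    obtain rfl := C.coaMap_unique hT hT₂
    rw [info_eq_of_mem hL hL' hh hh₂]
  info_available k K hK hs hhs hs' hhs' := by
    obtain ⟨-, L, hL, rfl⟩ := hK
    obtain ⟨hact, h, hh, hT⟩ := hhs
    obtain ⟨hact', h', hh', hT'⟩ := hhs'
    exact C.availableAt_coaHist_info hL hh hh' hT hT' hact hact'
  recall_decisions k K hK hs hhs hs' hhs' := by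
    obtain ⟨-, L, hL, rfl⟩ := hK
    obtain ⟨hact, h, hh, hT⟩ := hhs
    obtain ⟨hact', h', hh', hT'⟩ := hhs'
    exact C.coaMap_recall_decisions hL hh hh' hT hT' hact hact'
  recall_info k K hK hs hhs hs' hhs' g hg hgact := by
    obtain ⟨-, L, hL, rfl⟩ := hK
    obtain ⟨hact, h, hh, hT⟩ := hhs
    obtain ⟨hact', h', hh', hT'⟩ := hhs'
    obtain ⟨g₁, hT₁, hgh⟩ := C.coaMap_prefix hT hg
    have h1 := (C.activeAt_coaHist hT₁).1 hgact
    obtain ⟨g₂, hg₂, M, hM, h2, h3⟩ := G.recall_info k L hL h hh h' hh' g₁ hgh h1.1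
    have hgM : k = i → g₂ ∉ J := by
      rintro rfl h4
      obtain rfl := info_eq_of_mem hM C.succ.2.1 h3 h4
      exact h1.2 rfl h2
    have hact₂ := G.info_active k M hM g₂ h3
    obtain ⟨gs, hgs, hT₂⟩ := C.coaMap_lift hT' hg₂ fun h4 => ⟨k, fun hk => hgM hk h4, hact₂⟩
    have hact₃ := (C.activeAt_coaHist hT₂).2 ⟨hact₂, hgM⟩
    exact ⟨gs, hgs, {hs | ActiveAt (G.coaHist i I J a) k hs ∧ ∃ h ∈ M, G.CoaMap i I J a hs h},
      ⟨⟨gs, hact₃, g₂, h3, hT₂⟩, M, hM, rfl⟩, ⟨hgact, g₁, h2, hT₁⟩,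
      ⟨hact₃, g₂, h3, hT₂⟩⟩
  actions_disjoint _ _ hact _ hb _ hc hne := C.coaHist_actions_disjoint hact hb hc hne
  actions_cover _ _ hact := C.coaHist_actions_cover hact
  implements zs hzs θ hθ := by
    obtain ⟨z, hT⟩ := exists_coaMap hzs.1
    rw [C.coaOutcome_eq hT]
    exact G.implements z (C.coaMap_terminal hT hzs.2) θ (C.coaMap_reportedAll hT hθ)

theorem isCOA_coalesce (C : Coalescible G i I J a) : IsCOA G C.coalesce i I J a where
  available := C.available
  succ := C.succ
  no_news := C.no_news
  hist_eq := rfl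
  info_eq _ := rfl
  outcome_eq _ _ _ hT := C.coaOutcome_eq hT

end Coalescible

end Coalescing

end GradualMechanism

/-! ### Splitting and merging: construction of the mechanisms -/

namespace GradualMechanism

open GameForm

section Splitting

open Classical

variable {N : Type u} {Θ : N → Type v} {X : Type w} {f : ((i : N) → Θ i) → X}
  {G : GradualMechanism f}

/-- After the choice of the non-trivial action `a` at `I`, agent `i` moves at most once more, and
then she reveals her type. -/
structure FinalStage (G : GradualMechanism f) (i : N) (I : Set (History (Report Θ)))
    (a : Report Θ i) : Prop where
  info_mem : I ∈ G.info i
  available : ∀ g ∈ I, a ∈ G.available i g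
  nontrivial : a.1.Nontrivial
  last : ∀ g ∈ I, ∀ (p : ActionProfile (Report Θ)) (h h' : History (Report Θ)), p i = some a →
    g ++ [p] <+: h → G.Active i h → G.Active i h' → h <+: h' → h = h'
  available_iff : ∀ g ∈ I, ∀ (p : ActionProfile (Report Θ)) (h : History (Report Θ)),
    p i = some a → g ++ [p] <+: h → G.Active i h →
    ∀ c, c ∈ G.available i h ↔ ∃ t ∈ a.1, c.1 = {t}

/-- The histories of the mechanism in which `a` is split into `a₁` and `a₂`. -/
def splHist (G : GradualMechanism f) (i : N) (I : Set (History (Report Θ))) (a a₁ a₂ : Report Θ i) :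
    Set (History (Report Θ)) :=
  G.hist ∪ {h | ∃ z ∈ G.splitNodes i I a, ∃ b, (b = a₁ ∨ b = a₂) ∧ h = z ++ [soloProfile i b]}

theorem soloProfile_self {i : N} {b : Report Θ i} : soloProfile i b i = some b := by
  simp [soloProfile]

theorem soloProfile_of_ne {i k : N} (hk : k ≠ i) {b : Report Θ i} : soloProfile i b k = none := by
  simp [soloProfile, hk]

variable {i : N} {I : Set (History (Report Θ))} {a a₁ a₂ : Report Θ i}

theorem snoc_mem_splHist {h : History (Report Θ)} {r : ActionProfile (Report Θ)} :
    h ++ [r] ∈ splHist G i I a a₁ a₂ ↔ h ++ [r] ∈ G.hist ∨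
      (h ∈ G.splitNodes i I a ∧ ∃ b, (b = a₁ ∨ b = a₂) ∧ r = soloProfile i b) := by
  refine or_congr Iff.rfl ⟨?_, ?_⟩
  · rintro ⟨z, hz, b, hb, h1⟩
    obtain ⟨rfl, h2⟩ := List.append_inj' h1 rfl
    exact ⟨hz, b, hb, by simpa using h2⟩
  · rintro ⟨hz, b, hb, rfl⟩
    exact ⟨h, hz, b, hb, rfl⟩

theorem not_active_splitNodes {z k} (hz : z ∈ G.splitNodes i I a) : ¬ G.Active k z :=
  not_active_of_terminal hz.1

theorem availableAt_splHist {h k} (hh : k = i → h ∉ G.splitNodes i I a) :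
    availableAt (splHist G i I a a₁ a₂) k h = G.available k h := by
  ext c
  refine ⟨?_, fun ⟨r, hr, hc⟩ => ⟨r, Or.inl hr, hc⟩⟩
  rintro ⟨r, hr, hc⟩
  rcases snoc_mem_splHist.1 hr with hr | ⟨hz, b, -, rfl⟩
  · exact ⟨r, hr, hc⟩
  · have hk : k ≠ i := fun hk => hh hk hz
    rw [soloProfile_of_ne hk] at hc
    simp at hc

theorem availableAt_splHist_of_mem {z} (hz : z ∈ G.splitNodes i I a) {c : Report Θ i} :
    c ∈ availableAt (splHist G i I a a₁ a₂) i z ↔ c = a₁ ∨ c = a₂ := by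
  constructor
  · rintro ⟨r, hr, hc⟩
    rcases snoc_mem_splHist.1 hr with hr | ⟨-, b, hb, rfl⟩
    · exact absurd (activeAt_of_mem hr hc) (not_active_splitNodes hz)
    · rw [soloProfile_self] at hc
      obtain rfl : b = c := by simpa using hc
      exact hb
  · intro hc
    exact ⟨_, snoc_mem_splHist.2 (Or.inr ⟨hz, c, hc, rfl⟩), soloProfile_self⟩

theorem activeAt_splHist {h k} : ActiveAt (splHist G i I a a₁ a₂) k h ↔
    G.Active k h ∨ (k = i ∧ h ∈ G.splitNodes i I a) := by
  by_cases hh : k = i ∧ h ∈ G.splitNodes i I a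
  · obtain ⟨rfl, hz⟩ := hh
    exact ⟨fun _ => Or.inr ⟨rfl, hz⟩, fun _ => activeAt_of_available (a := a₁)
      ((availableAt_splHist_of_mem hz).2 (Or.inl rfl))⟩
  · have h1 := availableAt_splHist (G := G) (I := I) (a := a) (a₁ := a₁) (a₂ := a₂) (h := h)
      fun hk hz => hh ⟨hk, hz⟩
    constructor
    · intro hact
      obtain ⟨c, hc⟩ := hact.exists_available
      rw [h1] at hc
      exact Or.inl (activeAt_of_available hc)
    · intro hact
      obtain ⟨c, hc⟩ := (hact.resolve_right hh).exists_available
      exact activeAt_of_available (a := c) (by rw [h1]; exact hc)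

theorem mem_of_snoc_mem_splHist {h : History (Report Θ)} {r : ActionProfile (Report Θ)}
    (hr : h ++ [r] ∈ splHist G i I a a₁ a₂) : h ∈ G.hist := by
  rcases snoc_mem_splHist.1 hr with hr | ⟨hz, -⟩
  · exact G.prefix_mem _ _ hr
  · exact hz.1.1

/-- The outcome of the split mechanism. -/
noncomputable def splOutcome (G : GradualMechanism f) (h : History (Report Θ)) : X :=
  if h ∈ G.hist then G.outcome h else G.outcome h.dropLast

namespace FinalStage

/-- A further move of `i` after `a` would reveal her type, whereas her final report is the
non-singleton `a`; so `a` is chosen at `I` and is her last move. -/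
theorem follows_of_mem (F : FinalStage G i I a) {z} (hz : z ∈ G.splitNodes i I a) :
    ∃ g ∈ I, ∃ p : ActionProfile (Report Θ), p i = some a ∧ g ++ [p] <+: z ∧
      decisions i z = decisions i g ++ [a] := by
  obtain ⟨hz, hr, g, hg, h1, hne⟩ := hz
  obtain ⟨p, hp⟩ := exists_snoc_prefix h1 hne
  obtain ⟨c, hc, hcm⟩ := (G.info_active i I F.info_mem g hg).exists_eq_some hz.1 hp
  -- Reports shrink along the path, so the action `c` taken at `g` contains `a`; actions at `g` are
  -- disjoint, hence `c = a`.
  have h2 : a.1 ⊆ c.1 := by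
    rw [← hr, ← reported_snoc_some (h := g) hc]
    exact reported_anti hz.1 hp
  obtain ⟨t, ht⟩ := a.2
  obtain rfl := available_unique hcm (F.available g hg) (h2 ht) ht
  refine ⟨g, hg, p, hc, hp, ?_⟩
  rw [decisions_eq_of_not_active hz.1 hp fun h h3 h4 hhz hact => ?_, decisions_append,
    decisions_singleton_some hc]
  obtain ⟨q, hq⟩ := exists_snoc_prefix h4 hhz
  obtain ⟨b, hb, hbm⟩ := hact.exists_eq_some hz.1 hq
  obtain ⟨t, -, hbt⟩ := (F.available_iff g hg p h hc h3 hact b).1 hbm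
  have h5 : c.1 ⊆ b.1 := by
    rw [← hr, ← reported_snoc_some (h := h) hb]
    exact reported_anti hz.1 hq
  rw [hbt] at h5
  exact F.nontrivial.not_subset_singleton h5

/-- All earlier decision nodes of `i` are at or before `I`, where perfect recall of `G` applies. -/
theorem splitNodes_recall (F : FinalStage G i I a) {z z' h} (hz : z ∈ G.splitNodes i I a)
    (hz' : z' ∈ G.splitNodes i I a) (hh : h <+: z) (hact : G.Active i h) :
    ∃ h₂, h₂ <+: z' ∧ ∃ K ∈ G.info i, h ∈ K ∧ h₂ ∈ K := by
  obtain ⟨g, hg, p, hp, h1, h2⟩ := F.follows_of_mem hz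
  obtain ⟨g', hg', p', hp', h1', h2'⟩ := F.follows_of_mem hz'
  have hgz := (List.prefix_append _ _).trans h1
  have h3 : h <+: g := by
    rcases List.prefix_or_prefix_of_prefix hh hgz with h4 | h4
    · exact h4
    · by_cases hne : g = h
      · exact hne ▸ List.prefix_refl _
      · have h5 := active_decisions_lt (G.info_active i I F.info_mem g hg) hact.mem h4 hne
        have h6 : h ≠ z := by
          rintro rfl
          exact not_active_splitNodes hz hact
        have h7 := active_decisions_lt hact hz.1.1 hh h6
        rw [h2] at h7
        simp at h7
        omega
  obtain ⟨h₂, h4, h5⟩ := G.recall_info i I F.info_mem g hg g' hg' h h3 hact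
  exact ⟨h₂, h4.trans ((List.prefix_append _ _).trans h1'), h5⟩

/-- The mechanism in which `a` is split into `a₁` and `a₂`. -/
noncomputable def split (F : FinalStage G i I a) (hS : (G.splitNodes i I a).Nonempty)
    (hd : Disjoint a₁.1 a₂.1) (hu : a₁.1 ∪ a₂.1 = a.1) : GradualMechanism f where
  hist := splHist G i I a a₁ a₂
  info k := {K | K ∈ G.info k ∨ (k = i ∧ K = G.splitNodes i I a)}
  outcome := splOutcome G
  nil_mem := Or.inl G.nil_mem
  prefix_mem _ _ hr := Or.inl (mem_of_snoc_mem_splHist hr)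
  bounded := by
    obtain ⟨T, hT⟩ := G.bounded
    refine ⟨T + 1, ?_⟩
    rintro h (hh | ⟨z, hz, b, -, rfl⟩)
    · exact (hT h hh).trans (Nat.le_succ _)
    · simpa using hT z hz.1.1
  profile_nonempty h r hr := by
    rcases snoc_mem_splHist.1 hr with hr | ⟨-, b, -, rfl⟩
    · exact G.profile_nonempty h r hr
    · exact ⟨i, by rw [soloProfile_self]; rfl⟩
  active_uniform h r k hr hk := by
    rw [activeAt_splHist] at hk
    rcases snoc_mem_splHist.1 hr with hr | ⟨hz, b, -, rfl⟩
    · rcases hk with hk | ⟨-, hz⟩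
      · exact G.active_uniform h r k hr hk
      · exact absurd hr (hz.1.2 r)
    · rcases hk with hk | ⟨rfl, -⟩
      · exact absurd hk (not_active_splitNodes hz)
      · rw [soloProfile_self]; rfl
  product h := by
    rintro ⟨q, hq⟩ p h1 h2
    rw [snoc_mem_splHist] at hq ⊢
    rcases hq with hq | ⟨hz, -⟩
    · have hh : h ∉ G.splitNodes i I a := fun hz => hz.1.2 q hq
      refine Or.inl (G.product h ⟨q, hq⟩ p (fun k hk => ?_) (fun k hk => ?_))
      · have := h1 k (activeAt_splHist.2 (Or.inl hk))
        rwa [availableAt_splHist fun _ => hh] at this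
      · refine h2 k fun h3 => ?_
        rcases activeAt_splHist.1 h3 with h3 | h3
        · exact hk h3
        · exact hh h3.2
    · refine Or.inr ⟨hz, ?_⟩
      obtain ⟨c, hc, hpc⟩ := h1 i (activeAt_splHist.2 (Or.inr ⟨rfl, hz⟩))
      refine ⟨c, (availableAt_splHist_of_mem hz).1 hc, ?_⟩
      funext k
      by_cases hk : k = i
      · subst hk
        rw [hpc, soloProfile_self]
      · rw [soloProfile_of_ne hk]
        refine h2 k fun h3 => ?_
        rcases activeAt_splHist.1 h3 with h3 | h3
        · exact not_active_splitNodes hz h3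
        · exact hk h3.1
  root_active k := activeAt_splHist.2 (Or.inl (G.root_active k))
  info_nonempty k K hK := by
    rcases hK with hK | ⟨rfl, rfl⟩
    · exact G.info_nonempty k K hK
    · exact hS
  info_active k K hK h hh := by
    rw [activeAt_splHist]
    rcases hK with hK | ⟨rfl, rfl⟩
    · exact Or.inl (G.info_active k K hK h hh)
    · exact Or.inr ⟨rfl, hh⟩
  info_cover k h hh := by
    rcases activeAt_splHist.1 hh with hact | ⟨rfl, hz⟩
    · obtain ⟨K, hK, h1⟩ := exists_info hact
      refine ⟨K, ⟨Or.inl hK, h1⟩, ?_⟩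
      rintro K' ⟨hK' | ⟨rfl, rfl⟩, h2⟩
      · exact info_eq_of_mem hK' hK h2 h1
      · exact absurd hact (not_active_splitNodes h2)
    · refine ⟨_, ⟨Or.inr ⟨rfl, rfl⟩, hz⟩, ?_⟩
      rintro K' ⟨hK' | ⟨-, rfl⟩, h2⟩
      · exact absurd (G.info_active k K' hK' h h2) (not_active_splitNodes hz)
      · rfl
  info_available k K hK h hh h' hh' := by
    rcases hK with hK | ⟨rfl, rfl⟩
    · rw [availableAt_splHist fun _ h1 => not_active_splitNodes h1 (G.info_active k K hK h hh),
        availableAt_splHist fun _ h1 => not_active_splitNodes h1 (G.info_active k K hK h' hh')]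
      exact G.info_available k K hK h hh h' hh'
    · ext c
      rw [availableAt_splHist_of_mem hh, availableAt_splHist_of_mem hh']
  recall_decisions k K hK h hh h' hh' := by
    rcases hK with hK | ⟨rfl, rfl⟩
    · exact G.recall_decisions k K hK h hh h' hh'
    · obtain ⟨g, hg, -, -, -, h1⟩ := F.follows_of_mem hh
      obtain ⟨g', hg', -, -, -, h1'⟩ := F.follows_of_mem hh'
      rw [h1, h1', G.recall_decisions k I F.info_mem g hg g' hg']
  recall_info k K hK h hh h' hh' g hg hact := by
    rcases activeAt_splHist.1 hact with hgact | ⟨rfl, hgz⟩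
    · rcases hK with hK | ⟨rfl, rfl⟩
      · obtain ⟨g₂, h1, J, hJ, h2⟩ := G.recall_info k K hK h hh h' hh' g hg hgact
        exact ⟨g₂, h1, J, Or.inl hJ, h2⟩
      · obtain ⟨g₂, h1, J, hJ, h2⟩ := F.splitNodes_recall hh hh' hg hgact
        exact ⟨g₂, h1, J, Or.inl hJ, h2⟩
    · rcases hK with hK | ⟨-, rfl⟩
      · have hact' := G.info_active k K hK h hh
        obtain rfl := hgz.1.eq_of_prefix hact'.mem hg
        exact absurd hact' (not_active_splitNodes hgz)
      · exact ⟨h', List.prefix_refl _, _, Or.inr ⟨rfl, rfl⟩, hgz, hh'⟩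
  actions_disjoint k h hact b hb c hc hne := by
    by_cases hz : k = i ∧ h ∈ G.splitNodes i I a
    · obtain ⟨rfl, hz⟩ := hz
      rw [availableAt_splHist_of_mem hz] at hb hc
      rcases hb with rfl | rfl <;> rcases hc with rfl | rfl
      · exact absurd rfl hne
      · exact hd
      · exact hd.symm
      · exact absurd rfl hne
    · rw [availableAt_splHist fun h1 h2 => hz ⟨h1, h2⟩] at hb hc
      exact G.actions_disjoint k h (activeAt_of_available hb) b hb c hc hne
  actions_cover k h hact := by
    by_cases hz : k = i ∧ h ∈ G.splitNodes i I a
    · obtain ⟨rfl, hz⟩ := hz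
      rw [hz.2.1, ← hu]
      ext t
      simp only [Set.mem_iUnion₂, availableAt_splHist_of_mem hz]
      simp [or_and_right, exists_or]
    · rw [availableAt_splHist fun h1 h2 => hz ⟨h1, h2⟩]
      rw [activeAt_splHist] at hact
      exact G.actions_cover k h (hact.resolve_right hz)
  implements z hz θ hθ := by
    unfold splOutcome
    rcases hz.1 with hm | ⟨z', hz', b, hb, rfl⟩
    · rw [if_pos hm]
      exact G.implements z ⟨hm, fun p hp => hz.2 p (Or.inl hp)⟩ θ hθ
    · rw [if_neg (hz'.1.2 _), List.dropLast_concat]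
      refine G.implements z' hz'.1 θ fun k => ?_
      by_cases hk : k = i
      · subst hk
        rw [hz'.2.1, ← hu]
        have := hθ k
        rw [reported_snoc_some soloProfile_self] at this
        rcases hb with rfl | rfl
        · exact Or.inl this
        · exact Or.inr this
      · have := hθ k
        rwa [reported_snoc_none (soloProfile_of_ne hk)] at this

theorem isSPL_split (F : FinalStage G i I a) (hS : (G.splitNodes i I a).Nonempty)
    (hd : Disjoint a₁.1 a₂.1) (hu : a₁.1 ∪ a₂.1 = a.1) :
    IsSPL G (F.split hS hd hu) i I a a₁ a₂ where
  info_mem := F.info_mem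
  available := by
    obtain ⟨g, hg⟩ := G.info_nonempty i I F.info_mem
    exact ⟨g, hg, F.available g hg⟩
  nodes_nonempty := hS
  disjoint := hd
  union := hu
  hist_eq := rfl
  info_other k hk := by
    ext K
    exact or_iff_left fun h => hk h.1
  info_self := by
    ext K
    exact or_congr Iff.rfl (and_iff_right rfl)
  outcome_eq := by
    -- The map forgets the added solo move.
    refine ⟨fun h => if h ∈ G.hist then h else h.dropLast, ?_, ?_, ?_⟩
    · intro z hz
      rcases hz.1 with hm | ⟨z', hz', b, hb, rfl⟩
      · simp only [if_pos hm]
        exact ⟨hm, fun p hp => hz.2 p (Or.inl hp)⟩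
      · simp only [if_neg (hz'.1.2 _), List.dropLast_concat]
        exact hz'.1
    · intro z hz
      by_cases hzs : z ∈ G.splitNodes i I a
      · refine ⟨z ++ [soloProfile i a₁], ⟨Or.inr ⟨z, hzs, a₁, Or.inl rfl, rfl⟩, fun p hp => ?_⟩, ?_⟩
        · exact hz.2 _ (mem_of_snoc_mem_splHist hp)
        · simp only [if_neg (hz.2 _), List.dropLast_concat]
      · refine ⟨z, ⟨Or.inl hz.1, fun p hp => ?_⟩, if_pos hz.1⟩
        rcases snoc_mem_splHist.1 hp with hp | hp
        · exact hz.2 p hp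
        · exact hzs hp.1
    · intro z hz
      rcases hz.1 with hm | ⟨z', hz', b, hb, rfl⟩
      · simp only [if_pos hm]
        exact ⟨subset_rfl, if_pos hm⟩
      · simp only [if_neg (hz'.1.2 _), List.dropLast_concat]
        refine ⟨fun θ hθ k => ?_, ?_⟩
        · by_cases hk : k = i
          · subst hk
            rw [hz'.2.1, ← hu]
            have := hθ k
            rw [reported_snoc_some soloProfile_self] at this
            rcases hb with rfl | rfl
            · exact Or.inl this
            · exact Or.inr this
          · have := hθ k
            rwa [reported_snoc_none (soloProfile_of_ne hk)] at this
        · show splOutcome G _ = _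
          rw [splOutcome, if_neg (hz'.1.2 _), List.dropLast_concat]

end FinalStage

end Splitting

end GradualMechanism

/-! ### Merging information sets -/

namespace GradualMechanism

open GameForm

variable {N : Type u} {Θ : N → Type v} {X : Type w} {f : ((i : N) → Θ i) → X}
  {G : GradualMechanism f} {i : N} {I J₁ J₂ : Set (History (Report Θ))} {a : Report Θ i}

/-- The history `h` follows the choice of `a` at `I`. -/
def Follows (i : N) (I : Set (History (Report Θ))) (a : Report Θ i) (h : History (Report Θ)) :
    Prop :=
  ∃ g ∈ I, ∃ p : ActionProfile (Report Θ), p i = some a ∧ g ++ [p] <+: h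

/-- The information sets of the mechanism in which `J₁` and `J₂` are merged. -/
def mergeInfo (G : GradualMechanism f) (i : N) (J₁ J₂ : Set (History (Report Θ))) (k : N) :
    Set (Set (History (Report Θ))) :=
  {K | (K ∈ G.info k ∧ (k = i → K ≠ J₁ ∧ K ≠ J₂)) ∨ (k = i ∧ K = J₁ ∪ J₂)}

theorem follows_of_mem_info (hI : I ∈ G.info i) {J} (hJ : J ∈ G.info i) {h h'} (hh : h ∈ J)
    (hh' : h' ∈ J) (hf : Follows i I a h) : Follows i I a h' := by
  obtain ⟨g, hg, p, hp, h1⟩ := hf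
  obtain ⟨g₂, hg₂, p₂, h2, h3⟩ := recall_snoc hJ hI hg hh hh' h1
  exact ⟨g₂, hg₂, p₂, h3.trans hp, h2⟩

theorem exists_mergeInfo {k : N} {K} (hK : K ∈ G.info k) :
    ∃ K' ∈ mergeInfo G i J₁ J₂ k, K ⊆ K' := by
  by_cases h : k = i ∧ (K = J₁ ∨ K = J₂)
  · obtain ⟨rfl, rfl | rfl⟩ := h
    · exact ⟨_, Or.inr ⟨rfl, rfl⟩, Set.subset_union_left⟩
    · exact ⟨_, Or.inr ⟨rfl, rfl⟩, Set.subset_union_right⟩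
  · exact ⟨K, Or.inl ⟨hK, fun hk => ⟨fun h1 => h ⟨hk, Or.inl h1⟩, fun h1 => h ⟨hk, Or.inr h1⟩⟩⟩,
      subset_rfl⟩

namespace FinalStage

theorem decisions_of_follows (F : FinalStage G i I a) {h} (hf : Follows i I a h)
    (hact : G.Active i h) : ∃ g ∈ I, decisions i h = decisions i g ++ [a] := by
  obtain ⟨g, hg, p, hp, h1⟩ := hf
  refine ⟨g, hg, ?_⟩
  rw [decisions_eq_of_not_active hact.mem h1 fun h' h2 h3 hne hact' =>
    hne (F.last g hg p h' h hp h2 hact' hact h3), decisions_append, decisions_singleton_some hp]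

theorem recall_of_follows (F : FinalStage G i I a) {h h' g₀} (hf : Follows i I a h)
    (hf' : Follows i I a h') (hact : G.Active i h) (hg₀ : g₀ <+: h) (hgact : G.Active i g₀)
    (hne : g₀ ≠ h) : ∃ g₂, g₂ <+: h' ∧ ∃ K ∈ G.info i, g₀ ∈ K ∧ g₂ ∈ K := by
  obtain ⟨g, hg, p, hp, h1⟩ := hf
  obtain ⟨g', hg', p', hp', h1'⟩ := hf'
  have h3 : g₀ <+: g := by
    rcases prefix_cases hg₀ ((List.prefix_append _ _).trans h1) with h3 | ⟨q, h3⟩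
    · exact h3
    · obtain rfl := snoc_prefix_unique (h3.trans hg₀) h1
      exact absurd (F.last g hg q g₀ h hp h3 hgact hact hg₀) hne
  obtain ⟨h₂, h4, h5⟩ := G.recall_info i I F.info_mem g hg g' hg' g₀ h3 hgact
  exact ⟨h₂, h4.trans ((List.prefix_append _ _).trans h1'), h5⟩

/-- The mechanism in which `J₁` and `J₂` are merged. -/
def merge (F : FinalStage G i I a) (h₁ : J₁ ∈ G.info i) (h₂ : J₂ ∈ G.info i)
    (hf : ∀ h ∈ J₁ ∪ J₂, Follows i I a h) : GradualMechanism f where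
  __ := G
  info := mergeInfo G i J₁ J₂
  info_nonempty k K hK := by
    rcases hK with ⟨hK, -⟩ | ⟨rfl, rfl⟩
    · exact G.info_nonempty k K hK
    · exact (G.info_nonempty k J₁ h₁).mono Set.subset_union_left
  info_active k K hK h hh := by
    rcases hK with ⟨hK, -⟩ | ⟨rfl, rfl⟩
    · exact G.info_active k K hK h hh
    · exact hh.elim (G.info_active k J₁ h₁ h) (G.info_active k J₂ h₂ h)
  info_cover k h hact := by
    obtain ⟨K, hK, hh⟩ := exists_info hact
    obtain ⟨K', hK', hKK⟩ := exists_mergeInfo (i := i) (J₁ := J₁) (J₂ := J₂) hK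
    refine ⟨K', ⟨hK', hKK hh⟩, ?_⟩
    rintro L ⟨hL, hhL⟩
    have key : ∀ M, M ∈ G.info k → (k = i → M ≠ J₁ ∧ M ≠ J₂) → k = i → h ∈ M →
        h ∉ J₁ ∪ J₂ := by
      rintro M hM hne rfl hhM (h3 | h3)
      · exact (hne rfl).1 (info_eq_of_mem hM h₁ hhM h3)
      · exact (hne rfl).2 (info_eq_of_mem hM h₂ hhM h3)
    rcases hK' with ⟨hK', hne⟩ | ⟨hki, hK'⟩ <;> rcases hL with ⟨hL, hne'⟩ | ⟨hki', hL⟩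
    · exact info_eq_of_mem hL hK' hhL (hKK hh)
    · rw [hL] at hhL
      exact absurd hhL (key K' hK' hne hki' (hKK hh))
    · have := hKK hh
      rw [hK'] at this
      exact absurd this (key L hL hne' hki hhL)
    · rw [hL, hK']
  info_available k K hK h hh h' hh' := by
    rcases hK with ⟨hK, -⟩ | ⟨rfl, rfl⟩
    · exact G.info_available k K hK h hh h' hh'
    -- The two sets offer the same actions, namely the singletons of types in `a`.
    · have key : ∀ l ∈ J₁ ∪ J₂, ∀ c, c ∈ availableAt G.hist k l ↔ ∃ t ∈ a.1, c.1 = {t} := by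
        intro l hl c
        obtain ⟨g, hg, p, hp, h1⟩ := hf l hl
        exact F.available_iff g hg p l hp h1
          (hl.elim (G.info_active k J₁ h₁ l) (G.info_active k J₂ h₂ l)) c
      ext c
      rw [key h hh c, key h' hh' c]
  recall_decisions k K hK h hh h' hh' := by
    rcases hK with ⟨hK, -⟩ | ⟨rfl, rfl⟩
    · exact G.recall_decisions k K hK h hh h' hh'
    · have key : ∀ l ∈ J₁ ∪ J₂, ∃ g ∈ I, decisions k l = decisions k g ++ [a] := fun l hl =>
        F.decisions_of_follows (hf l hl)
          (hl.elim (G.info_active k J₁ h₁ l) (G.info_active k J₂ h₂ l))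
      obtain ⟨g, hg, h1⟩ := key h hh
      obtain ⟨g', hg', h1'⟩ := key h' hh'
      rw [h1, h1', G.recall_decisions k I F.info_mem g hg g' hg']
  recall_info k K hK h hh h' hh' g hg hgact := by
    have hlift : (∃ g₂, g₂ <+: h' ∧ ∃ J ∈ G.info k, g ∈ J ∧ g₂ ∈ J) →
        ∃ g₂, g₂ <+: h' ∧ ∃ J ∈ mergeInfo G i J₁ J₂ k, g ∈ J ∧ g₂ ∈ J := by
      rintro ⟨g₂, h3, J, hJ, h4, h5⟩
      obtain ⟨J', hJ', h6⟩ := exists_mergeInfo (i := i) (J₁ := J₁) (J₂ := J₂) hJ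
      exact ⟨g₂, h3, J', hJ', h6 h4, h6 h5⟩
    rcases hK with ⟨hK, -⟩ | ⟨rfl, rfl⟩
    · exact hlift (G.recall_info k K hK h hh h' hh' g hg hgact)
    · by_cases hne : g = h
      · subst hne
        exact ⟨h', List.prefix_refl _, _, Or.inr ⟨rfl, rfl⟩, hh, hh'⟩
      · exact hlift (F.recall_of_follows (hf h hh) (hf h' hh')
          (hh.elim (G.info_active k J₁ h₁ h) (G.info_active k J₂ h₂ h)) hg hgact hne)
  actions_disjoint := G.actions_disjoint
  actions_cover := G.actions_cover
  implements := G.implements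

/-- Since `i` does not move after `J₁` or `J₂`, dividing their union affects no other information
set and gives back exactly `G`. -/
theorem isILL_merge (F : FinalStage G i I a) (h₁ : J₁ ∈ G.info i) (h₂ : J₂ ∈ G.info i)
    (hf : ∀ h ∈ J₁ ∪ J₂, Follows i I a h) (hne : J₁ ≠ J₂) :
    IsILL (F.merge h₁ h₂ hf) G i (J₁ ∪ J₂) J₁ J₂ := by
  have hlast : ∀ l ∈ J₁ ∪ J₂, ∀ h, G.Active i h → l <+: h → l = h := by
    intro l hl h hact hlh
    obtain ⟨g, hg, p, hp, h1⟩ := hf l hl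
    exact F.last g hg p l h hp h1
      (hl.elim (G.info_active i J₁ h₁ l) (G.info_active i J₂ h₂ l)) hact hlh
  have hdisj : Disjoint J₁ J₂ := Set.disjoint_left.2 fun h h3 h4 => hne (info_eq_of_mem h₁ h₂ h3 h4)
  have hpre : InfoPrecEq (J₁ ∪ J₂) (J₁ ∪ J₂) := by
    obtain ⟨l, hl⟩ := G.info_nonempty i J₁ h₁
    exact ⟨l, Or.inl hl, l, Or.inl hl, List.prefix_refl _⟩
  have hpart₁ : {h | h ∈ J₁ ∪ J₂ ∧ SetPrecEq J₁ h} = J₁ := by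
    ext h
    refine ⟨?_, fun hh => ⟨Or.inl hh, h, hh, List.prefix_refl _⟩⟩
    rintro ⟨hh, l, hl, hlh⟩
    rwa [← hlast l (Or.inl hl) h (hh.elim (G.info_active i J₁ h₁ h) (G.info_active i J₂ h₂ h)) hlh]
  have hpart₂ : {h | h ∈ J₁ ∪ J₂ ∧ SetPrecEq J₂ h} = J₂ := by
    ext h
    refine ⟨?_, fun hh => ⟨Or.inr hh, h, hh, List.prefix_refl _⟩⟩
    rintro ⟨hh, l, hl, hlh⟩
    rwa [← hlast l (Or.inr hl) h (hh.elim (G.info_active i J₁ h₁ h) (G.info_active i J₂ h₂ h)) hlh]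
  have hnot : ∀ K ∈ G.info i, K ≠ J₁ → K ≠ J₂ → ¬ InfoPrecEq (J₁ ∪ J₂) K := by
    rintro K hK hK₁ hK₂ ⟨k, hk, l, hl, hlk⟩
    obtain rfl := hlast l hl k (G.info_active i K hK k hk) hlk
    rcases hl with hl | hl
    · exact hK₁ (info_eq_of_mem hK h₁ hk hl)
    · exact hK₂ (info_eq_of_mem hK h₂ hk hl)
  exact {
    info_mem := Or.inr ⟨rfl, rfl⟩
    nonempty₁ := G.info_nonempty i J₁ h₁
    nonempty₂ := G.info_nonempty i J₂ h₂
    disjoint := hdisj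
    union := rfl
    hist_eq := rfl
    info_other := fun k hk => by
      ext K
      constructor
      · exact fun hK => Or.inl ⟨hK, fun h => absurd h hk⟩
      · rintro (⟨hK, -⟩ | ⟨h, -⟩)
        · exact hK
        · exact absurd h hk
    info_self := by
      ext K
      constructor
      · intro hK
        by_cases hK₁ : K = J₁
        · subst hK₁
          exact Or.inr ⟨G.info_nonempty i K h₁, _, Or.inr ⟨rfl, rfl⟩, hpre, Or.inl hpart₁.symm⟩
        by_cases hK₂ : K = J₂
        · subst hK₂
          exact Or.inr ⟨G.info_nonempty i K h₂, _, Or.inr ⟨rfl, rfl⟩, hpre, Or.inr hpart₂.symm⟩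
        · exact Or.inl ⟨Or.inl ⟨hK, fun _ => ⟨hK₁, hK₂⟩⟩, hnot K hK hK₁ hK₂⟩
      · rintro (⟨⟨hK, -⟩ | ⟨-, rfl⟩, hK'⟩ | ⟨-, L, ⟨hL, hL'⟩ | ⟨-, rfl⟩, hpreL, hKL⟩)
        · exact hK
        · exact absurd hpre hK'
        · exact absurd hpreL (hnot L hL (hL' rfl).1 (hL' rfl).2)
        · rcases hKL with rfl | rfl
          · rwa [hpart₁]
          · rwa [hpart₂]
    outcome_eq := fun _ _ => rfl }

/-! ### The next transformation -/

/-- If every path after the choice of `a` passes a further decision node of `i`, and these nodes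
form one information set, then it can be coalesced. -/
theorem coalescible (F : FinalStage G i I a) (hS : ¬ (G.splitNodes i I a).Nonempty) {J}
    (hJ : J ∈ G.info i) (hf : ∃ h ∈ J, Follows i I a h)
    (hu : ∀ h, G.Active i h → Follows i I a h → h ∈ J) : Coalescible G i I J a := by
  classical
  have hfol : ∀ h ∈ J, Follows i I a h := fun h hh =>
    hf.elim fun h' hh' => follows_of_mem_info F.info_mem hJ hh'.1 hh hh'.2
  obtain ⟨h₀, hh₀, g₀, hg₀, p₀, hp₀, hgh₀⟩ := hf
  have hstrict : ∀ {g h : History (Report Θ)} {p : ActionProfile (Report Θ)}, g ++ [p] <+: h →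
      Precedes g h := fun {g h p} h1 => ⟨(List.prefix_append _ _).trans h1, by
    rintro rfl
    exact not_snoc_prefix_self h1⟩
  refine ⟨⟨g₀, hg₀, F.available g₀ hg₀⟩, ⟨F.info_mem, hJ, ⟨h₀, hh₀, g₀, hg₀, hstrict hgh₀⟩, ?_,
    g₀, hg₀, h₀, hh₀, p₀, hp₀, hgh₀⟩, ?_⟩
  -- An information set between `I` and `J` would give `i` two moves after `a`.
  · rintro ⟨K, hK, ⟨l, hl, g, hg, hgl, hgne⟩, k, hk, l', hl', hlk, hlne⟩
    obtain ⟨q, hq⟩ := exists_snoc_prefix hgl hgne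
    obtain ⟨g', hg', q', hq', -⟩ := recall_snoc hK F.info_mem hg hl hl' hq
    obtain ⟨g₁, hg₁, p, hp, h1⟩ := hfol k hk
    have hkm := mem_hist_of_mem_info hJ hk
    obtain rfl := info_antichain F.info_mem hg₁ hg' hkm ((List.prefix_append _ _).trans h1)
      ((List.prefix_append _ _).trans (hq'.trans hlk))
    obtain rfl := snoc_prefix_unique h1 (hq'.trans hlk)
    exact hlne (F.last g₁ hg₁ p l' k hp hq' (G.info_active i K hK l' hl')
      (G.info_active i J hJ k hk) hlk)
  · ext θ
    constructor
    · rintro ⟨g, hg, hθ⟩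
      obtain ⟨t, ht⟩ := a.2
      -- Completing `θ` by a type in `a` makes the truthful path choose `a` at `g`.
      let θ' : (j : N) → Θ j := fun j => if h : j = i then h ▸ t else θ ⟨j, h⟩
      have hti : θ' i = t := by simp [θ']
      have htj : ∀ j : {j : N // j ≠ i}, θ' j = θ j := fun j => by simp [θ', j.2]
      have hθ' : θ' ∈ reportedAll g := by
        intro j
        by_cases hj : j = i
        · subst hj
          rw [hti]
          exact available_subset (F.available g hg) ht
        · rw [htj ⟨j, hj⟩]
          exact hθ ⟨j, hj⟩
      obtain ⟨q, hq, -⟩ := F.available g hg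
      obtain ⟨p, hp, hθp⟩ := exists_snoc hq hθ'
      obtain ⟨b, hb, hbm⟩ := (G.info_active i I F.info_mem g hg).exists_eq_some hp
        (List.prefix_refl _)
      have hbt := mem_of_snoc_prefix hp (List.prefix_refl _) hb hθp
      rw [hti] at hbt
      obtain rfl := available_unique hbm (F.available g hg) hbt ht
      obtain ⟨z, hz, hpz, hθz⟩ := exists_terminal hp hθp
      by_contra hno
      refine hS ⟨z, hz, ?_, g, hg, hstrict hpz⟩
      -- If the path avoided `J`, agent `i` would make no further move, and `z` would be a node at
      -- which `a` can be split.
      have hd : decisions i z = decisions i (g ++ [p]) := by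
        refine decisions_eq_of_not_active hz.1 hpz fun h h1 h2 _ hact => hno ?_
        refine ⟨h, hu h hact ⟨g, hg, p, hb, h1⟩, fun j => ?_⟩
        rw [← htj]
        exact reportedAll_anti hz.1 h2 hθz j
      rw [reported_eq_of_decisions hd, reported_snoc_some hb]
    · rintro ⟨k, hk, hθ⟩
      obtain ⟨g, hg, p, -, hgk⟩ := hfol k hk
      exact ⟨g, hg, fun j => reported_anti (mem_hist_of_mem_info hJ hk)
        ((List.prefix_append _ _).trans hgk) (hθ j)⟩

/-- Some path after the choice of `a` passes a further decision node of `i`, if none ends. -/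
theorem exists_follows (F : FinalStage G i I a) (hS : ¬ (G.splitNodes i I a).Nonempty) :
    ∃ h, G.Active i h ∧ Follows i I a h := by
  obtain ⟨g, hg⟩ := G.info_nonempty i I F.info_mem
  obtain ⟨p, hp, hpa⟩ := F.available g hg
  obtain ⟨θ, hθ⟩ := reportedAll_nonempty G (g ++ [p])
  obtain ⟨z, hz, hpz, -⟩ := exists_terminal hp hθ
  by_contra hno
  push Not at hno
  refine hS ⟨z, hz, ?_, g, hg, (List.prefix_append _ _).trans hpz, ?_⟩
  · rw [reported_eq_of_decisions (decisions_eq_of_not_active hz.1 hpz fun h h1 h2 _ hact =>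
      hno h hact ⟨g, hg, p, hpa, h1⟩), reported_snoc_some hpa]
  · rintro rfl
    exact not_snoc_prefix_self hpz

end FinalStage

/-- Without idle moves, there is a final stage unless all agents reveal their types at once. -/
theorem NoIdleMoves.exists_finalStage (hG : G.NoIdleMoves) {h₀} {a₀ : Report Θ i}
    (ha₀ : a₀ ∈ G.available i h₀) (hn : a₀.1.Nontrivial) : ∃ I a, FinalStage G i I a := by
  obtain ⟨T, hT⟩ := G.bounded
  -- Maximizing the number of previous decisions over all non-singleton actions of `i` forces her
  -- later actions to be singletons.
  let B : Set ℕ := {n | ∃ h, ∃ a : Report Θ i, a ∈ G.available i h ∧ a.1.Nontrivial ∧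
    (decisions i h).length = n}
  have hB : BddAbove B := by
    refine ⟨T, ?_⟩
    rintro n ⟨h, a, ha, -, rfl⟩
    exact (List.length_filterMap_le _ _).trans (hT h (activeAt_of_available ha).mem)
  obtain ⟨h, a, ha, han, hlen⟩ : sSup B ∈ B := Nat.sSup_mem ⟨_, h₀, a₀, ha₀, hn, rfl⟩ hB
  obtain ⟨I, hI, hh⟩ := exists_info (activeAt_of_available ha)
  have hsub : ∀ g ∈ I, ∀ (p : ActionProfile (Report Θ)) h', g ++ [p] <+: h' → G.Active i h' →
      ∀ c ∈ G.available i h', ∃ t, c.1 = {t} := by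
    intro g hg p h' h1 hact c hc
    rcases c.1.subsingleton_or_nontrivial with hs | hs
    · obtain ⟨t, ht⟩ := c.2
      exact ⟨t, hs.eq_singleton_of_mem ht⟩
    · have h2 : (decisions i h').length ≤ sSup B := le_csSup hB ⟨h', c, hc, hs, rfl⟩
      have h3 := active_decisions_lt (G.info_active i I hI g hg) hact.mem
        ((List.prefix_append _ _).trans h1) (by
          rintro rfl
          exact not_snoc_prefix_self h1)
      rw [G.recall_decisions i I hI g hg h hh] at h3
      omega
  have hlast : ∀ g ∈ I, ∀ (p : ActionProfile (Report Θ)) (h h' : History (Report Θ)),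
      p i = some a → g ++ [p] <+: h → G.Active i h → G.Active i h' → h <+: h' → h = h' := by
    intro g hg p l l' hp h1 hact hact' hll
    by_contra hne
    obtain ⟨q, hq⟩ := exists_snoc_prefix hll hne
    obtain ⟨c, hc, hcm⟩ := hact.exists_eq_some hact'.mem hq
    obtain ⟨t, ht⟩ := hsub g hg p l h1 hact c hcm
    -- After the singleton report `c`, another move would be idle.
    have h2 := reported_anti (i := i) hact'.mem hq
    rw [reported_snoc_some hc, ht] at h2
    refine (hG i l' ?_ hact').not_subset_singleton h2
    rintro rfl
    simp at hq
  refine ⟨I, a, hI, fun g hg => available_of_info hI hh hg ha, han, hlast, ?_⟩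
  intro g hg p l hp h1 hact c
  have hr : reported i l = a.1 := by
    rw [reported_eq_of_decisions (decisions_eq_of_not_active hact.mem h1 fun l' h2 h3 hne hact' =>
      hne (hlast g hg p l' l hp h2 hact' hact h3)), reported_snoc_some hp]
  constructor
  · intro hc
    obtain ⟨t, ht⟩ := hsub g hg p l h1 hact c hc
    refine ⟨t, ?_, ht⟩
    rw [← hr]
    exact available_subset hc (by simp [ht])
  · rintro ⟨t, hta, hct⟩
    rw [← hr] at hta
    obtain ⟨b, hb, htb⟩ := exists_available hact hta
    obtain ⟨t', ht'⟩ := hsub g hg p l h1 hact b hb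
    have h2 : t = t' := by rw [ht'] at htb; exact htb
    obtain rfl : b = c := Subtype.ext (by rw [ht', hct, h2])
    exact hb

/-- Singleton reports at the root leave nothing to distinguish, so without idle moves nobody moves
again. -/
theorem NoIdleMoves.isDirect [Nonempty N] (hG : G.NoIdleMoves)
    (h : ∀ i, ∀ a ∈ G.available i [], ¬ a.1.Nontrivial) : G.IsDirect := by
  have hsing : ∀ {i} {a : Report Θ i}, a ∈ G.available i [] → ∀ t ∈ a.1,
      a = ⟨{t}, Set.singleton_nonempty _⟩ := fun {i a} ha t ht =>
    Subtype.ext ((Set.not_nontrivial_iff.1 (h i a ha)).eq_singleton_of_mem ht)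
  have hact : ∀ i h, G.Active i h → h = [] := by
    intro i l hl
    by_contra hne
    obtain ⟨p, hp⟩ := exists_snoc_prefix (List.nil_prefix (l := l)) (Ne.symm hne)
    obtain ⟨b, hb, hbm⟩ := (G.root_active i).exists_eq_some hl.mem hp
    have h1 := reported_anti (i := i) hl.mem hp
    rw [reported_snoc_some hb] at h1
    exact h i b hbm ((hG i l hne hl).mono h1)
  have hpath : ∀ p, [] ++ [p] ∈ G.hist → ∀ θ ∈ reportedAll ([] ++ [p]),
      p = fun i => some (⟨{θ i}, Set.singleton_nonempty _⟩ : Report Θ i) := by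
    intro p hp θ hθ
    funext i
    obtain ⟨b, hb, hbm⟩ := (G.root_active i).exists_eq_some hp (List.prefix_refl _)
    rw [hb, hsing hbm (θ i) (mem_of_snoc_prefix hp (List.prefix_refl _) hb hθ)]
  constructor
  · ext l
    constructor
    · intro hl
      by_cases hne : l = []
      · exact Or.inl hne
      obtain ⟨p, hp⟩ := exists_snoc_prefix (List.nil_prefix (l := l)) (Ne.symm hne)
      have hpm := G.mem_of_prefix hl hp
      have hlp : [] ++ [p] = l := (terminal_of_mem hpm fun i hi => by
        have := hact i _ hi
        simp at this).eq_of_prefix hl hp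
      obtain ⟨θ, hθ⟩ := reportedAll_nonempty G ([] ++ [p])
      refine Or.inr ⟨θ, ?_⟩
      rw [← hlp, hpath p hpm θ hθ]
      rfl
    · rintro (rfl | ⟨θ, rfl⟩)
      · exact G.nil_mem
      -- An active agent guarantees that the root has a successor.
      · obtain ⟨i⟩ := ‹Nonempty N›
        obtain ⟨q, hq, -⟩ := G.root_active i
        obtain ⟨p, hp, hθp⟩ := exists_snoc hq (θ := θ) fun _ => trivial
        have := hpath p hp θ hθp
        rw [this] at hp
        exact hp
  · intro i
    obtain ⟨K, hK, hmem⟩ := exists_info (G.root_active i)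
    have hsub : ∀ L ∈ G.info i, L = {[]} := by
      intro L hL
      obtain ⟨l, hl⟩ := G.info_nonempty i L hL
      refine Set.Subset.antisymm (fun k hk => hact i k (G.info_active i L hL k hk)) ?_
      rintro k rfl
      rwa [← hact i l (G.info_active i L hL l hl)]
    ext L
    constructor
    · exact hsub L
    · rintro rfl
      rwa [← hsub K hK]

end GradualMechanism

/-! ### Termination -/

namespace GradualMechanism

open GameForm

variable {N : Type u} {Θ : N → Type v} {X : Type w} {f : ((i : N) → Θ i) → X}
  {G : GradualMechanism f} {i : N} {I J J₁ J₂ : Set (History (Report Θ))} {a a₁ a₂ : Report Θ i}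

/-- Pairs of type profiles that are not separated at the end. -/
def sameCell (G : GradualMechanism f) : Set (((i : N) → Θ i) × ((i : N) → Θ i)) :=
  {x | ∃ z, G.Terminal z ∧ x.1 ∈ reportedAll z ∧ x.2 ∈ reportedAll z}

/-- All information sets, labelled with their owners. -/
def allInfo (G : GradualMechanism f) : Set (N × Set (History (Report Θ))) :=
  {x | x.2 ∈ G.info x.1}

theorem sameCell_finite [Finite N] [∀ i, Finite (Θ i)] (G : GradualMechanism f) :
    G.sameCell.Finite := Set.toFinite _

theorem hist_finite [Finite N] [∀ i, Finite (Θ i)] (G : GradualMechanism f) : G.hist.Finite := by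
  obtain ⟨T, hT⟩ := G.bounded
  exact (List.finite_length_le (ActionProfile (Report Θ)) T).subset hT

theorem allInfo_finite [Finite N] [∀ i, Finite (Θ i)] (G : GradualMechanism f) :
    G.allInfo.Finite := by
  refine (Set.finite_univ.prod G.hist_finite.finite_subsets).subset ?_
  rintro ⟨k, K⟩ hK
  exact ⟨trivial, fun h hh => mem_hist_of_mem_info hK hh⟩

theorem ncard_lt_of_subset_image {α β : Type*} {A : Set α} {B : Set β} (hA : A.Finite) {x : α}
    (hx : x ∈ A) (g : α → β) (h : B ⊆ g '' (A \ {x})) : B.ncard < A.ncard :=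
  calc B.ncard ≤ (g '' (A \ {x})).ncard := Set.ncard_le_ncard h (hA.sdiff.image g)
    _ ≤ (A \ {x}).ncard := Set.ncard_image_le hA.sdiff
    _ < A.ncard := Set.ncard_sdiff_singleton_lt_of_mem hx hA

/-- Two profiles in the cell of a split node that differ only in a type from `a₁` and a type from
`a₂` share a cell before the split but not after it. -/
theorem IsSPL.sameCell_ssubset {Gs : GradualMechanism f} (H : IsSPL G Gs i I a a₁ a₂) :
    Gs.sameCell ⊂ G.sameCell := by
  classical
  constructor
  · rintro x ⟨z, hz, h1, h2⟩
    obtain ⟨m, hm, -, h3⟩ := H.outcome_eq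
    exact ⟨m z, hm hz, (h3 z hz).1 h1, (h3 z hz).1 h2⟩
  · intro hsub
    obtain ⟨z, hz⟩ := H.nodes_nonempty
    obtain ⟨θ, hθ⟩ := reportedAll_nonempty G z
    obtain ⟨t₁, ht₁⟩ := a₁.2
    obtain ⟨t₂, ht₂⟩ := a₂.2
    have hmem : ∀ t, t ∈ a₁.1 ∪ a₂.1 → Function.update θ i t ∈ reportedAll z := fun t ht =>
      update_mem_reportedAll (by rwa [hz.2.1, ← H.union]) fun j _ => hθ j
    have h1 := hmem t₁ (Or.inl ht₁)
    obtain ⟨z', hz', h3, h4⟩ := hsub (a := (Function.update θ i t₁, Function.update θ i t₂))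
      ⟨z, hz.1, h1, hmem t₂ (Or.inr ht₂)⟩
    have hz'' := hz'.1
    rw [H.hist_eq] at hz''
    rcases hz'' with hm | ⟨z'', hz'', b, hb, rfl⟩
    -- An old history that is still terminal and contains the first profile would be `z`, but `z`
    -- now has successors.
    · have h5 : z' = z := by
        have := prefix_terminal hm hz.1 h3 h1
        refine (hz.1.eq_of_prefix hm ?_).symm
        rcases comparable hm hz.1.1 h3 h1 with h6 | h6
        · by_cases hne : z' = z
          · exact hne ▸ List.prefix_refl _
          · obtain ⟨p, hp⟩ := exists_snoc_prefix h6 hne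
            exact absurd (by rw [H.hist_eq]; exact Or.inl (G.mem_of_prefix hz.1.1 hp)) (hz'.2 p)
        · exact h6
      subst h5
      refine hz'.2 (soloProfile i a₁) ?_
      rw [H.hist_eq]
      exact Or.inr ⟨z', hz, a₁, Or.inl rfl, rfl⟩
    · have h5 : Function.update θ i t₁ i ∈ _ := h3 i
      have h6 : Function.update θ i t₂ i ∈ _ := h4 i
      rw [reported_snoc_some soloProfile_self, Function.update_self] at h5 h6
      rcases hb with rfl | rfl
      · exact Set.disjoint_left.1 H.disjoint h6 ht₂
      · exact Set.disjoint_left.1 H.disjoint ht₁ h5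

theorem NoIdleMoves.split (hG : G.NoIdleMoves) (F : FinalStage G i I a)
    (hS : (G.splitNodes i I a).Nonempty) (hd : Disjoint a₁.1 a₂.1) (hu : a₁.1 ∪ a₂.1 = a.1) :
    (F.split hS hd hu).NoIdleMoves := by
  intro k h hne hact
  rcases activeAt_splHist.1 hact with hact | ⟨rfl, hz⟩
  · exact hG k h hne hact
  · rw [hz.2.1]
    exact F.nontrivial

namespace Coalescible

theorem sameCell_subset (C : Coalescible G i I J a) : C.coalesce.sameCell ⊆ G.sameCell := by
  rintro x ⟨z, hz, h1, h2⟩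
  obtain ⟨z', hT⟩ := exists_coaMap hz.1
  exact ⟨z', C.coaMap_terminal hT hz.2, C.coaMap_reportedAll hT h1, C.coaMap_reportedAll hT h2⟩

/-- New information sets are images of old ones, and `J` contributes none because `i` is inactive at
all counterparts of its nodes. -/
theorem allInfo_ncard_lt [Finite N] [∀ i, Finite (Θ i)] (C : Coalescible G i I J a) :
    C.coalesce.allInfo.ncard < G.allInfo.ncard := by
  refine ncard_lt_of_subset_image G.allInfo_finite (x := (i, J)) C.succ.2.1
    (fun x => (x.1, {hs | ActiveAt (G.coaHist i I J a) x.1 hs ∧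
      ∃ h ∈ x.2, G.CoaMap i I J a hs h})) ?_
  rintro ⟨k, K⟩ hK
  obtain ⟨⟨hs, hhs⟩, L, hL, hKL⟩ : K.Nonempty ∧ ∃ L ∈ G.info k,
    K = {hs | ActiveAt (G.coaHist i I J a) k hs ∧ ∃ h ∈ L, G.CoaMap i I J a hs h} := hK
  subst hKL
  refine ⟨(k, L), ⟨hL, ?_⟩, rfl⟩
  intro heq
  obtain ⟨rfl, rfl⟩ := Prod.mk.inj heq
  obtain ⟨hact, h, hh, hT⟩ := hhs
  exact ((C.activeAt_coaHist hT).1 hact).2 rfl hh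

theorem noIdleMoves (C : Coalescible G i I J a) (hG : G.NoIdleMoves) :
    C.coalesce.NoIdleMoves := by
  intro k hs hne hact
  obtain ⟨h, hT⟩ := exists_coaMap (ActiveAt.mem (G := C.coalesce.toGameForm) hact)
  rw [C.coaMap_reported_active hT hact]
  refine hG k h ?_ ((C.activeAt_coaHist hT).1 hact).1
  rintro rfl
  have := C.length_le_of_coaMap hT
  exact hne (List.length_eq_zero_iff.1 (Nat.le_zero.1 this))

end Coalescible

theorem FinalStage.allInfo_merge_ncard_lt [Finite N] [∀ i, Finite (Θ i)] (F : FinalStage G i I a)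
    (h₁ : J₁ ∈ G.info i) (h₂ : J₂ ∈ G.info i) (hf : ∀ h ∈ J₁ ∪ J₂, Follows i I a h)
    (hne : J₁ ≠ J₂) : (F.merge h₁ h₂ hf).allInfo.ncard < G.allInfo.ncard := by
  classical
  -- The set `J₁` is omitted and `J₂` stands for the union.
  refine ncard_lt_of_subset_image G.allInfo_finite (x := (i, J₁)) h₁
    (fun x => if x = (i, J₂) then (i, J₁ ∪ J₂) else x) ?_
  rintro ⟨k, K⟩ (⟨hK, hK'⟩ | ⟨hk, hK⟩)
  · refine ⟨(k, K), ⟨hK, fun heq => ?_⟩, if_neg fun heq => ?_⟩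
    · obtain ⟨hk, hKJ⟩ := Prod.mk.inj heq
      exact (hK' hk).1 hKJ
    · obtain ⟨hk, hKJ⟩ := Prod.mk.inj heq
      exact (hK' hk).2 hKJ
  · refine ⟨(i, J₂), ⟨h₂, fun heq => ?_⟩, ?_⟩
    · exact hne (Prod.mk.inj heq).2.symm
    · exact (if_pos rfl).trans (Prod.ext hk.symm hK.symm)

/-- A mechanism without idle moves that is not direct can be transformed into a smaller one. -/
theorem NoIdleMoves.exists_step [Finite N] [Nonempty N] [∀ i, Finite (Θ i)] (hG : G.NoIdleMoves)
    (hD : ¬ G.IsDirect) : ∃ G₁ : GradualMechanism f, G₁.NoIdleMoves ∧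
      (G₁.sameCell.ncard < G.sameCell.ncard ∨
        (G₁.sameCell.ncard ≤ G.sameCell.ncard ∧ G₁.allInfo.ncard < G.allInfo.ncard)) ∧
      ∀ D, Nonempty (Chain G₁ D) → Nonempty (Chain G D) := by
  obtain ⟨i, a₀, ha₀, hn⟩ : ∃ i, ∃ a ∈ G.available i [], a.1.Nontrivial := by
    by_contra hno
    push Not at hno
    exact hD (hG.isDirect fun i a ha => Set.not_nontrivial_iff.2 (hno i a ha))
  obtain ⟨I, a, F⟩ := hG.exists_finalStage ha₀ hn
  by_cases hS : (G.splitNodes i I a).Nonempty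
  · obtain ⟨t, ht, t', ht', htt⟩ := F.nontrivial
    -- Any partition of `a` into two non-empty sets would do.
    let a₁ : Report Θ i := ⟨{t}, Set.singleton_nonempty t⟩
    let a₂ : Report Θ i := ⟨a.1 \ {t}, t', ht', fun h => htt h.symm⟩
    have hd : Disjoint a₁.1 a₂.1 := Set.disjoint_sdiff_right
    have hu : a₁.1 ∪ a₂.1 = a.1 := Set.union_sdiff_cancel (Set.singleton_subset_iff.2 ht)
    have H := F.isSPL_split hS hd hu
    exact ⟨F.split hS hd hu, hG.split F hS hd hu,
      Or.inl (Set.ncard_lt_ncard H.sameCell_ssubset G.sameCell_finite),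
      fun D ⟨c⟩ => ⟨.spl i I a a₁ a₂ H c⟩⟩
  · obtain ⟨h, hact, hf⟩ := F.exists_follows hS
    obtain ⟨J₁, h₁, hh₁⟩ := exists_info hact
    by_cases hu : ∀ h, G.Active i h → Follows i I a h → h ∈ J₁
    · have C := F.coalescible hS h₁ ⟨h, hh₁, hf⟩ hu
      exact ⟨C.coalesce, C.noIdleMoves hG,
        Or.inr ⟨Set.ncard_le_ncard C.sameCell_subset G.sameCell_finite, C.allInfo_ncard_lt⟩,
        fun D ⟨c⟩ => ⟨.coa i I J₁ a C.isCOA_coalesce c⟩⟩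
    · push Not at hu
      obtain ⟨h', hact', hf', hh'⟩ := hu
      obtain ⟨J₂, h₂, hh₂⟩ := exists_info hact'
      have hne : J₁ ≠ J₂ := by
        rintro rfl
        exact hh' hh₂
      have hfol : ∀ l ∈ J₁ ∪ J₂, Follows i I a l := by
        rintro l (hl | hl)
        · exact follows_of_mem_info F.info_mem h₁ hh₁ hl hf
        · exact follows_of_mem_info F.info_mem h₂ hh₂ hl hf'
      exact ⟨F.merge h₁ h₂ hfol, hG, Or.inr ⟨le_refl _, F.allInfo_merge_ncard_lt h₁ h₂ hfol hne⟩,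
        fun D ⟨c⟩ => ⟨.invILL i (J₁ ∪ J₂) J₁ J₂ (F.isILL_merge h₁ h₂ hfol hne) c⟩⟩

/-- The order must be lexicographic with cells first: an SPL adds an information set but separates
further profiles, whereas the other two steps reduce the information sets without enlarging
`sameCell`. -/
theorem NoIdleMoves.exists_chain [Finite N] [Nonempty N] [∀ i, Finite (Θ i)]
    {G : GradualMechanism f} (hG : G.NoIdleMoves) :
    ∃ D : GradualMechanism f, D.IsDirect ∧ Nonempty (Chain G D) := by
  induction hμ : (toLex (G.sameCell.ncard, G.allInfo.ncard) : ℕ ×ₗ ℕ)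
    using WellFoundedLT.induction generalizing G with
  | _ μ ih =>
    by_cases hD : G.IsDirect
    · exact ⟨G, hD, ⟨.nil G⟩⟩
    · obtain ⟨G₁, hG₁, hlt, hc⟩ := hG.exists_step hD
      obtain ⟨D, h1, h2⟩ := ih (toLex (G₁.sameCell.ncard, G₁.allInfo.ncard)) (by
        rw [← hμ, Prod.Lex.toLex_lt_toLex]
        rcases hlt with h | ⟨h, h'⟩
        · exact Or.inl h
        · rcases h.lt_or_eq with h | h
          · exact Or.inl h
          · exact Or.inr ⟨h, h'⟩) hG₁ rfl
      exact ⟨D, h1, hc D h2⟩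

end GradualMechanism

theorem theorem1 {N : Type u} [Finite N] [Nonempty N] {Θ : N → Type v} {X : Type w}
    (R : (i : N) → Θ i → X → X → Prop)
    (R_complete : ∀ (i : N) (t : Θ i) (x y : X), R i t x y ∨ R i t y x)
    (R_trans : ∀ (i : N) (t : Θ i) (x y z : X), R i t x y → R i t y z → R i t x z)
    (f : ((i : N) → Θ i) → X) (hf : StrategyProof R f) (G : GradualMechanism f) :
    ((∀ i, Finite (Θ i)) → G.NoIdleMoves →
      ∃ D : GradualMechanism f, D.IsDirect ∧ Nonempty (GradualMechanism.Chain G D)) ∧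
    ∀ D : GradualMechanism f, D.IsDirect → ∀ c : GradualMechanism.Chain G D,
      (G.IncentiveCompatible R ↔ c.AllIP R) := by
  refine ⟨fun hfin hG => ?_, fun D hD c => c.incentiveCompatible_iff hf hD⟩
  have := hfin
  exact hG.exists_chain
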